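/- **Setting.** Fix $T>0$. Let $\Omega\subset\mathbb R^3$ be a bounded domain with smooth boundary and unit outer normal $n_\Omega$. For $0\le t<T$ let $\Omega_A(t)$ be a domain with $\overline{\Omega_A(t)}\subset\Omega$ whose boundary $\Gamma(t)$ is a closed surface evolving smoothly in $t\in[0,T)$, with unit normal $n=n_\Gamma$ pointing out of $\Omega_A(t)$; put $\Omega_B(t)=\Omega\setminus\overline{\Omega_A(t)}$. $P=I-n\otimes n$, $\partial_i^\Gamma f=\sum_j(\delta_{ij}-n_in_j)\partial_jf$, and $\nabla_\Gamma$, $\operatorname{grad}_\Gamma$, $\operatorname{div}_\Gamma$ are formed from the $\partial^\Gamma_i$. $(\nabla V)_{ij}=\partial_jV_i$, $(\nabla_\Gamma V)_{ij}=\partial^\Gamma_jV_i$, $(\operatorname{div}M)_i=\sum_j\partial_jM_{ij}$ and similarly for $\operatorname{div}_\Gamma M$; $|M|^2=\sum_{ij}M_{ij}^2$. $\mathcal H^2$ is two-dimensional Hausdorff (surface) measure. For $\sharp\in\{A,B,S\}$ let the density $\rho_\sharp$, velocity $v_\sharp$, pressure $\pi_\sharp$, temperature $\theta_\sharp$, internal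 energy $e_\sharp$, conductivity $\kappa_\sharp$ and viscosities $\mu_\sharp,\lambda_\sharp$ be smooth functions on $\mathbb R^4$. Put $D_t^\sharp f=\partial_tf+(v_\sharp\cdot\nabla)f$, $D_t^Nf=\partial_tf+(v_S\cdot n)(n\cdot\nabla)f$ and $E_\sharp=\tfrac12\rho_\sharp|v_\sharp|^2+\rho_\sharp e_\sharp$. For $\sharp=A,B$ put $$D(v_\sharp)=\tfrac12(\nabla v_\sharp+{}^t\nabla v_\sharp),\quad q_\sharp=\kappa_\sharp\operatorname{grad}\theta_\sharp,\quad e_{D_\sharp}=\mu_\sharp|D(v_\sharp)|^2+\lambda_\sharp|\operatorname{div}v_\sharp|^2,\quad \mathcal T_\sharp=\mu_\sharp D(v_\sharp)+\lambda_\sharp(\operatorname{div}v_\sharp)I-\pi_\sharp I,$$ and $D_\Gamma(v_S)=\tfrac12(P\nabla_\Gamma v_S+{}^t(P\nabla_\Gamma v_S))$, $q_S=\kappa_S\operatorname{grad}_\Gamma\theta_S$, $e_{D_S}=\mu_S|D_\Gamma(v_S)|^2+\lambda_S|\operatorname{div}_\Gamma v_S|^2$, $\mathcal T_S=\mu_SD_\Gamma(v_S)+\lambda_S(\operatorname{div}_\Gamma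 v_S)P-\pi_SP$. Let $r\in\{0,1\}$; for $\sharp=A,B$ let $\widetilde{\mathcal T}_\sharp=\mathcal T_\sharp$ if $r=1$, and let $\widetilde{\mathcal T}_\sharp$ be the scalar $\mu_\sharp\, n\cdot(n\cdot\nabla)v_\sharp+\lambda_\sharp\operatorname{div}v_\sharp-\pi_\sharp$ if $r=0$. *The system*, for $0<t<T$: for $\sharp=A,B$, in $\Omega_\sharp(t)$, $$D_t^\sharp\rho_\sharp+(\operatorname{div}v_\sharp)\rho_\sharp=0,\quad \rho_\sharp D_t^\sharp e_\sharp+(\operatorname{div}v_\sharp)\pi_\sharp=\operatorname{div}q_\sharp+e_{D_\sharp},\quad \rho_\sharp D_t^\sharp v_\sharp=\operatorname{div}\mathcal T_\sharp,$$ and on $\Gamma(t)$ $$D_t^S\rho_S+(\operatorname{div}_\Gamma v_S)\rho_S=0,\quad \rho_SD_t^Se_S+(\operatorname{div}_\Gamma v_S)\pi_S=\operatorname{div}_\Gamma q_S+e_{D_S}+q_B\cdot n-q_A\cdot n,\quad \rho_SD_t^Sv_S=\operatorname{div}_\Gamma\mathcal T_S+\widetilde{\mathcal T}_Bn-\widetilde{\mathcal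 T}_An.$$ *The boundary conditions*, for $0<t<T$: $v_B=0$ and $(n_\Omega\cdot\nabla)\theta_B=0$ on $\partial\Omega$; $v_A\cdot n=v_B\cdot n=v_S\cdot n$, $Pv_A=Pv_B=rPv_S$ and $\theta_A=\theta_B=\theta_S$ on $\Gamma(t)$. *Flow by the velocities.* $\Omega\times(0,T)$ is flowed by $(v_A,v_B,v_S)$ if for all $f\in C^1(\mathbb R^4)$ and $0<t<T$, $$\frac{d}{dt}\int_{\Omega_\sharp(t)}f\,dx=\int_{\Omega_\sharp(t)}\{D_t^\sharp f+(\operatorname{div}v_\sharp)f\}\,dx\ (\sharp=A,B),\qquad \frac{d}{dt}\int_{\Gamma(t)}f\,d\mathcal H^2=\int_{\Gamma(t)}\{D_t^Sf+(\operatorname{div}_\Gamma v_S)f\}\,d\mathcal H^2 .$$ **Theorem 2.8 (Conservative forms and conservation laws).** (i) Any solution of the system satisfies, for $0<t<T$: for $\sharp=A,B$, in $\Omega_\sharp(t)$, $$\partial_t\rho_\sharp+\operatorname{div}(\rho_\sharp v_\sharp)=0,\quad \partial_tE_\sharp+\operatorname{div}(E_\sharp v_\sharp-q_\sharp-\mathcal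 T_\sharp v_\sharp)=0,\quad \partial_t(\rho_\sharp v_\sharp)+\operatorname{div}(\rho_\sharp v_\sharp\otimes v_\sharp-\mathcal T_\sharp)=0,$$ and on $\Gamma(t)$ $$D_t^N\rho_S+\operatorname{div}_\Gamma(\rho_Sv_S)=0,$$ $$D_t^NE_S+\operatorname{div}_\Gamma(E_Sv_S-q_S-\mathcal T_Sv_S)=\widetilde{\mathcal T}_Bn\cdot v_S-\widetilde{\mathcal T}_An\cdot v_S+q_B\cdot n-q_A\cdot n,$$ $$D_t^N(\rho_Sv_S)+\operatorname{div}_\Gamma(\rho_Sv_S\otimes v_S-\mathcal T_S)=\widetilde{\mathcal T}_Bn-\widetilde{\mathcal T}_An .$$ (ii) Suppose that $\Omega\times(0,T)$ is flowed by $(v_A,v_B,v_S)$ and that the boundary conditions hold. Then any solution of the system satisfies, for all $0\le t_1<t_2<T$: the total mass $\int_{\Omega_A(t)}\rho_A\,dx+\int_{\Omega_B(t)}\rho_B\,dx+\int_{\Gamma(t)}\rho_S\,d\mathcal H^2$ and the total energy $\int_{\Omega_A(t)}E_A\,dx+\int_{\Omega_B(t)}E_B\,dx+\int_{\Gamma(t)}E_S\,d\mathcal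 H^2$ take the same values at $t=t_1$ and $t=t_2$, and with $K(t)=\int_{\Omega_A(t)}\tfrac12\rho_A|v_A|^2dx+\int_{\Omega_B(t)}\tfrac12\rho_B|v_B|^2dx+\int_{\Gamma(t)}\tfrac12\rho_S|v_S|^2d\mathcal H^2$, $$K(t_2)+\int_{t_1}^{t_2}\!\Big(\int_{\Omega_A(t)}e_{D_A}dx+\int_{\Omega_B(t)}e_{D_B}dx+\int_{\Gamma(t)}e_{D_S}d\mathcal H^2\Big)dt$$ $$=K(t_1)+\int_{t_1}^{t_2}\!\Big(\int_{\Omega_A(t)}(\operatorname{div}v_A)\pi_A\,dx+\int_{\Omega_B(t)}(\operatorname{div}v_B)\pi_B\,dx+\int_{\Gamma(t)}(\operatorname{div}_\Gamma v_S)\pi_S\,d\mathcal H^2\Big)dt .$$ (iii) Suppose in addition to the assumptions of (ii) that $r=1$ and $\int_{\partial\Omega}\mathcal T_Bn_\Omega\,d\mathcal H^2=0$ for $0<t<T$. Then for any solution of the system and all $0\le t_1<t_2<T$ the total momentum $\int_{\Omega_A(t)}\rho_Av_A\,dx+\int_{\Omega_B(t)}\rho_Bv_B\,dx+\int_{\Gamma(t)}\rho_Sv_S\,d\mathcal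 H^2$ takes the same values at $t=t_1$ and $t=t_2$. -/

import Mathlib

open MeasureTheory Set Filter Topology Matrix
open scoped ContDiff

noncomputable section

namespace TwoPhaseSurfaceFlow

/-- Physical space `ℝ³` with its Euclidean distance. -/
abbrev E3 := EuclideanSpace ℝ (Fin 3)

/-- Column vectors (values of velocities, normals, fluxes), with dot product `⬝ᵥ`. -/
abbrev Vec3 := Fin 3 → ℝ

/-- `3 × 3` matrices (values of tensor fields). -/
abbrev Mat3 := Matrix (Fin 3) (Fin 3) ℝ

/-! ### Differential operators in space (at a fixed time) -/

/-- `∂ᵢ g`. -/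
def pd (i : Fin 3) (g : E3 → ℝ) (x : E3) : ℝ :=
  fderiv ℝ g x (EuclideanSpace.single i 1)

/-- `grad g = (∂₁ g, ∂₂ g, ∂₃ g)`. -/
def grad (g : E3 → ℝ) (x : E3) : Vec3 := fun i => pd i g x

/-- `div V = ∑ᵢ ∂ᵢ Vᵢ`. -/
def div (V : E3 → Vec3) (x : E3) : ℝ := ∑ i, pd i (fun y => V y i) x

/-- `(div M)ᵢ = ∑ⱼ ∂ⱼ Mᵢⱼ` for a matrix field `M`. -/
def divMat (M : E3 → Mat3) (x : E3) : Vec3 := fun i => ∑ j, pd j (fun y => M y i j) x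

/-- `(∇V)ᵢⱼ = ∂ⱼ Vᵢ`. -/
def jac (V : E3 → Vec3) (x : E3) : Mat3 := Matrix.of fun i j => pd j (fun y => V y i) x

/-- The strain rate tensor `D(V) = (∇V + ᵗ(∇V)) / 2`. -/
def strain (V : E3 → Vec3) (x : E3) : Mat3 := (1 / 2 : ℝ) • (jac V x + (jac V x)ᵀ)

/-- The Frobenius inner product `M : N = ∑ᵢⱼ Mᵢⱼ Nᵢⱼ`. -/
def frob (M N : Mat3) : ℝ := ∑ i, ∑ j, M i j * N i j

/-! ### The boundary surface of a region and its operators -/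

/-- `ν` is the unit outer normal at the boundary point `x` of `U`: near `x` the set `U` is
`{g < 0}` for a `C¹` function `g` with `g x = 0`, and `grad g x` is a positive multiple of the
unit vector `ν`. There is at most one such `ν`. -/
def IsOuterUnitNormal (U : Set E3) (x : E3) (ν : Vec3) : Prop :=
  ν ⬝ᵥ ν = 1 ∧ ∃ g : E3 → ℝ, ContDiffAt ℝ 1 g x ∧ g x = 0 ∧
    (∀ᶠ y in 𝓝 x, y ∈ U ↔ g y < 0) ∧ ∃ c : ℝ, 0 < c ∧ grad g x = c • ν

open Classical in
/-- The unit outer normal of `U` at its boundary points (zero where there is none). -/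
def outerNormal (U : Set E3) (x : E3) : Vec3 :=
  if h : ∃ ν, IsOuterUnitNormal U x ν then h.choose else 0

/-- The orthogonal projection `P = I - n ⊗ n` onto the tangent plane of `frontier U`. -/
def tproj (U : Set E3) (x : E3) : Mat3 :=
  1 - vecMulVec (outerNormal U x) (outerNormal U x)

/-- The tangential derivative `∂ᵢ^Γ g` on `Γ = frontier U`: the derivative of `g` along `Γ` in the
tangent direction `P eᵢ`. It depends on the values of `g` on `Γ` only, so that it also applies to
functions given only on `Γ` (such as those built from the normal); if `g` is differentiable
in a neighbourhood it equals `∑ⱼ (δᵢⱼ - nᵢ nⱼ) ∂ⱼ g`, because a derivative within `Γ` is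
determined on the tangent directions of `Γ`. -/
def tpd (U : Set E3) (i : Fin 3) (g : E3 → ℝ) (x : E3) : ℝ :=
  fderivWithin ℝ g (frontier U) x (WithLp.toLp 2 (tproj U x *ᵥ Pi.single i 1))

/-- `grad_Γ g`. -/
def tgrad (U : Set E3) (g : E3 → ℝ) (x : E3) : Vec3 := fun i => tpd U i g x

/-- `div_Γ V = ∑ᵢ ∂ᵢ^Γ Vᵢ`. -/
def tdiv (U : Set E3) (V : E3 → Vec3) (x : E3) : ℝ := ∑ i, tpd U i (fun y => V y i) x

/-- `(div_Γ M)ᵢ = ∑ⱼ ∂ⱼ^Γ Mᵢⱼ` for a matrix field `M`. -/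
def tdivMat (U : Set E3) (M : E3 → Mat3) (x : E3) : Vec3 :=
  fun i => ∑ j, tpd U j (fun y => M y i j) x

/-- `(∇_Γ V)ᵢⱼ = ∂ⱼ^Γ Vᵢ`. -/
def tjac (U : Set E3) (V : E3 → Vec3) (x : E3) : Mat3 :=
  Matrix.of fun i j => tpd U j (fun y => V y i) x

/-- The surface strain tensor `D_Γ(V) = (P ∇_Γ V + ᵗ(P ∇_Γ V)) / 2`. -/
def tstrain (U : Set E3) (V : E3 → Vec3) (x : E3) : Mat3 :=
  (1 / 2 : ℝ) • (tproj U x * tjac U V x + (tproj U x * tjac U V x)ᵀ)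

/-! ### Time derivatives. A time dependent field is written `f t x`. -/

/-- `∂ₜ f`. -/
def dt (f : ℝ → E3 → ℝ) (t : ℝ) (x : E3) : ℝ := deriv (fun s => f s x) t

/-- The material derivative `∂ₜ f + (v · ∇) f`. -/
def matD (v : ℝ → E3 → Vec3) (f : ℝ → E3 → ℝ) (t : ℝ) (x : E3) : ℝ :=
  dt f t x + v t x ⬝ᵥ grad (f t) x

/-- The normal time derivative `D_t^N f = ∂ₜ f + (v · n_Γ) (n_Γ · ∇) f`, `Γ(t) = frontier (U t)`. -/
def normD (U : ℝ → Set E3) (v : ℝ → E3 → Vec3) (f : ℝ → E3 → ℝ) (t : ℝ) (x : E3) : ℝ :=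
  dt f t x + (v t x ⬝ᵥ outerNormal (U t) x) * (outerNormal (U t) x ⬝ᵥ grad (f t) x)

/-! ### The moving geometry -/

/-- A bounded domain with smooth boundary: nonempty, connected, bounded, and equal to `{ψ < 0}`
for a smooth `ψ` whose gradient does not vanish on `{ψ = 0}` (which is then the boundary). -/
structure IsSmoothBoundedDomain (Ω : Set E3) : Prop where
  bounded : Bornology.IsBounded Ω
  connected : IsConnected Ω
  smooth : ∃ ψ : E3 → ℝ, ContDiff ℝ ∞ ψ ∧ Ω = {x | ψ x < 0} ∧ ∀ x, ψ x = 0 → fderiv ℝ ψ x ≠ 0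

/-- The moving geometry on `0 ≤ t < T`: `Ω_A(t)` is a bounded domain with closure in `Ω` whose
boundary `Γ(t)` is a smoothly evolving closed surface, that is, `Ω_A(t) = {φ(·,t) < 0}` and
`Γ(t) = {φ(·,t) = 0}` for a function `φ` smooth in space and time whose spatial gradient does not
vanish on `Γ(t)`. -/
structure IsMovingGeometry (T : ℝ) (Ω : Set E3) (ΩA : ℝ → Set E3) : Prop where
  T_pos : 0 < T
  outer : IsSmoothBoundedDomain Ω
  connected : ∀ t ∈ Ico 0 T, IsConnected (ΩA t)
  closure_subset : ∀ t ∈ Ico 0 T, closure (ΩA t) ⊆ Ω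
  smooth : ∃ φ : ℝ → E3 → ℝ,
    ContDiffOn ℝ ∞ (fun p : ℝ × E3 => φ p.1 p.2) (Iio T ×ˢ univ) ∧
    ∀ t ∈ Ico 0 T, ΩA t = {x | φ t x < 0} ∧ ∀ x, φ t x = 0 → fderiv ℝ (φ t) x ≠ 0

/-- The exterior phase `Ω_B(t) = Ω \ closure (Ω_A(t))`. -/
def phaseB (Ω : Set E3) (ΩA : ℝ → Set E3) (t : ℝ) : Set E3 := Ω \ closure (ΩA t)

/-- The regions and the surface are flowed by the velocity fields `(v_A, v_B, v_S)`: for every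
`f ∈ C¹(ℝ⁴)` and `0 < t < T`, the rate of change of the integral of `f` over `Ω_A(t)`, `Ω_B(t)`,
`Γ(t) = frontier (Ω_A(t))` is that of a region (surface) carried along by the velocity. -/
structure IsFlowedBy (T : ℝ) (Ω : Set E3) (ΩA : ℝ → Set E3) (vA vB vS : ℝ → E3 → Vec3) :
    Prop where
  inA : ∀ f : ℝ → E3 → ℝ, ContDiff ℝ 1 (fun p : ℝ × E3 => f p.1 p.2) → ∀ t ∈ Ioo 0 T,
    HasDerivAt (fun s => ∫ x in ΩA s, f s x)
      (∫ x in ΩA t, (matD vA f t x + div (vA t) x * f t x)) t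
  inB : ∀ f : ℝ → E3 → ℝ, ContDiff ℝ 1 (fun p : ℝ × E3 => f p.1 p.2) → ∀ t ∈ Ioo 0 T,
    HasDerivAt (fun s => ∫ x in phaseB Ω ΩA s, f s x)
      (∫ x in phaseB Ω ΩA t, (matD vB f t x + div (vB t) x * f t x)) t
  onS : ∀ f : ℝ → E3 → ℝ, ContDiff ℝ 1 (fun p : ℝ × E3 => f p.1 p.2) → ∀ t ∈ Ioo 0 T,
    HasDerivAt (fun s => ∫ x in frontier (ΩA s), f s x ∂μHE[2])
      (∫ x in frontier (ΩA t), (matD vS f t x + tdiv (ΩA t) (vS t) x * f t x) ∂μHE[2]) t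

/-! ### The fluids -/

/-- The unknowns and coefficients of one fluid. -/
structure Fluid where
  /-- density -/
  ρ : ℝ → E3 → ℝ
  /-- velocity -/
  v : ℝ → E3 → Vec3
  /-- pressure -/
  π : ℝ → E3 → ℝ
  /-- temperature -/
  θ : ℝ → E3 → ℝ
  /-- internal energy -/
  e : ℝ → E3 → ℝ
  /-- thermal conductivity -/
  κ : ℝ → E3 → ℝ
  /-- first viscosity -/
  μ : ℝ → E3 → ℝ
  /-- second viscosity -/
  lam : ℝ → E3 → ℝ

namespace Fluid

/-- All fields are smooth functions on `ℝ⁴`. -/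
structure Smooth (F : Fluid) : Prop where
  ρ : ContDiff ℝ ∞ (fun p : ℝ × E3 => F.ρ p.1 p.2)
  v : ContDiff ℝ ∞ (fun p : ℝ × E3 => F.v p.1 p.2)
  π : ContDiff ℝ ∞ (fun p : ℝ × E3 => F.π p.1 p.2)
  θ : ContDiff ℝ ∞ (fun p : ℝ × E3 => F.θ p.1 p.2)
  e : ContDiff ℝ ∞ (fun p : ℝ × E3 => F.e p.1 p.2)
  κ : ContDiff ℝ ∞ (fun p : ℝ × E3 => F.κ p.1 p.2)
  μ : ContDiff ℝ ∞ (fun p : ℝ × E3 => F.μ p.1 p.2)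
  lam : ContDiff ℝ ∞ (fun p : ℝ × E3 => F.lam p.1 p.2)

variable (F : Fluid)

/-- Kinetic energy density `ρ |v|² / 2`. -/
def kinetic (t : ℝ) (x : E3) : ℝ := F.ρ t x * (F.v t x ⬝ᵥ F.v t x) / 2

/-- Total energy density `E = ρ |v|² / 2 + ρ e`. -/
def energy (t : ℝ) (x : E3) : ℝ := F.kinetic t x + F.ρ t x * F.e t x

/-- Momentum density `ρ v`. -/
def momentum (t : ℝ) (x : E3) : Vec3 := F.ρ t x • F.v t x

/-- Momentum flux `ρ v ⊗ v`. -/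
def momentumFlux (t : ℝ) (x : E3) : Mat3 := F.ρ t x • vecMulVec (F.v t x) (F.v t x)

/-- Bulk heat flux `q = κ grad θ`. -/
def heat (t : ℝ) (x : E3) : Vec3 := F.κ t x • grad (F.θ t) x

/-- Bulk dissipation density `e_D = μ |D(v)|² + λ |div v|²`. -/
def dissip (t : ℝ) (x : E3) : ℝ :=
  F.μ t x * frob (strain (F.v t) x) (strain (F.v t) x) + F.lam t x * div (F.v t) x ^ 2

/-- Bulk stress tensor `𝒯 = μ D(v) + λ (div v) I - π I`. -/
def stress (t : ℝ) (x : E3) : Mat3 :=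
  F.μ t x • strain (F.v t) x + (F.lam t x * div (F.v t) x) • (1 : Mat3) - F.π t x • (1 : Mat3)

/-- Surface heat flux `q_S = κ grad_Γ θ`, where `Γ(t) = frontier (U t)`. -/
def surfHeat (U : ℝ → Set E3) (t : ℝ) (x : E3) : Vec3 := F.κ t x • tgrad (U t) (F.θ t) x

/-- Surface dissipation density `μ |D_Γ(v)|² + λ |div_Γ v|²`. -/
def surfDissip (U : ℝ → Set E3) (t : ℝ) (x : E3) : ℝ :=
  F.μ t x * frob (tstrain (U t) (F.v t) x) (tstrain (U t) (F.v t) x) +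
    F.lam t x * tdiv (U t) (F.v t) x ^ 2

/-- Surface stress tensor `𝒯_S = μ D_Γ(v) + λ (div_Γ v) P_Γ - π P_Γ`. -/
def surfStress (U : ℝ → Set E3) (t : ℝ) (x : E3) : Mat3 :=
  F.μ t x • tstrain (U t) (F.v t) x + (F.lam t x * tdiv (U t) (F.v t) x) • tproj (U t) x -
    F.π t x • tproj (U t) x

/-- The interface stress of a bulk fluid on `Γ(t) = frontier (U t)`: for `r = 0` the scalar
`μ n · (n · ∇) v + λ div v - π` (as a multiple of the identity), otherwise the stress tensor. -/
def interfaceStress (r : ℕ) (U : ℝ → Set E3) (t : ℝ) (x : E3) : Mat3 :=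
  if r = 0 then
    (F.μ t x * (outerNormal (U t) x ⬝ᵥ (jac (F.v t) x *ᵥ outerNormal (U t) x)) +
      F.lam t x * div (F.v t) x - F.π t x) • (1 : Mat3)
  else F.stress t x

end Fluid

/-- The traction jump `𝒯̃_B n_Γ - 𝒯̃_A n_Γ` on `Γ(t)`. -/
def tractionJump (r : ℕ) (ΩA : ℝ → Set E3) (A B : Fluid) (t : ℝ) (x : E3) : Vec3 :=
  B.interfaceStress r ΩA t x *ᵥ outerNormal (ΩA t) x -
    A.interfaceStress r ΩA t x *ᵥ outerNormal (ΩA t) x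

/-- The heat flux jump `q_B · n_Γ - q_A · n_Γ` on `Γ(t)`. -/
def heatJump (ΩA : ℝ → Set E3) (A B : Fluid) (t : ℝ) (x : E3) : ℝ :=
  B.heat t x ⬝ᵥ outerNormal (ΩA t) x - A.heat t x ⬝ᵥ outerNormal (ΩA t) x

/-! ### The system and the boundary conditions -/

/-- The equations of a bulk fluid in the moving region `U t`, `0 < t < T`. -/
structure SolvesBulk (T : ℝ) (U : ℝ → Set E3) (F : Fluid) : Prop where
  mass : ∀ t ∈ Ioo 0 T, ∀ x ∈ U t, matD F.v F.ρ t x + div (F.v t) x * F.ρ t x = 0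
  energy : ∀ t ∈ Ioo 0 T, ∀ x ∈ U t,
    F.ρ t x * matD F.v F.e t x + div (F.v t) x * F.π t x = div (F.heat t) x + F.dissip t x
  momentum : ∀ t ∈ Ioo 0 T, ∀ x ∈ U t, ∀ i,
    F.ρ t x * matD F.v (fun s y => F.v s y i) t x = divMat (F.stress t) x i

/-- The equations of the surface fluid `S` on `Γ(t) = frontier (Ω_A(t))`, `0 < t < T`. -/
structure SolvesSurface (T : ℝ) (r : ℕ) (ΩA : ℝ → Set E3) (A B S : Fluid) : Prop where
  mass : ∀ t ∈ Ioo 0 T, ∀ x ∈ frontier (ΩA t),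
    matD S.v S.ρ t x + tdiv (ΩA t) (S.v t) x * S.ρ t x = 0
  energy : ∀ t ∈ Ioo 0 T, ∀ x ∈ frontier (ΩA t),
    S.ρ t x * matD S.v S.e t x + tdiv (ΩA t) (S.v t) x * S.π t x =
      tdiv (ΩA t) (S.surfHeat ΩA t) x + S.surfDissip ΩA t x + heatJump ΩA A B t x
  momentum : ∀ t ∈ Ioo 0 T, ∀ x ∈ frontier (ΩA t), ∀ i,
    S.ρ t x * matD S.v (fun s y => S.v s y i) t x =
      tdivMat (ΩA t) (S.surfStress ΩA t) x i + tractionJump r ΩA A B t x i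

/-- The full system of continuity, internal energy and momentum equations. -/
structure SolvesSystem (T : ℝ) (r : ℕ) (Ω : Set E3) (ΩA : ℝ → Set E3) (A B S : Fluid) : Prop where
  inA : SolvesBulk T ΩA A
  inB : SolvesBulk T (phaseB Ω ΩA) B
  onS : SolvesSurface T r ΩA A B S

/-- The conditions on `∂Ω` and on `Γ(t)` for `0 < t < T`. -/
structure BoundaryConditions (T : ℝ) (r : ℕ) (Ω : Set E3) (ΩA : ℝ → Set E3) (A B S : Fluid) :
    Prop where
  outer_velocity : ∀ t ∈ Ioo 0 T, ∀ x ∈ frontier Ω, B.v t x = 0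
  normal_A : ∀ t ∈ Ioo 0 T, ∀ x ∈ frontier (ΩA t),
    A.v t x ⬝ᵥ outerNormal (ΩA t) x = B.v t x ⬝ᵥ outerNormal (ΩA t) x
  normal_B : ∀ t ∈ Ioo 0 T, ∀ x ∈ frontier (ΩA t),
    B.v t x ⬝ᵥ outerNormal (ΩA t) x = S.v t x ⬝ᵥ outerNormal (ΩA t) x
  tangential_A : ∀ t ∈ Ioo 0 T, ∀ x ∈ frontier (ΩA t),
    tproj (ΩA t) x *ᵥ A.v t x = tproj (ΩA t) x *ᵥ B.v t x
  tangential_B : ∀ t ∈ Ioo 0 T, ∀ x ∈ frontier (ΩA t),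
    tproj (ΩA t) x *ᵥ B.v t x = (r : ℝ) • (tproj (ΩA t) x *ᵥ S.v t x)
  outer_temperature : ∀ t ∈ Ioo 0 T, ∀ x ∈ frontier Ω, outerNormal Ω x ⬝ᵥ grad (B.θ t) x = 0
  temperature_A : ∀ t ∈ Ioo 0 T, ∀ x ∈ frontier (ΩA t), A.θ t x = B.θ t x
  temperature_B : ∀ t ∈ Ioo 0 T, ∀ x ∈ frontier (ΩA t), B.θ t x = S.θ t x

/-! ### The conservative forms -/

/-- The conservative form of the bulk equations. -/
structure ConservativeBulk (T : ℝ) (U : ℝ → Set E3) (F : Fluid) : Prop where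
  mass : ∀ t ∈ Ioo 0 T, ∀ x ∈ U t, dt F.ρ t x + div (F.momentum t) x = 0
  energy : ∀ t ∈ Ioo 0 T, ∀ x ∈ U t,
    dt F.energy t x +
      div (fun y => F.energy t y • F.v t y - F.heat t y - F.stress t y *ᵥ F.v t y) x = 0
  momentum : ∀ t ∈ Ioo 0 T, ∀ x ∈ U t, ∀ i,
    dt (fun s y => F.momentum s y i) t x +
      divMat (fun y => F.momentumFlux t y - F.stress t y) x i = 0

/-- The conservative form of the surface equations, with the normal time derivative `D_t^N`. -/
structure ConservativeSurface (T : ℝ) (r : ℕ) (ΩA : ℝ → Set E3) (A B S : Fluid) : Prop where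
  mass : ∀ t ∈ Ioo 0 T, ∀ x ∈ frontier (ΩA t),
    normD ΩA S.v S.ρ t x + tdiv (ΩA t) (S.momentum t) x = 0
  energy : ∀ t ∈ Ioo 0 T, ∀ x ∈ frontier (ΩA t),
    normD ΩA S.v S.energy t x +
      tdiv (ΩA t) (fun y => S.energy t y • S.v t y - S.surfHeat ΩA t y -
        S.surfStress ΩA t y *ᵥ S.v t y) x =
      tractionJump r ΩA A B t x ⬝ᵥ S.v t x + heatJump ΩA A B t x
  momentum : ∀ t ∈ Ioo 0 T, ∀ x ∈ frontier (ΩA t), ∀ i,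
    normD ΩA S.v (fun s y => S.momentum s y i) t x +
      tdivMat (ΩA t) (fun y => S.momentumFlux t y - S.surfStress ΩA t y) x i =
      tractionJump r ΩA A B t x i

end TwoPhaseSurfaceFlow

end

/-! ### Comparison of measures -/

/-! The pointwise part is a computation from the continuity equation. If `D` denotes `div v` or
`div_Γ v`, that equation turns `ρ D_t f` into `D_t (ρ f) + D ρ f`, so each of the balance laws
becomes a transport equation for a density. Pairing the momentum equation with `v` gives the kinetic
energy balance. For a symmetric stress, `div (𝒯 v) = div 𝒯 · v + 𝒯 : ∇v`, and the power `𝒯 : ∇v`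
equals `e_D - (div v) π`. The same terms occur with opposite sign in the internal energy equation,
so they cancel in the total energy. On the surface the same algebra holds with tangential
derivatives, because the surface stress is symmetric and annihilates `n`. The difference between
`D_t^S` and `D_t^N` is tangential convection, which the surface divergence absorbs.

The global laws are instances of one transport balance (`IsMovingDefining.hasDerivAt_total`): bulk
densities with fluxes `W_A`, `W_B`, a surface density with tangential flux `W_S`, and sources. The
flow identities convert time derivatives into integrals of flux divergences and sources. The
divergence theorem turns the bulk fluxes into interface fluxes, which cancel against the jump in the
surface equation, and an outer flux with integral zero. The surface divergence of `W_S` integrates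
to zero. For the energies the cancellation requires `𝒯̃ n · v_S = 𝒯 v · n` on each side
(`interfaceStress_power`): for `r = 1` the velocities agree and the stress is symmetric; for `r = 0`
the bulk velocity is normal and only the normal component of the traction does work. Integration in
time uses continuity of all integrals up to the initial time.

The analytic input is the divergence theorem for a bounded regular sublevel set with Hausdorff
measure on its boundary. Locally the boundary is a graph over a hyperplane; Fubini and the
fundamental theorem of calculus produce an integral over the base, and comparing Hausdorff measure
with its orthogonal projection identifies the conormal density. A partition of unity globalizes
this. The surface divergence theorem then follows from `div curl = 0`, applied to the cross product
of the normal and the tangential field. Fields built from the normal exist only on the surface; they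
are differentiated through an extension of the normal that is smooth on all of space. -/

/-- By the Lindelöf property countably many of the neighbourhoods cover `S`; after making them
disjoint, the local inequalities are summed. -/
theorem measure_le_of_locally_le {X : Type*} [TopologicalSpace X] [SecondCountableTopology X]
    [MeasurableSpace X] [BorelSpace X] {μ ν : Measure X} {S : Set X} (hS : MeasurableSet S)
    (hμ : μ Sᶜ = 0)
    (h : ∀ x ∈ S, ∃ W ∈ 𝓝 x, ∀ A, MeasurableSet A → A ⊆ S ∩ W → μ A ≤ ν A) : μ ≤ ν := by
  choose! W hW hWA using h
  obtain ⟨t, htS, htc, hcov⟩ := TopologicalSpace.countable_cover_nhdsWithin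
    (s := S) (f := fun x => interior (W x))
    (fun x hx => mem_nhdsWithin_of_mem_nhds (interior_mem_nhds.2 (hW x hx)))
  refine Measure.le_iff.2 fun A hA => ?_
  have hAS : μ A = μ (A ∩ S) := by
    refine (measure_inter_conull' ?_).symm
    exact measure_mono_null (fun x hx => hx.2) hμ
  rcases t.eq_empty_or_nonempty with rfl | hne
  · have : S = ∅ := by simpa using hcov
    simp [hAS, this]
  obtain ⟨f, hf⟩ := htc.exists_eq_range hne
  set V : ℕ → Set X := disjointed fun k => interior (W (f k)) with hV
  have hVm : ∀ k, MeasurableSet (V k) := fun k =>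
    MeasurableSet.disjointed (fun k => isOpen_interior.measurableSet) k
  have hcov' : A ∩ S = ⋃ k, (A ∩ S) ∩ V k := by
    rw [← inter_iUnion, hV, iUnion_disjointed, eq_comm, inter_eq_left]
    intro x hx
    have := hcov hx.2
    rw [hf] at this
    simpa using this
  have hdis : Pairwise (Function.onFun Disjoint fun k => (A ∩ S) ∩ V k) := fun i j hij =>
    (disjoint_disjointed _ hij).mono inter_subset_right inter_subset_right
  have hm : ∀ k, MeasurableSet ((A ∩ S) ∩ V k) := fun k => (hA.inter hS).inter (hVm k)
  calc μ A = μ (⋃ k, (A ∩ S) ∩ V k) := by rw [hAS, ← hcov']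
    _ = ∑' k, μ ((A ∩ S) ∩ V k) := measure_iUnion hdis hm
    _ ≤ ∑' k, ν ((A ∩ S) ∩ V k) := by
        refine ENNReal.tsum_le_tsum fun k => ?_
        refine hWA (f k) (htS (hf ▸ mem_range_self k)) _ (hm k) fun x hx => ⟨hx.1.2, ?_⟩
        exact interior_subset (disjointed_subset _ k hx.2)
    _ = ν (⋃ k, (A ∩ S) ∩ V k) := (measure_iUnion hdis hm).symm
    _ ≤ ν A := by rw [← hcov']; exact measure_mono inter_subset_left

theorem measure_le_of_forall_one_lt {X : Type*} [MeasurableSpace X] {μ ν : Measure X}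
    (h : ∀ c : NNReal, 1 < c → μ ≤ c • ν) : μ ≤ ν := by
  refine Measure.le_iff.2 fun A _ => ?_
  have h1 : Tendsto (fun c : NNReal => (c : ENNReal) * ν A) (𝓝[>] 1) (𝓝 (1 * ν A)) := by
    refine ENNReal.Tendsto.mul_const ?_ (Or.inl one_ne_zero)
    exact (ENNReal.continuous_coe.tendsto 1).mono_left nhdsWithin_le_nhds
  rw [one_mul] at h1
  refine ge_of_tendsto h1 (eventually_nhdsWithin_of_forall fun c hc => ?_)
  simpa using h c hc A

/-! ### Surface measure of a level set -/

section LevelSet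

open Module Measure

variable {E : Type*} [NormedAddCommGroup E] [InnerProductSpace ℝ E]

theorem LipschitzOnWith.euclideanHausdorffMeasure_image_le {X Y : Type*}
    [EMetricSpace X] [MeasurableSpace X] [BorelSpace X]
    [EMetricSpace Y] [MeasurableSpace Y] [BorelSpace Y] {K : NNReal} {f : X → Y} {s : Set X}
    (h : LipschitzOnWith K f s) (d : ℕ) :
    μHE[d] (f '' s) ≤ (K : ENNReal) ^ d * μHE[d] s := by
  simp only [euclideanHausdorffMeasure_def, Measure.smul_apply, Measure.nnreal_smul_coe_apply]
  calc _ ≤ _ := mul_le_mul_right (h.hausdorffMeasure_image_le (d := d) (by positivity)) _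
    _ = _ := by rw [ENNReal.rpow_natCast]; ring

/-- A map this close to the identity is `c`-Lipschitz with `c`-Lipschitz inverse. The upper bound `1
+ (1 - c⁻¹) ≤ c` is `(c - 1)² ≥ 0` in disguise; the lower bound `c⁻¹ ‖a - b‖` is immediate from the
triangle inequality. -/
theorem euclideanHausdorffMeasure_image_near {E : Type*} [NormedAddCommGroup E]
    [MeasurableSpace E] [BorelSpace E] {Q : E → E} {s : Set E} {c : NNReal} (hc : 1 < c)
    (d : ℕ) (hQ : ∀ a ∈ s, ∀ b ∈ s, ‖(Q a - Q b) - (a - b)‖ ≤ (1 - (c : ℝ)⁻¹) * ‖a - b‖) :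
    μHE[d] (Q '' s) ≤ (c : ENNReal) ^ d * μHE[d] s ∧
      μHE[d] s ≤ (c : ENNReal) ^ d * μHE[d] (Q '' s) := by
  have hc' : (1 : ℝ) < c := by exact_mod_cast hc
  have hc0 : (0 : ℝ) < c := by linarith
  have hcc : 1 + (1 - (c : ℝ)⁻¹) ≤ c := by
    have : (c : ℝ) * (c : ℝ)⁻¹ = 1 := mul_inv_cancel₀ hc0.ne'
    nlinarith [sq_nonneg ((c : ℝ) - 1), inv_pos.2 hc0]
  have key : ∀ a ∈ s, ∀ b ∈ s, ‖Q a - Q b‖ ≤ c * ‖a - b‖ ∧ ‖a - b‖ ≤ c * ‖Q a - Q b‖ := by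
    intro a ha b hb
    have h := hQ a ha b hb
    have h1 : ‖Q a - Q b‖ ≤ ‖(Q a - Q b) - (a - b)‖ + ‖a - b‖ := by
      simpa using norm_add_le ((Q a - Q b) - (a - b)) (a - b)
    have h2 : ‖a - b‖ ≤ ‖Q a - Q b‖ + ‖(Q a - Q b) - (a - b)‖ := by
      simpa using norm_sub_le (Q a - Q b) ((Q a - Q b) - (a - b))
    constructor
    · nlinarith [norm_nonneg (a - b)]
    · have : (c : ℝ)⁻¹ * ‖a - b‖ ≤ ‖Q a - Q b‖ := by linarith
      rwa [inv_mul_le_iff₀ hc0] at this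
  constructor
  · refine LipschitzOnWith.euclideanHausdorffMeasure_image_le ?_ d
    refine LipschitzOnWith.of_dist_le_mul fun a ha b hb => ?_
    simpa [dist_eq_norm] using (key a ha b hb).1
  · have hinj : InjOn Q s := fun a ha b hb hab => by
      have := (key a ha b hb).2
      rw [hab, sub_self, norm_zero, mul_zero] at this
      exact sub_eq_zero.1 (norm_le_zero_iff.1 this)
    rcases s.eq_empty_or_nonempty with rfl | ⟨x0, hx0⟩
    · simp
    have : Nonempty E := ⟨x0⟩
    have himg : Function.invFunOn Q s '' (Q '' s) = s := hinj.invFunOn_image subset_rfl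
    conv_lhs => rw [← himg]
    refine LipschitzOnWith.euclideanHausdorffMeasure_image_le ?_ d
    refine LipschitzOnWith.of_dist_le_mul ?_
    rintro _ ⟨a, ha, rfl⟩ _ ⟨b, hb, rfl⟩
    rw [hinj.leftInvOn_invFunOn ha, hinj.leftInvOn_invFunOn hb]
    simpa [dist_eq_norm] using (key a ha b hb).2

variable [FiniteDimensional ℝ E]

/-- The volume factor of the inverse of the orthogonal projection along the unit vector `e`,
restricted to the kernel of a linear functional. -/
theorem normDet_graph {e : E} (he : ‖e‖ = 1) (D : E →L[ℝ] ℝ) (hD : 0 < D e) :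
    LinearMap.normDet ((ℝ ∙ e)ᗮ.subtype -
      (LinearMap.toSpanSingleton ℝ E e) ∘ₗ ((D e)⁻¹ • (D : E →ₗ[ℝ] ℝ) ∘ₗ (ℝ ∙ e)ᗮ.subtype)) =
      ‖D‖ / D e := by
  set K := (ℝ ∙ e)ᗮ with hK
  set M := (K.subtype -
      (LinearMap.toSpanSingleton ℝ E e) ∘ₗ ((D e)⁻¹ • (D : E →ₗ[ℝ] ℝ) ∘ₗ K.subtype)) with hM
  have hMk : ∀ k : K, M k = (k : E) - (D k / D e) • e := by
    intro k
    simp [hM, div_eq_inv_mul]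
  have hke : ∀ k : K, inner ℝ (k : E) e = 0 := fun k =>
    Submodule.mem_orthogonal_singleton_iff_inner_left.1 k.2
  have hek : ∀ k : K, inner ℝ e (k : E) = 0 := fun k =>
    Submodule.mem_orthogonal_singleton_iff_inner_right.1 k.2
  have hee : inner ℝ e e = (1 : ℝ) := by rw [real_inner_self_eq_norm_sq, he]; norm_num
  have hMM : ∀ k l : K, inner ℝ (M k) (M l) = inner ℝ k l + (D k / D e) * (D l / D e) := by
    intro k l
    rw [hMk, hMk, inner_sub_left, inner_sub_right, inner_sub_right, inner_smul_left,
      inner_smul_right, inner_smul_left, inner_smul_right, hee, hke, hek]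
    simp
  set b := stdOrthonormalBasis ℝ K
  set a : Fin (finrank ℝ K) → ℝ := fun i => D (b i) / D e with ha
  -- Because `e` is a unit vector orthogonal to `K`, the Gram matrix of the images of an orthonormal
  -- basis is the identity plus the rank one matrix `a aᵀ`.
  have hgram : (LinearMap.normDet M) ^ 2 = 1 + a ⬝ᵥ a := by
    have h1 : (LinearMap.normDet M) ^ 2 = (Matrix.gram ℝ (fun i => M (b i))).det := by
      simpa using LinearMap.normDet_sq_eq_det_gram M b
    have h2 : Matrix.gram ℝ (fun i => M (b i)) =
        1 + Matrix.replicateCol Unit a * Matrix.replicateRow Unit a := by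
      ext i j
      rw [Matrix.gram_apply, hMM, orthonormal_iff_ite.1 b.orthonormal i j]
      simp [Matrix.mul_apply, Matrix.one_apply, ha]
    rw [h1, h2, Matrix.det_one_add_replicateCol_mul_replicateRow]
  -- The Riesz vector of `D` splits into `D e` times `e` and a part in `K` whose coordinates are `D
  -- e * a i`.
  have hnorm : ‖D‖ ^ 2 = (D e) ^ 2 * (1 + a ⬝ᵥ a) := by
    set g := (InnerProductSpace.toDual ℝ E).symm D with hg
    have hgD : ∀ z, D z = inner ℝ g z := fun z => by
      rw [hg, InnerProductSpace.toDual_symm_apply]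
    have hgn : ‖g‖ = ‖D‖ := by simp [hg]
    set k := K.orthogonalProjectionOnto g with hk
    have hsplit : g = (D e) • e + (k : E) := by
      have h := Submodule.starProjection_add_starProjection_orthogonal (K := ℝ ∙ e) g
      rw [Submodule.starProjection_unit_singleton ℝ he] at h
      rw [hgD e, real_inner_comm]
      exact h.symm
    have hDk : ∀ l : K, D l = inner ℝ k l := by
      intro l
      rw [hgD, hsplit, inner_add_left, inner_smul_left, hek]
      simp
    have hkk : ‖k‖ ^ 2 = (D e) ^ 2 * (a ⬝ᵥ a) := by
      rw [← b.sum_sq_norm_inner_left k, dotProduct, Finset.mul_sum]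
      refine Finset.sum_congr rfl fun i _ => ?_
      simp only [ha]
      rw [hDk, Real.norm_eq_abs, sq_abs]
      field_simp
    rw [← hgn, ← real_inner_self_eq_norm_sq]
    conv_lhs => rw [hsplit]
    rw [inner_add_left, inner_add_right, inner_add_right, inner_smul_left, inner_smul_right,
      inner_smul_right, inner_smul_left, hee, hek, hke,
      real_inner_self_eq_norm_sq, ← Submodule.coe_norm, hkk]
    simp
    ring
  rw [eq_div_iff hD.ne']
  refine (sq_eq_sq₀ (mul_nonneg (LinearMap.normDet_nonneg _) hD.le) (norm_nonneg _)).1 ?_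
  rw [mul_pow, hgram, hnorm]
  ring

end LevelSet

/-! ### Orthogonal projection of a level set along a transversal direction -/

section LevelSet

open Module Measure

variable {E : Type*} [NormedAddCommGroup E] [InnerProductSpace ℝ E]

/-- Splitting off the direction of a unit vector. -/
noncomputable def lineSplit (e : E) (he : ‖e‖ = 1) : (ℝ × (ℝ ∙ e)ᗮ) ≃L[ℝ] E :=
  ContinuousLinearEquiv.equivOfInverse
    ((ContinuousLinearMap.toSpanSingleton ℝ e).coprod (ℝ ∙ e)ᗮ.subtypeL)
    ((innerSL ℝ e).prod (ℝ ∙ e)ᗮ.orthogonalProjectionOnto)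
    (by
      rintro ⟨s, y⟩
      have hy : inner ℝ e (y : E) = 0 := Submodule.mem_orthogonal_singleton_iff_inner_right.1 y.2
      have h1 : (ℝ ∙ e)ᗮ.orthogonalProjectionOnto e = 0 :=
        Submodule.orthogonalProjectionOnto_orthogonalComplement_singleton_eq_zero e
      simp [inner_add_right, inner_smul_right, hy, he, h1])
    (by
      intro z
      have h := Submodule.starProjection_add_starProjection_orthogonal (K := ℝ ∙ e) z
      rw [Submodule.starProjection_unit_singleton ℝ he] at h
      simpa using h)

theorem lineSplit_apply (e : E) (he : ‖e‖ = 1) (s : ℝ) (y : (ℝ ∙ e)ᗮ) :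
    lineSplit e he (s, y) = s • e + y := by
  simp [lineSplit]

theorem lineSplit_symm_apply (e : E) (he : ‖e‖ = 1) (z : E) :
    (lineSplit e he).symm z = (inner ℝ e z, (ℝ ∙ e)ᗮ.orthogonalProjectionOnto z) := by
  simp [lineSplit]

variable [FiniteDimensional ℝ E] [MeasurableSpace E] [BorelSpace E]

theorem exists_one_lt_pow_le {c : NNReal} (hc : 1 < c) (d : ℕ) :
    ∃ k : NNReal, 1 < k ∧ k ^ d ≤ c := by
  have h : Tendsto (fun k : NNReal => k ^ d) (𝓝[>] 1) (𝓝 (1 ^ d)) :=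
    ((continuous_pow d).tendsto 1).mono_left nhdsWithin_le_nhds
  rw [one_pow] at h
  obtain ⟨k, hk, hk1⟩ := ((h.eventually (eventually_lt_nhds hc)).and
    self_mem_nhdsWithin).exists
  exact ⟨k, hk1, hk.le⟩

/-- Near a regular point of a level set, the orthogonal projection along a transversal unit vector
`e` distorts the surface measure by the factor `D e / ‖D‖`, up to a constant close to one. -/
theorem exists_nhds_projection_compare {φ : E → ℝ} {D : E →L[ℝ] ℝ} {x e : E}
    (hφ : HasStrictFDerivAt φ D x) (he : ‖e‖ = 1) (hD : 0 < D e) {c : NNReal} (hc : 1 < c) :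
    ∃ W ∈ 𝓝 x, ∀ A ⊆ {z | φ z = 0} ∩ W,
      volume ((ℝ ∙ e)ᗮ.orthogonalProjectionOnto '' A) ≤
        c * (ENNReal.ofReal (D e / ‖D‖) * μHE[finrank ℝ (ℝ ∙ e)ᗮ] A) ∧
      ENNReal.ofReal (D e / ‖D‖) * μHE[finrank ℝ (ℝ ∙ e)ᗮ] A ≤
        c * volume ((ℝ ∙ e)ᗮ.orthogonalProjectionOnto '' A) := by
  set K := (ℝ ∙ e)ᗮ with hK
  set d := finrank ℝ K
  obtain ⟨k, hk1, hkc⟩ := exists_one_lt_pow_le hc d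
  have hk1' : (1 : ℝ) < k := by exact_mod_cast hk1
  -- The linearization error is later divided by `D e`, so this choice leaves exactly the constant
  -- `1 - k⁻¹` of `euclideanHausdorffMeasure_image_near`.
  have hε : 0 < D e * (1 - (k : ℝ)⁻¹) :=
    mul_pos hD (sub_pos.2 (inv_lt_one_of_one_lt₀ hk1'))
  have hD0 : D ≠ 0 := by rintro rfl; simp at hD
  have hDn : 0 < ‖D‖ := norm_pos_iff.2 hD0
  have hlo := hφ.isLittleO.def hε
  rw [nhds_prod_eq] at hlo
  obtain ⟨W, hW, hWW⟩ := Filter.mem_prod_same_iff.1 hlo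
  refine ⟨W, hW, fun A hA => ?_⟩
  -- `Q` is the projection onto `ker D` along `e`. Strict differentiability makes `D (a - b)` small
  -- for points of the zero set near `x`, so there `Q` is almost the identity on differences.
  set Q : E → E := fun z => z - (D z / D e) • e with hQ
  obtain ⟨h1, h2⟩ := euclideanHausdorffMeasure_image_near (Q := Q) (s := A) hk1 d (by
    intro a ha b hb
    have h : ‖φ a - φ b - D (a - b)‖ ≤ D e * (1 - (k : ℝ)⁻¹) * ‖a - b‖ :=
      hWW (mk_mem_prod (hA ha).2 (hA hb).2)
    have ha0 : φ a = 0 := (hA ha).1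
    have hb0 : φ b = 0 := (hA hb).1
    simp only [ha0, hb0, sub_self, zero_sub, norm_neg] at h
    have : Q a - Q b - (a - b) = -((D (a - b) / D e) • e) := by
      simp only [hQ, map_sub, sub_div, sub_smul]; abel
    rw [this, norm_neg, norm_smul, he, mul_one, norm_div, Real.norm_of_nonneg hD.le, div_le_iff₀ hD]
    linarith)
  set M := (K.subtype -
      (LinearMap.toSpanSingleton ℝ E e) ∘ₗ ((D e)⁻¹ • (D : E →ₗ[ℝ] ℝ) ∘ₗ K.subtype)) with hM
  -- `Q` kills `e`, hence factors through the orthogonal projection to `K`. The remaining factor `M`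
  -- is linear, so its effect on area is known exactly.
  have hQM : Q '' A = M '' (K.orthogonalProjectionOnto '' A) := by
    rw [image_image]
    refine image_congr fun z _ => ?_
    have h := Submodule.starProjection_add_starProjection_orthogonal (K := ℝ ∙ e) z
    rw [Submodule.starProjection_unit_singleton ℝ he] at h
    have hz : ((K.orthogonalProjectionOnto z : K) : E) = z - inner ℝ e z • e :=
      eq_sub_of_add_eq' h
    simp only [hM, hQ, LinearMap.sub_apply, Submodule.subtype_apply, LinearMap.comp_apply,
      LinearMap.smul_apply, ContinuousLinearMap.coe_coe, LinearMap.toSpanSingleton_apply, hz,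
      map_sub, map_smul, smul_eq_mul]
    rw [sub_sub, ← add_smul]
    congr 2
    field_simp
    ring
  have hvol : μHE[d] (Q '' A) = ENNReal.ofReal (‖D‖ / D e) *
      volume (K.orthogonalProjectionOnto '' A) := by
    rw [hQM, LinearMap.euclideanHausdorffMeasure_image_eq_normDet_mul_volume, normDet_graph he D hD]
  have hinv : ENNReal.ofReal (D e / ‖D‖) * ENNReal.ofReal (‖D‖ / D e) = 1 := by
    rw [← ENNReal.ofReal_mul (by positivity)]
    rw [div_mul_div_cancel₀ hDn.ne', div_self hD.ne', ENNReal.ofReal_one]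
  have hpow : (k : ENNReal) ^ d ≤ c := by exact_mod_cast hkc
  have hv : volume (K.orthogonalProjectionOnto '' A) =
      ENNReal.ofReal (D e / ‖D‖) * μHE[d] (Q '' A) := by
    rw [hvol, ← mul_assoc, hinv, one_mul]
  constructor
  · calc _ = ENNReal.ofReal (D e / ‖D‖) * μHE[d] (Q '' A) := hv
      _ ≤ ENNReal.ofReal (D e / ‖D‖) * (c * μHE[d] A) := by gcongr; exact h1.trans (by gcongr)
      _ = _ := by ring
  · calc _ ≤ ENNReal.ofReal (D e / ‖D‖) * (c * μHE[d] (Q '' A)) := by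
          gcongr; exact h2.trans (by gcongr)
      _ = _ := by rw [hv]; ring

/-- The product carries the sup norm, so `lineSplit` is not treated as an isometry. It is the
isometry of `ℝ` with the line spanned by `e`, followed by the measure preserving orthogonal
decomposition. -/
theorem measurePreserving_lineSplit (e : E) (he : ‖e‖ = 1) :
    MeasurePreserving (lineSplit e he) := by
  have h1 := ((ℝ ∙ e).measurePreserving_measurableEquivProd (0 : E)).symm
  rw [InnerProductSpace.euclideanHausdorffMeasure_eq_volume, Measure.volume_eq_prod] at h1
  have h0 : MeasurePreserving (LinearIsometryEquiv.toSpanUnitSingleton e he) volume volume :=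
    LinearIsometryEquiv.measurePreserving _
  have h2 := h0.prod (MeasurePreserving.id (volume : Measure (ℝ ∙ e)ᗮ))
  have h3 : ⇑(lineSplit e he) = ⇑((ℝ ∙ e).measurableEquivProd (0 : E)).symm ∘
      Prod.map (LinearIsometryEquiv.toSpanUnitSingleton e he) id := by
    funext p
    rw [← p.eta, lineSplit_apply]
    simp
  rw [h3, Measure.volume_eq_prod]
  exact h1.comp h2

end LevelSet

/-! ### Zero sets as graphs over hyperplanes -/

section LevelSet

open Module Measure

variable {E : Type*} [NormedAddCommGroup E] [InnerProductSpace ℝ E]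

theorem hasDerivAt_lineSplit {F : Type*} [NormedAddCommGroup F] [NormedSpace ℝ F] {φ : E → F}
    {e : E} (he : ‖e‖ = 1) {s : ℝ} {y : (ℝ ∙ e)ᗮ}
    (hφ : DifferentiableAt ℝ φ (lineSplit e he (s, y))) :
    HasDerivAt (fun s => φ (lineSplit e he (s, y))) (fderiv ℝ φ (lineSplit e he (s, y)) e) s := by
  have h1 : HasDerivAt (fun s : ℝ => lineSplit e he (s, y)) e s := by
    simp only [lineSplit_apply]
    simpa using ((hasDerivAt_id s).smul_const e).add_const (y : E)
  exact hφ.hasFDerivAt.comp_hasDerivAt s h1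

/-- Near a regular zero, the zero set of a `C¹` function is a graph over the hyperplane orthogonal
to a transversal direction. -/
theorem exists_graph {φ : E → ℝ} (hφ : ContDiff ℝ 1 φ) {x e : E} (hx : φ x = 0) (he : ‖e‖ = 1)
    (hD : 0 < fderiv ℝ φ x e) :
    ∃ (a b r : ℝ) (g : (ℝ ∙ e)ᗮ → ℝ), 0 < r ∧
      inner ℝ e x ∈ Ioo a b ∧
      ContinuousOn g (Metric.ball ((ℝ ∙ e)ᗮ.orthogonalProjectionOnto x) r) ∧
      ∀ y ∈ Metric.ball ((ℝ ∙ e)ᗮ.orthogonalProjectionOnto x) r,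
        g y ∈ Ioo a b ∧ ∀ s ∈ Ioo a b, 0 < fderiv ℝ φ (lineSplit e he (s, y)) e ∧
        (φ (lineSplit e he (s, y)) < 0 ↔ s < g y) ∧
        (φ (lineSplit e he (s, y)) = 0 ↔ s = g y) := by
  set y0 := (ℝ ∙ e)ᗮ.orthogonalProjectionOnto x with hy0
  set s0 : ℝ := inner ℝ e x with hs0
  have hx0 : lineSplit e he (s0, y0) = x := by
    rw [hs0, hy0, ← lineSplit_symm_apply e he, ContinuousLinearEquiv.apply_symm_apply]
  have hcont : Continuous fun p : ℝ × (ℝ ∙ e)ᗮ => φ (lineSplit e he p) :=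
    hφ.continuous.comp (lineSplit e he).continuous
  have hcont' : Continuous fun p : ℝ × (ℝ ∙ e)ᗮ => fderiv ℝ φ (lineSplit e he p) e :=
    ((hφ.continuous_fderiv one_ne_zero).clm_apply continuous_const).comp
      (lineSplit e he).continuous
  have hO : ∀ᶠ p in 𝓝 (s0, y0), 0 < fderiv ℝ φ (lineSplit e he p) e :=
    hcont'.continuousAt.eventually (lt_mem_nhds (by simpa only [hx0] using hD))
  obtain ⟨δ', hδ', hball⟩ := Metric.eventually_nhds_iff_ball.1 hO
  -- Halving keeps the closed interval of radius `δ` inside the region where the derivative along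
  -- `e` is positive.
  set δ := δ' / 2 with hδdef
  have hδ : 0 < δ := by positivity
  have hpos : ∀ s ∈ Icc (s0 - δ) (s0 + δ), ∀ y ∈ Metric.ball y0 δ,
      0 < fderiv ℝ φ (lineSplit e he (s, y)) e := by
    intro s hs y hy
    refine hball _ ?_
    rw [Metric.mem_ball, Prod.dist_eq, max_lt_iff]
    constructor
    · simp only [Real.dist_eq]
      rw [abs_lt]; constructor <;> linarith [hs.1, hs.2]
    · have := Metric.mem_ball.1 hy
      linarith
  have hmono : ∀ y ∈ Metric.ball y0 δ,
      StrictMonoOn (fun s => φ (lineSplit e he (s, y))) (Icc (s0 - δ) (s0 + δ)) := by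
    intro y hy
    refine strictMonoOn_of_deriv_pos (convex_Icc _ _)
      (hcont.comp (by fun_prop : Continuous fun s : ℝ => (s, y))).continuousOn fun s hs => ?_
    rw [(hasDerivAt_lineSplit he (hφ.differentiable one_ne_zero _)).deriv]
    exact hpos s (interior_subset hs) y hy
  have hy0m : y0 ∈ Metric.ball y0 δ := Metric.mem_ball_self hδ
  have ha0 : φ (lineSplit e he (s0 - δ, y0)) < 0 := by
    rw [← hx, ← hx0]
    exact hmono y0 hy0m ⟨le_rfl, by linarith⟩ ⟨by linarith, by linarith⟩ (by linarith)
  have hb0 : 0 < φ (lineSplit e he (s0 + δ, y0)) := by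
    rw [← hx, ← hx0]
    exact hmono y0 hy0m ⟨by linarith, by linarith⟩ ⟨by linarith, le_rfl⟩ (by linarith)
  have hev : ∀ᶠ y in 𝓝 y0, φ (lineSplit e he (s0 - δ, y)) < 0 ∧
      0 < φ (lineSplit e he (s0 + δ, y)) :=
    ((hcont.comp (by fun_prop : Continuous fun y => (s0 - δ, y))).continuousAt.eventually
      (gt_mem_nhds ha0)).and
    ((hcont.comp (by fun_prop : Continuous fun y => (s0 + δ, y))).continuousAt.eventually
      (lt_mem_nhds hb0))
  obtain ⟨r', hr', hsign⟩ := Metric.eventually_nhds_iff_ball.1 hev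
  have hsub : Metric.ball y0 (min r' δ) ⊆ Metric.ball y0 δ :=
    Metric.ball_subset_ball (min_le_right _ _)
  have hex : ∀ y ∈ Metric.ball y0 (min r' δ), ∃ s ∈ Ioo (s0 - δ) (s0 + δ),
      φ (lineSplit e he (s, y)) = 0 := by
    intro y hy
    obtain ⟨h1, h2⟩ := hsign y (Metric.ball_subset_ball (min_le_left _ _) hy)
    obtain ⟨s, hs, hs0⟩ := intermediate_value_Ioo (by linarith : s0 - δ ≤ s0 + δ)
      (hcont.comp (by fun_prop : Continuous fun s : ℝ => (s, y))).continuousOn ⟨h1, h2⟩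
    exact ⟨s, hs, hs0⟩
  choose! g hg hg0 using hex
  have hlt : ∀ y ∈ Metric.ball y0 (min r' δ), ∀ s ∈ Icc (s0 - δ) (s0 + δ),
      (φ (lineSplit e he (s, y)) < 0 ↔ s < g y) := fun y hy s hs => by
    have := (hmono y (hsub hy)).lt_iff_lt hs (Ioo_subset_Icc_self (hg y hy))
    simp only [hg0 y hy] at this
    exact this
  have hgt : ∀ y ∈ Metric.ball y0 (min r' δ), ∀ s ∈ Icc (s0 - δ) (s0 + δ),
      (0 < φ (lineSplit e he (s, y)) ↔ g y < s) := fun y hy s hs => by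
    have := (hmono y (hsub hy)).lt_iff_lt (Ioo_subset_Icc_self (hg y hy)) hs
    simp only [hg0 y hy] at this
    exact this
  refine ⟨s0 - δ, s0 + δ, min r' δ, g, lt_min hr' hδ, ⟨by linarith, by linarith⟩, ?_, ?_⟩
  · intro y hy
    have hnear : ∀ᶠ z in 𝓝[Metric.ball y0 (min r' δ)] y, z ∈ Metric.ball y0 (min r' δ) :=
      self_mem_nhdsWithin
    -- Continuity of `g` is read off from order: for fixed `a`, the relation of `a` to `g z` is the
    -- sign of `φ` at height `a`, and a strict sign persists near `y`.
    refine tendsto_order.2 ⟨fun a ha => ?_, fun a ha => ?_⟩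
    · rcases le_or_gt a (s0 - δ) with h | h
      · filter_upwards [hnear] with z hz
        exact h.trans_lt (hg z hz).1
      · have haI : a ∈ Icc (s0 - δ) (s0 + δ) := ⟨h.le, (ha.trans (hg y hy).2).le⟩
        have h3 := (hcont.comp (by fun_prop : Continuous fun z => (a, z))).continuousAt.eventually
          (gt_mem_nhds ((hlt y hy a haI).2 ha))
        filter_upwards [hnear, mem_nhdsWithin_of_mem_nhds h3] with z hz hz2
        exact (hlt z hz a haI).1 hz2
    · rcases le_or_gt (s0 + δ) a with h | h
      · filter_upwards [hnear] with z hz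
        exact (hg z hz).2.trans_le h
      · have haI : a ∈ Icc (s0 - δ) (s0 + δ) := ⟨((hg y hy).1.trans ha).le, h.le⟩
        have h3 := (hcont.comp (by fun_prop : Continuous fun z => (a, z))).continuousAt.eventually
          (lt_mem_nhds ((hgt y hy a haI).2 ha))
        filter_upwards [hnear, mem_nhdsWithin_of_mem_nhds h3] with z hz hz2
        exact (hgt z hz a haI).1 hz2
  · intro y hy
    refine ⟨hg y hy, fun s hs => ?_⟩
    have hs' := Ioo_subset_Icc_self hs
    refine ⟨hpos s hs' y (hsub hy), hlt y hy s hs', ?_⟩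
    have h1 := hlt y hy s hs'
    have h2 := hgt y hy s hs'
    constructor
    · intro h
      exact le_antisymm (not_lt.1 fun h' => (h2.2 h').ne' h) (not_lt.1 fun h' => (h1.2 h').ne h)
    · rintro rfl
      exact hg0 y hy

variable [FiniteDimensional ℝ E] [MeasurableSpace E] [BorelSpace E]

/-- The conormal density `∂ₑφ / ‖Dφ‖` times the surface measure of the zero set is, over a graph
patch, Lebesgue measure on the base hyperplane. -/
theorem map_graph_eq_withDensity {φ : E → ℝ} (hφ : ContDiff ℝ 1 φ) {e : E} (he : ‖e‖ = 1)
    {B : Set (ℝ ∙ e)ᗮ} (hB : IsOpen B) {a b : ℝ} {g : (ℝ ∙ e)ᗮ → ℝ} (hg : ContinuousOn g B)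
    (hgraph : ∀ y ∈ B, g y ∈ Ioo a b ∧ ∀ s ∈ Ioo a b, 0 < fderiv ℝ φ (lineSplit e he (s, y)) e ∧
        (φ (lineSplit e he (s, y)) = 0 ↔ s = g y)) :
    (volume.restrict B).map (fun y => lineSplit e he (g y, y)) =
      ((μHE[finrank ℝ (ℝ ∙ e)ᗮ]).restrict
        ({z | φ z = 0} ∩ lineSplit e he '' (Ioo a b ×ˢ B))).withDensity
        (fun z => ENNReal.ofReal (fderiv ℝ φ z e / ‖fderiv ℝ φ z‖)) := by
  set S := {z | φ z = 0} ∩ lineSplit e he '' (Ioo a b ×ˢ B) with hS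
  set h : E → ℝ := fun z => fderiv ℝ φ z e / ‖fderiv ℝ φ z‖ with hh
  set γ : (ℝ ∙ e)ᗮ → E := fun y => lineSplit e he (g y, y) with hγ
  have hcD := hφ.continuous_fderiv one_ne_zero
  have hUo : IsOpen (lineSplit e he '' (Ioo a b ×ˢ B)) :=
    (lineSplit e he).toHomeomorph.isOpenMap _ (isOpen_Ioo.prod hB)
  have hSm : MeasurableSet S :=
    (isClosed_eq hφ.continuous continuous_const).measurableSet.inter hUo.measurableSet
  have hSform : ∀ z ∈ S, ∃ y ∈ B, z = γ y := by
    rintro z ⟨hz, ⟨s, y⟩, ⟨hs, hy⟩, rfl⟩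
    exact ⟨y, hy, by rw [((hgraph y hy).2 s hs).2.1 hz]⟩
  have hSγ : ∀ y ∈ B, γ y ∈ S := fun y hy =>
    ⟨((hgraph y hy).2 _ (hgraph y hy).1).2.2 rfl, _, ⟨(hgraph y hy).1, hy⟩, rfl⟩
  have hpγ : ∀ y, (ℝ ∙ e)ᗮ.orthogonalProjectionOnto (γ y) = y := fun y => by
    have := (lineSplit e he).symm_apply_apply (g y, y)
    rw [lineSplit_symm_apply] at this
    exact congrArg Prod.snd this
  have hDpos : ∀ z ∈ S, 0 < fderiv ℝ φ z e := fun z hz => by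
    obtain ⟨y, hy, rfl⟩ := hSform z hz
    exact ((hgraph y hy).2 _ (hgraph y hy).1).1
  have hDn : ∀ z ∈ S, 0 < ‖fderiv ℝ φ z‖ := fun z hz => by
    refine norm_pos_iff.2 fun h0 => ?_
    have := hDpos z hz
    simp [h0] at this
  have hγm : AEMeasurable γ (volume.restrict B) := by
    refine ContinuousOn.aemeasurable ?_ hB.measurableSet
    exact (lineSplit e he).continuous.comp_continuousOn (hg.prodMk continuousOn_id)
  have hνA : ∀ A, MeasurableSet A → A ⊆ S → (volume.restrict B).map γ A =
      volume ((ℝ ∙ e)ᗮ.orthogonalProjectionOnto '' A) := by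
    intro A hA hAS
    rw [Measure.map_apply_of_aemeasurable hγm hA, Measure.restrict_apply' hB.measurableSet]
    congr 1
    ext y
    constructor
    · rintro ⟨hy1, hy2⟩
      exact ⟨γ y, hy1, hpγ y⟩
    · rintro ⟨z, hz, rfl⟩
      obtain ⟨y, hy, rfl⟩ := hSform z (hAS hz)
      rw [hpγ]
      exact ⟨hz, hy⟩
  have hμA : ∀ A, MeasurableSet A → A ⊆ S →
      (((μHE[finrank ℝ (ℝ ∙ e)ᗮ] : Measure E).restrict S).withDensity (fun z => ENNReal.ofReal (h z))) A =
      ∫⁻ z in A, ENNReal.ofReal (h z) ∂μHE[finrank ℝ (ℝ ∙ e)ᗮ] := by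
    intro A hA hAS
    rw [withDensity_apply _ hA, Measure.restrict_restrict hA, inter_eq_left.2 hAS]
  have hcontrol : ∀ c : NNReal, 1 < c → ∀ x ∈ S, ∃ W ∈ 𝓝 x, ∀ A, MeasurableSet A → A ⊆ S ∩ W →
      (volume.restrict B).map γ A ≤ c * (((μHE[finrank ℝ (ℝ ∙ e)ᗮ] : Measure E).restrict S).withDensity
        (fun z => ENNReal.ofReal (h z))) A ∧
      (((μHE[finrank ℝ (ℝ ∙ e)ᗮ] : Measure E).restrict S).withDensity (fun z => ENNReal.ofReal (h z))) A ≤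
        c * (volume.restrict B).map γ A := by
    intro c hc x hx
    -- One factor `k` pays for the distortion of the projection, the other for the oscillation of
    -- the density `h` near `x`.
    obtain ⟨k, hk1, hk⟩ := exists_one_lt_pow_le hc 2
    have hk1' : (1 : ℝ) < k := by exact_mod_cast hk1
    obtain ⟨W, hW, hcomp⟩ := exists_nhds_projection_compare
      (hφ.contDiffAt.hasStrictFDerivAt (x := x) one_ne_zero) he (hDpos x hx) hk1
    have hhx : 0 < h x := div_pos (hDpos x hx) (hDn x hx)
    have hhc : ContinuousAt h x :=
      ((hcD.clm_apply continuous_const).continuousAt).div hcD.norm.continuousAt (hDn x hx).ne'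
    have hW1 : ∀ᶠ z in 𝓝 x, h z < k * h x := hhc.eventually (gt_mem_nhds (by nlinarith))
    have hW2 : ∀ᶠ z in 𝓝 x, h x < k * h z := by
      have : Tendsto (fun z => k * h z) (𝓝 x) (𝓝 (k * h x)) := hhc.const_mul (k : ℝ)
      exact this.eventually (lt_mem_nhds (by nlinarith))
    refine ⟨_, inter_mem hW (hW1.and hW2), fun A hA hAS => ?_⟩
    have hA1 : A ⊆ S := fun z hz => (hAS hz).1
    obtain ⟨hc1, hc2⟩ := hcomp A fun z hz => ⟨(hAS hz).1.1, (hAS hz).2.1⟩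
    rw [hνA A hA hA1, hμA A hA hA1]
    have hkk : (k : ENNReal) * k ≤ c := by
      rw [← sq]; exact_mod_cast hk
    have hup : ∫⁻ z in A, ENNReal.ofReal (h z) ∂μHE[finrank ℝ (ℝ ∙ e)ᗮ] ≤
        k * (ENNReal.ofReal (h x) * μHE[finrank ℝ (ℝ ∙ e)ᗮ] A) := by
      calc _ ≤ ∫⁻ z in A, k * ENNReal.ofReal (h x) ∂μHE[finrank ℝ (ℝ ∙ e)ᗮ] := by
            refine setLIntegral_mono' hA fun z hz => ?_
            rw [← ENNReal.ofReal_coe_nnreal, ← ENNReal.ofReal_mul (by positivity)]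
            exact ENNReal.ofReal_le_ofReal (hAS hz).2.2.1.le
        _ = _ := by rw [setLIntegral_const, mul_assoc]
    have hlow : ENNReal.ofReal (h x) * μHE[finrank ℝ (ℝ ∙ e)ᗮ] A ≤
        k * ∫⁻ z in A, ENNReal.ofReal (h z) ∂μHE[finrank ℝ (ℝ ∙ e)ᗮ] := by
      rw [← lintegral_const_mul' _ _ ENNReal.coe_ne_top, ← setLIntegral_const]
      refine setLIntegral_mono' hA fun z hz => ?_
      rw [← ENNReal.ofReal_coe_nnreal, ← ENNReal.ofReal_mul (by positivity)]
      exact ENNReal.ofReal_le_ofReal (hAS hz).2.2.2.le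
    constructor
    · calc _ ≤ _ := hc1
        _ ≤ k * (k * ∫⁻ z in A, ENNReal.ofReal (h z) ∂μHE[finrank ℝ (ℝ ∙ e)ᗮ]) := by gcongr
        _ ≤ _ := by rw [← mul_assoc]; gcongr
    · calc _ ≤ _ := hup
        _ ≤ k * (k * volume ((ℝ ∙ e)ᗮ.orthogonalProjectionOnto '' A)) := by gcongr
        _ ≤ _ := by rw [← mul_assoc]; gcongr
  -- The two measures agree locally up to any factor `c > 1`. Both are concentrated on `S`, so the
  -- comparison becomes global, and then `c` tends to one.
  refine le_antisymm (measure_le_of_forall_one_lt fun c hc => ?_)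
    (measure_le_of_forall_one_lt fun c hc => ?_)
  · refine measure_le_of_locally_le hSm ?_ fun x hx => ?_
    · rw [Measure.map_apply_of_aemeasurable hγm hSm.compl, Measure.restrict_apply' hB.measurableSet]
      convert measure_empty (μ := (volume : Measure (ℝ ∙ e)ᗮ))
      ext y
      simp only [mem_inter_iff, mem_preimage, mem_compl_iff, mem_empty_iff_false, iff_false, not_and]
      exact fun h1 h2 => h1 (hSγ y h2)
    · obtain ⟨W, hW, hWA⟩ := hcontrol c hc x hx
      exact ⟨W, hW, fun A hA hAS => (hWA A hA hAS).1⟩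
  · refine measure_le_of_locally_le hSm ?_ fun x hx => ?_
    · rw [withDensity_apply _ hSm.compl, Measure.restrict_restrict hSm.compl]
      simp
    · obtain ⟨W, hW, hWA⟩ := hcontrol c hc x hx
      exact ⟨W, hW, fun A hA hAS => (hWA A hA hAS).2⟩

end LevelSet

/-! ### The divergence theorem for regular sublevel sets -/

section LevelSet

open Module Measure

variable {E : Type*} [NormedAddCommGroup E] [InnerProductSpace ℝ E]

theorem continuousOn_conormal {φ : E → ℝ} (hφ : ContDiff ℝ 1 φ)
    (hreg : ∀ x, φ x = 0 → fderiv ℝ φ x ≠ 0) (e : E) :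
    ContinuousOn (fun z => fderiv ℝ φ z e / ‖fderiv ℝ φ z‖) {x | φ x = 0} :=
  ((hφ.continuous_fderiv one_ne_zero).clm_apply continuous_const).continuousOn.div
    (hφ.continuous_fderiv one_ne_zero).norm.continuousOn fun x hx => norm_ne_zero_iff.2 (hreg x hx)

theorem exists_unit_fderiv_pos {D : E →L[ℝ] ℝ} (hD : D ≠ 0) : ∃ e : E, ‖e‖ = 1 ∧ 0 < D e := by
  obtain ⟨v, hv⟩ : ∃ v, D v ≠ 0 := by
    by_contra! h
    exact hD (ContinuousLinearMap.ext h)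
  have hv0 : v ≠ 0 := by rintro rfl; simp at hv
  have hvn : 0 < ‖v‖ := norm_pos_iff.2 hv0
  rcases lt_or_gt_of_ne hv with h | h
  · refine ⟨-(‖v‖⁻¹ • v), by rw [norm_neg, norm_smul, norm_inv, norm_norm, inv_mul_cancel₀ hvn.ne'], ?_⟩
    rw [map_neg, map_smul, smul_eq_mul]
    nlinarith [inv_pos.2 hvn]
  · refine ⟨‖v‖⁻¹ • v, by rw [norm_smul, norm_inv, norm_norm, inv_mul_cancel₀ hvn.ne'], ?_⟩
    rw [map_smul, smul_eq_mul]
    positivity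

variable [FiniteDimensional ℝ E] [MeasurableSpace E] [BorelSpace E]

/-- Fubini along `e` reduces the claim to the fundamental theorem of calculus on `(a, g y)`. The
lower endpoint contributes nothing, since the support of `f` lies in the open cylinder. -/
theorem setIntegral_fderiv_of_graph {φ : E → ℝ} (hφ : Continuous φ) {e : E} (he : ‖e‖ = 1)
    {B : Set (ℝ ∙ e)ᗮ} (hB : MeasurableSet B) {a b : ℝ} {g : (ℝ ∙ e)ᗮ → ℝ}
    (hgraph : ∀ y ∈ B, g y ∈ Ioo a b ∧ ∀ s ∈ Ioo a b, (φ (lineSplit e he (s, y)) < 0 ↔ s < g y))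
    {f : E → ℝ} (hf : ContDiff ℝ 1 f) (hfc : HasCompactSupport f)
    (hfU : tsupport f ⊆ lineSplit e he '' (Ioo a b ×ˢ B)) :
    ∫ z in {z | φ z < 0}, fderiv ℝ f z e = ∫ y in B, f (lineSplit e he (g y, y)) := by
  have hmem : ∀ s y, lineSplit e he (s, y) ∈ tsupport f → s ∈ Ioo a b ∧ y ∈ B := by
    intro s y hsy
    obtain ⟨p, hp, hpe⟩ := hfU hsy
    rw [(lineSplit e he).injective hpe] at hp
    exact hp
  have hFc : Continuous fun z => fderiv ℝ f z e :=
    (hf.continuous_fderiv one_ne_zero).clm_apply continuous_const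
  have hFs : HasCompactSupport fun z => fderiv ℝ f z e := hfc.fderiv_apply ℝ e
  have hF0 : ∀ z ∉ tsupport f, fderiv ℝ f z e = 0 := fun z hz => by
    rw [fderiv_of_notMem_tsupport ℝ hz]; rfl
  have hm : MeasurableSet {z | φ z < 0} := (isOpen_lt hφ continuous_const).measurableSet
  have hint : Integrable ({z | φ z < 0}.indicator fun z => fderiv ℝ f z e) :=
    (hFc.integrable_of_hasCompactSupport hFs).indicator hm
  have hmp := measurePreserving_lineSplit e he
  have hme : MeasurableEmbedding (lineSplit e he) :=
    (lineSplit e he).toHomeomorph.measurableEmbedding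
  rw [← integral_indicator hm, ← hmp.integral_comp hme, Measure.volume_eq_prod,
    integral_prod_symm (fun p => {z | φ z < 0}.indicator (fun z => fderiv ℝ f z e)
      (lineSplit e he p)) ((hmp.integrable_comp_emb hme).2 hint), ← integral_indicator hB]
  congr 1
  funext y
  by_cases hy : y ∈ B
  · rw [indicator_of_mem hy]
    obtain ⟨hgy, hgs⟩ := hgraph y hy
    have h1 : (fun s => {z | φ z < 0}.indicator (fun z => fderiv ℝ f z e) (lineSplit e he (s, y))) =
        (Ioo a (g y)).indicator fun s => fderiv ℝ f (lineSplit e he (s, y)) e := by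
      funext s
      by_cases hs : s ∈ Ioo a b
      · by_cases hsg : s < g y
        · rw [indicator_of_mem (show s ∈ Ioo a (g y) from ⟨hs.1, hsg⟩),
            indicator_of_mem (show _ ∈ {z | φ z < 0} from (hgs s hs).2 hsg)]
        · rw [indicator_of_notMem (show s ∉ Ioo a (g y) from fun h => hsg h.2),
            indicator_of_notMem (show _ ∉ {z | φ z < 0} from fun h => hsg ((hgs s hs).1 h))]
      · rw [indicator_of_notMem (show s ∉ Ioo a (g y) from fun h => hs ⟨h.1, h.2.trans hgy.2⟩)]
        have h0 := hF0 (lineSplit e he (s, y)) fun h => hs (hmem s y h).1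
        exact (indicator_apply_eq_zero (s := {z | φ z < 0})).2 fun _ => h0
    rw [h1, integral_indicator measurableSet_Ioo, ← integral_Ioc_eq_integral_Ioo,
      ← intervalIntegral.integral_of_le hgy.1.le,
      intervalIntegral.integral_eq_sub_of_hasDerivAt
        (f := fun s => f (lineSplit e he (s, y)))
        (fun s _ => hasDerivAt_lineSplit he (hf.differentiable one_ne_zero _))]
    · rw [image_eq_zero_of_notMem_tsupport (f := f) (x := lineSplit e he (a, y))
        (fun h => (hmem a y h).1.1.false), sub_zero]
    · exact (hFc.comp ((lineSplit e he).continuous.comp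
        (by fun_prop : Continuous fun s : ℝ => (s, y)))).intervalIntegrable _ _
  · rw [indicator_of_notMem hy]
    refine integral_eq_zero_of_ae (Eventually.of_forall fun s => ?_)
    have h0 := hF0 (lineSplit e he (s, y)) fun h => hy (hmem s y h).2
    exact (indicator_apply_eq_zero (s := {z | φ z < 0})).2 fun _ => h0

/-- The volume integral is an integral over the base of the graph, and by `map_graph_eq_withDensity`
the lifted base measure is the surface measure weighted by the conormal component. -/
theorem exists_isOpen_setIntegral_fderiv_of_unit {φ : E → ℝ} (hφ : ContDiff ℝ 1 φ) {x e : E}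
    (hx : φ x = 0) (he : ‖e‖ = 1) (hD : 0 < fderiv ℝ φ x e) :
    ∃ U, IsOpen U ∧ x ∈ U ∧ ∀ f : E → ℝ, ContDiff ℝ 1 f → HasCompactSupport f → tsupport f ⊆ U →
      ∫ z in {z | φ z < 0}, fderiv ℝ f z e =
        ∫ z in {z | φ z = 0}, f z * (fderiv ℝ φ z e / ‖fderiv ℝ φ z‖)
          ∂μHE[finrank ℝ (ℝ ∙ e)ᗮ] := by
  obtain ⟨a, b, r, g, hr, hsx, hgc, hg⟩ := exists_graph hφ hx he hD
  set B := Metric.ball ((ℝ ∙ e)ᗮ.orthogonalProjectionOnto x) r with hBdef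
  have hB : IsOpen B := Metric.isOpen_ball
  have hUo : IsOpen (lineSplit e he '' (Ioo a b ×ˢ B)) :=
    (lineSplit e he).toHomeomorph.isOpenMap _ (isOpen_Ioo.prod hB)
  refine ⟨_, hUo, ⟨(lineSplit e he).symm x, ?_, by simp⟩, fun f hf hfc hfU => ?_⟩
  · rw [lineSplit_symm_apply]
    exact ⟨hsx, Metric.mem_ball_self hr⟩
  set U := lineSplit e he '' (Ioo a b ×ˢ B) with hU
  have hγm : AEMeasurable (fun y => lineSplit e he (g y, y)) (volume.restrict B) := by
    refine ContinuousOn.aemeasurable ?_ hB.measurableSet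
    exact (lineSplit e he).continuous.comp_continuousOn (hgc.prodMk continuousOn_id)
  have hDm : Measurable fun z => fderiv ℝ φ z e / ‖fderiv ℝ φ z‖ :=
    ((hφ.continuous_fderiv one_ne_zero).clm_apply continuous_const).measurable.div
      (hφ.continuous_fderiv one_ne_zero).norm.measurable
  have hmap := map_graph_eq_withDensity hφ he hB hgc
    fun y hy => ⟨(hg y hy).1, fun s hs => ⟨((hg y hy).2 s hs).1, ((hg y hy).2 s hs).2.2⟩⟩
  rw [setIntegral_fderiv_of_graph hφ.continuous he hB.measurableSet
    (fun y hy => ⟨(hg y hy).1, fun s hs => ((hg y hy).2 s hs).2.1⟩) hf hfc hfU,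
    ← integral_map hγm hf.continuous.aestronglyMeasurable, hmap,
    integral_withDensity_eq_integral_toReal_smul hDm.ennreal_ofReal (by simp)]
  have hΓm : MeasurableSet {z | φ z = 0} :=
    (isClosed_eq hφ.continuous continuous_const).measurableSet
  have hres : ∫ z in {z | φ z = 0}, f z * (fderiv ℝ φ z e / ‖fderiv ℝ φ z‖)
        ∂μHE[finrank ℝ (ℝ ∙ e)ᗮ] =
      ∫ z in {z | φ z = 0} ∩ U, f z * (fderiv ℝ φ z e / ‖fderiv ℝ φ z‖)
        ∂μHE[finrank ℝ (ℝ ∙ e)ᗮ] := by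
    refine setIntegral_eq_of_subset_of_forall_sdiff_eq_zero hΓm inter_subset_left ?_
    rintro z ⟨hz1, hz2⟩
    have : f z = 0 := image_eq_zero_of_notMem_tsupport fun h => hz2 ⟨hz1, hfU h⟩
    rw [this, zero_mul]
  rw [hres]
  refine setIntegral_congr_fun (hΓm.inter hUo.measurableSet) ?_
  rintro _ ⟨-, ⟨s, y⟩, ⟨hs, hy⟩, rfl⟩
  have h1 := ((hg y hy).2 s hs).1
  simp only [smul_eq_mul]
  rw [ENNReal.toReal_ofReal (by positivity), mul_comm]

variable {d : ℕ} [Fact (finrank ℝ E = d + 1)]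

/-- Near each point the surface measure is controlled by the volume of a bounded projection to a
hyperplane; compactness makes this global. -/
theorem euclideanHausdorffMeasure_levelSet_lt_top {φ : E → ℝ} (hφ : ContDiff ℝ 1 φ)
    (hreg : ∀ x, φ x = 0 → fderiv ℝ φ x ≠ 0) (hc : IsCompact {x | φ x = 0}) :
    μHE[d] {x | φ x = 0} < ⊤ := by
  refine hc.measure_lt_top_of_nhdsWithin fun x hx => ?_
  obtain ⟨e, he, hD⟩ := exists_unit_fderiv_pos (hreg x hx)
  have he0 : e ≠ 0 := by rintro rfl; simp at he
  have hd : finrank ℝ (ℝ ∙ e)ᗮ = d := Submodule.finrank_orthogonal_span_singleton he0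
  obtain ⟨W, hW, hWA⟩ := exists_nhds_projection_compare
    (hφ.contDiffAt.hasStrictFDerivAt (x := x) one_ne_zero) he hD (c := 2) (by norm_num)
  obtain ⟨h1, h2⟩ := hWA ({z | φ z = 0} ∩ (W ∩ Metric.ball x 1))
    (inter_subset_inter_right _ inter_subset_left)
  refine ⟨{z | φ z = 0} ∩ (W ∩ Metric.ball x 1), inter_mem_nhdsWithin _
    (inter_mem hW (Metric.ball_mem_nhds x one_pos)), ?_⟩
  rw [hd] at h2
  have h3 : volume ((ℝ ∙ e)ᗮ.orthogonalProjectionOnto '' ({z | φ z = 0} ∩ (W ∩ Metric.ball x 1)))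
      < ⊤ := by
    refine Bornology.IsBounded.measure_lt_top ?_
    refine ((ContinuousLinearMap.lipschitz _).isBounded_image ?_)
    exact Metric.isBounded_ball.subset fun z hz => hz.2.2
  have h4 := h2.trans_lt (ENNReal.mul_lt_top ENNReal.coe_lt_top h3)
  refine lt_top_iff_ne_top.2 fun htop => ?_
  rw [htop, ENNReal.mul_top] at h4
  · exact h4.ne rfl
  · rw [ne_eq, ENNReal.ofReal_eq_zero, not_le]
    exact div_pos hD (norm_pos_iff.2 (hreg x hx))

variable (d) in
-- Both sides are homogeneous in `e`, so the direction need not be a unit vector.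
theorem exists_isOpen_setIntegral_fderiv_of_pos {φ : E → ℝ} (hφ : ContDiff ℝ 1 φ) {x e : E}
    (hx : φ x = 0) (hD : 0 < fderiv ℝ φ x e) :
    ∃ U, IsOpen U ∧ x ∈ U ∧ ∀ f : E → ℝ, ContDiff ℝ 1 f → HasCompactSupport f → tsupport f ⊆ U →
      ∫ z in {z | φ z < 0}, fderiv ℝ f z e =
        ∫ z in {z | φ z = 0}, f z * (fderiv ℝ φ z e / ‖fderiv ℝ φ z‖) ∂μHE[d] := by
  have he0 : e ≠ 0 := by rintro rfl; simp at hD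
  have hen : 0 < ‖e‖ := norm_pos_iff.2 he0
  have hu : ‖‖e‖⁻¹ • e‖ = 1 := by rw [norm_smul, norm_inv, norm_norm, inv_mul_cancel₀ hen.ne']
  have hu0 : ‖e‖⁻¹ • e ≠ 0 := by rw [← norm_ne_zero_iff, hu]; exact one_ne_zero
  have hd : finrank ℝ (ℝ ∙ (‖e‖⁻¹ • e))ᗮ = d := Submodule.finrank_orthogonal_span_singleton hu0
  obtain ⟨U, hU, hxU, h⟩ := exists_isOpen_setIntegral_fderiv_of_unit hφ hx hu (by
    rw [map_smul, smul_eq_mul]; positivity)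
  refine ⟨U, hU, hxU, fun f hf hfc hfU => ?_⟩
  have h1 := h f hf hfc hfU
  rw [hd] at h1
  simp only [map_smul, smul_eq_mul, mul_div_assoc] at h1
  rw [integral_const_mul] at h1
  have h2 : ∀ z, f z * (‖e‖⁻¹ * (fderiv ℝ φ z e / ‖fderiv ℝ φ z‖)) =
      ‖e‖⁻¹ * (f z * (fderiv ℝ φ z e / ‖fderiv ℝ φ z‖)) := fun z => by ring
  simp only [h2] at h1
  rw [integral_const_mul] at h1
  exact mul_left_cancel₀ (inv_ne_zero hen.ne') h1

theorem integrableOn_levelSet {φ : E → ℝ} (hφ : ContDiff ℝ 1 φ)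
    (hreg : ∀ x, φ x = 0 → fderiv ℝ φ x ≠ 0) (hc : IsCompact {x | φ x = 0}) {F : Type*}
    [NormedAddCommGroup F] {u : E → F}
    (hu : ContinuousOn u {x | φ x = 0}) : IntegrableOn u {x | φ x = 0} μHE[d] := by
  have : IsFiniteMeasure ((μHE[d] : Measure E).restrict {x | φ x = 0}) :=
    ⟨by rw [Measure.restrict_apply_univ]; exact euclideanHausdorffMeasure_levelSet_lt_top hφ hreg hc⟩
  obtain ⟨C, hC⟩ := hc.exists_bound_of_continuousOn hu
  refine Integrable.mono' (integrable_const C)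
    (hu.aestronglyMeasurable_of_isCompact hc hc.measurableSet) ?_
  exact (ae_restrict_iff' hc.measurableSet).2 (Eventually.of_forall hC)

variable (d) in
-- Inside, the derivative of a compactly supported function integrates to zero; outside, both sides
-- vanish. At a boundary point the identity is linear in the direction, and every `e` is a
-- combination of two directions that cross the surface outwards.
theorem exists_isOpen_setIntegral_fderiv {φ : E → ℝ} (hφ : ContDiff ℝ 1 φ)
    (hreg : ∀ x, φ x = 0 → fderiv ℝ φ x ≠ 0) (hc : IsCompact {x | φ x = 0}) (x e : E) :
    ∃ U, IsOpen U ∧ x ∈ U ∧ ∀ f : E → ℝ, ContDiff ℝ 1 f → HasCompactSupport f → tsupport f ⊆ U →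
      ∫ z in {z | φ z < 0}, fderiv ℝ f z e =
        ∫ z in {z | φ z = 0}, f z * (fderiv ℝ φ z e / ‖fderiv ℝ φ z‖) ∂μHE[d] := by
  rcases lt_trichotomy (φ x) 0 with hx | hx | hx
  · refine ⟨{z | φ z < 0}, isOpen_lt hφ.continuous continuous_const, hx, fun f hf hfc hfU => ?_⟩
    have hFc : Continuous fun z => fderiv ℝ f z e :=
      (hf.continuous_fderiv one_ne_zero).clm_apply continuous_const
    rw [setIntegral_eq_integral_of_forall_compl_eq_zero fun z hz => by
        rw [fderiv_of_notMem_tsupport ℝ fun h => hz (hfU h)]; rfl,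
      setIntegral_eq_zero_of_forall_eq_zero fun z hz => by
        rw [image_eq_zero_of_notMem_tsupport (f := f) fun h => (hfU h).ne hz, zero_mul]]
    -- Integration by parts against the constant function one.
    have := integral_mul_fderiv_eq_neg_fderiv_mul_of_integrable (μ := (volume : Measure E))
      (f := fun _ => (1 : ℝ)) (g := f) (v := e) (by simp)
      (by simpa using hFc.integrable_of_hasCompactSupport (hfc.fderiv_apply ℝ e))
      (by simpa using hf.continuous.integrable_of_hasCompactSupport hfc)
      (fun _ _ => differentiableAt_const _) (fun _ _ => hf.differentiable one_ne_zero _)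
    simpa using this
  · obtain ⟨n, hn1, hn⟩ := exists_unit_fderiv_pos (hreg x hx)
    -- With this `t` the derivative along `e + t • n` is `fderiv ℝ φ x e + 1 + |fderiv ℝ φ x e|`,
    -- which is at least one.
    set t : ℝ := (1 + |fderiv ℝ φ x e|) / fderiv ℝ φ x n with ht
    have hpos : 0 < fderiv ℝ φ x (e + t • n) := by
      rw [map_add, map_smul, smul_eq_mul, ht, div_mul_cancel₀ _ hn.ne']
      linarith [neg_abs_le (fderiv ℝ φ x e)]
    obtain ⟨U1, hU1, hxU1, h1⟩ := exists_isOpen_setIntegral_fderiv_of_pos d hφ hx hn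
    obtain ⟨U2, hU2, hxU2, h2⟩ := exists_isOpen_setIntegral_fderiv_of_pos d hφ hx hpos
    refine ⟨U1 ∩ U2, hU1.inter hU2, ⟨hxU1, hxU2⟩, fun f hf hfc hfU => ?_⟩
    have h1 := h1 f hf hfc fun z hz => (hfU hz).1
    have h2 := h2 f hf hfc fun z hz => (hfU hz).2
    have hFi : ∀ v, Integrable (fun z => fderiv ℝ f z v) := fun v =>
      ((hf.continuous_fderiv one_ne_zero).clm_apply
        continuous_const).integrable_of_hasCompactSupport (hfc.fderiv_apply ℝ v)
    have hBi : ∀ v, IntegrableOn (fun z => f z * (fderiv ℝ φ z v / ‖fderiv ℝ φ z‖))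
        {z | φ z = 0} μHE[d] := fun v =>
      integrableOn_levelSet hφ hreg hc
        (hf.continuous.continuousOn.mul (continuousOn_conormal hφ hreg v))
    simp only [map_add, map_smul, smul_eq_mul, add_div, mul_div_assoc, mul_add,
      mul_left_comm (f _) t] at h2
    rw [integral_add (hFi e).integrableOn ((hFi n).const_mul t).integrableOn,
      integral_add (hBi e) ((hBi n).const_mul t), integral_const_mul, integral_const_mul, h1] at h2
    exact add_right_cancel h2
  · refine ⟨{z | 0 < φ z}, isOpen_lt continuous_const hφ.continuous, hx, fun f hf hfc hfU => ?_⟩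
    rw [setIntegral_eq_zero_of_forall_eq_zero fun z hz => by
        rw [fderiv_of_notMem_tsupport ℝ fun h => lt_asymm (show φ z < 0 from hz) (hfU h)]; rfl,
      setIntegral_eq_zero_of_forall_eq_zero fun z hz => by
        rw [image_eq_zero_of_notMem_tsupport (f := f) fun h => (hfU h).ne' hz, zero_mul]]

variable (d) in
/-- **Divergence theorem** in the direction `e` for a bounded regular sublevel set. -/
theorem setIntegral_fderiv_eq_levelSet {φ : E → ℝ} (hφ : ContDiff ℝ 1 φ)
    (hreg : ∀ x, φ x = 0 → fderiv ℝ φ x ≠ 0) (hc : IsCompact {x | φ x ≤ 0}) (e : E)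
    {f : E → ℝ} (hf : ContDiff ℝ 1 f) :
    ∫ z in {z | φ z < 0}, fderiv ℝ f z e =
      ∫ z in {z | φ z = 0}, f z * (fderiv ℝ φ z e / ‖fderiv ℝ φ z‖) ∂μHE[d] := by
  have hc0 : IsCompact {x | φ x = 0} :=
    hc.of_isClosed_subset (isClosed_eq hφ.continuous continuous_const) fun x hx => le_of_eq hx
  choose U hU hxU h using fun x => exists_isOpen_setIntegral_fderiv d hφ hreg hc0 x e
  -- Intersecting with balls gives the localized functions compact support, although `f` itself need
  -- not have it.
  set V : E → Set E := fun x => U x ∩ Metric.ball x 1 with hV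
  have hVo : ∀ x, IsOpen (V x) := fun x => (hU x).inter Metric.isOpen_ball
  obtain ⟨t, ht⟩ := hc.elim_finite_subcover V hVo
    fun x _ => mem_iUnion.2 ⟨x, hxU x, Metric.mem_ball_self one_pos⟩
  obtain ⟨ρ, hρ⟩ := SmoothPartitionOfUnity.exists_isSubordinate (modelWithCornersSelf ℝ E)
    hc.isClosed (fun i : t => V i) (fun i => hVo i) (by
      refine ht.trans ?_
      intro z hz
      obtain ⟨i, hi, hz⟩ := mem_iUnion₂.1 hz
      exact mem_iUnion.2 ⟨⟨i, hi⟩, hz⟩)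
  have hρs : ∀ i, ContDiff ℝ 1 (ρ i) := fun i => ((ρ i).contMDiff.contDiff).of_le (by simp)
  have hsum : ∀ z, φ z ≤ 0 → ∑ i, ρ i z = 1 := fun z hz => by
    rw [← finsum_eq_sum_of_fintype]; exact ρ.sum_eq_one hz
  set F : t → E → ℝ := fun i z => ρ i z * f z with hF
  have hFd : ∀ i, ContDiff ℝ 1 (F i) := fun i => (hρs i).mul hf
  have hts : ∀ i, tsupport (F i) ⊆ V i := fun i => (tsupport_mul_subset_left).trans (hρ i)
  have hFc : ∀ i, HasCompactSupport (F i) := fun i =>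
    Metric.isCompact_of_isClosed_isBounded (isClosed_tsupport _)
      (Metric.isBounded_ball.subset fun z hz => (hts i hz).2)
  have hFsum : ∀ z, φ z ≤ 0 → f z = ∑ i, F i z := fun z hz => by
    simp only [hF, ← Finset.sum_mul, hsum z hz, one_mul]
  have hm : MeasurableSet {z | φ z < 0} := (isOpen_lt hφ.continuous continuous_const).measurableSet
  -- The partition is known to sum to one only on `{φ ≤ 0}`. At a point of the open set `{φ < 0}`
  -- this covers a neighbourhood, so derivatives may be compared there.
  have hL : ∫ z in {z | φ z < 0}, fderiv ℝ f z e =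
      ∫ z in {z | φ z < 0}, ∑ i, fderiv ℝ (F i) z e := by
    refine setIntegral_congr_fun hm fun z hz => ?_
    have : f =ᶠ[𝓝 z] fun y => ∑ i, F i y := by
      filter_upwards [(isOpen_lt hφ.continuous continuous_const).mem_nhds hz] with y hy
      exact hFsum y (le_of_lt hy)
    rw [this.fderiv_eq, fderiv_fun_sum fun i _ => (hFd i).differentiable one_ne_zero _]
    simp
  have hR : ∫ z in {z | φ z = 0}, f z * (fderiv ℝ φ z e / ‖fderiv ℝ φ z‖) ∂μHE[d] =
      ∫ z in {z | φ z = 0}, ∑ i, F i z * (fderiv ℝ φ z e / ‖fderiv ℝ φ z‖) ∂μHE[d] := by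
    refine setIntegral_congr_fun hc0.measurableSet fun z hz => ?_
    rw [hFsum z (le_of_eq hz), Finset.sum_mul]
  rw [hL, hR, integral_finsetSum, integral_finsetSum]
  · exact Finset.sum_congr rfl fun i _ => h i (F i) (hFd i) (hFc i) fun z hz => (hts i hz).1
  · exact fun i _ => integrableOn_levelSet hφ hreg hc0
      ((hFd i).continuous.continuousOn.mul (continuousOn_conormal hφ hreg e))
  · exact fun i _ => (((hFd i).continuous_fderiv one_ne_zero).clm_apply
        continuous_const).integrable_of_hasCompactSupport ((hFc i).fderiv_apply ℝ e) |>.integrableOn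

end LevelSet

/-! ### Tangent vectors to level sets -/

theorem HasDerivAt.eventually_neg_right {h : ℝ → ℝ} {m a : ℝ} (hd : HasDerivAt h m a)
    (h0 : h a = 0) (hm : m < 0) : ∀ᶠ t in 𝓝[>] a, h t < 0 := by
  have := (hasDerivWithinAt_iff_tendsto_slope' (self_notMem_Ioi)).1 (hd.hasDerivWithinAt (s := Ioi a))
  filter_upwards [this.eventually (gt_mem_nhds hm), self_mem_nhdsWithin] with t ht hta
  rw [slope_def_field, h0, sub_zero] at ht
  by_contra! hcon
  exact absurd ht (not_lt.2 (div_nonneg hcon (sub_pos.2 hta).le))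

theorem HasDerivAt.eventually_pos_right {h : ℝ → ℝ} {m a : ℝ} (hd : HasDerivAt h m a)
    (h0 : h a = 0) (hm : 0 < m) : ∀ᶠ t in 𝓝[>] a, 0 < h t := by
  have := hd.neg.eventually_neg_right (by simp [h0]) (by linarith)
  filter_upwards [this] with t ht
  simpa using ht

theorem DifferentiableAt.hasDerivAt_along {E : Type*} [NormedAddCommGroup E] [NormedSpace ℝ E]
    {φ : E → ℝ} {x : E} (h : DifferentiableAt ℝ φ x) (v : E) :
    HasDerivAt (fun t : ℝ => φ (x + t • v)) (fderiv ℝ φ x v) 0 := by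
  have h1 : HasDerivAt (fun t : ℝ => x + t • v) v 0 := by
    simpa using ((hasDerivAt_id (0 : ℝ)).smul_const v).const_add x
  have h2 : HasFDerivAt φ (fderiv ℝ φ x) (x + (0 : ℝ) • v) := by simpa using h.hasFDerivAt
  exact h2.comp_hasDerivAt 0 h1

/-- Vectors annihilated by the derivative of a defining function are tangent to its zero set. -/
theorem mem_tangentConeAt_levelSet {E : Type*} [NormedAddCommGroup E] [NormedSpace ℝ E]
    {φ : E → ℝ} (hφ : ContDiff ℝ 1 φ) {x τ : E} (hx : φ x = 0) (hreg : fderiv ℝ φ x ≠ 0)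
    (hτ : fderiv ℝ φ x τ = 0) : τ ∈ tangentConeAt ℝ {z | φ z = 0} x := by
  obtain ⟨n, hn⟩ : ∃ n, 0 < fderiv ℝ φ x n := by
    obtain ⟨v, hv⟩ : ∃ v, fderiv ℝ φ x v ≠ 0 := by
      by_contra! h
      exact hreg (ContinuousLinearMap.ext h)
    rcases lt_or_gt_of_ne hv with h | h
    · exact ⟨-v, by rw [map_neg]; linarith⟩
    · exact ⟨v, h⟩
  have hd : DifferentiableAt ℝ φ x := hφ.differentiable one_ne_zero x
  -- Tilting `τ` by `±ε n` makes `φ` change sign at a common small time, so some intermediate tilt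
  -- `s` lands on the zero set. As `ε` tends to zero these secants converge to `τ`.
  have hex : ∀ k : ℕ, ∃ t s : ℝ, 0 < t ∧ t < 1 / ((k : ℝ) + 1) ∧ |s| ≤ 1 / ((k : ℝ) + 1) ∧
      φ (x + t • (τ + s • n)) = 0 := by
    intro k
    set ε : ℝ := 1 / ((k : ℝ) + 1) with hε
    have hεp : 0 < ε := by positivity
    have h1 := (hd.hasDerivAt_along (τ + ε • n)).eventually_pos_right (by simpa using hx)
      (by rw [map_add, map_smul, hτ, zero_add, smul_eq_mul]; positivity)
    have h2 := (hd.hasDerivAt_along (τ + (-ε) • n)).eventually_neg_right (by simpa using hx)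
      (by rw [map_add, map_smul, hτ, zero_add, smul_eq_mul]; nlinarith)
    obtain ⟨t, ⟨⟨ht1, ht2⟩, ht3⟩, ht4⟩ := ((h1.and h2).and
      (Ioo_mem_nhdsGT hεp)).and self_mem_nhdsWithin |>.exists
    obtain ⟨s, hs, hs0⟩ := intermediate_value_Icc (by linarith : -ε ≤ ε)
      (f := fun s : ℝ => φ (x + t • (τ + s • n)))
      (hφ.continuous.comp (by fun_prop)).continuousOn ⟨ht2.le, ht1.le⟩
    exact ⟨t, s, ht3.1, ht3.2, abs_le.2 hs, hs0⟩
  choose t s ht htk hs hzero using hex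
  have h0 : Tendsto (fun k : ℕ => 1 / ((k : ℝ) + 1)) atTop (𝓝 0) :=
    tendsto_one_div_add_atTop_nhds_zero_nat
  have hs0 : Tendsto s atTop (𝓝 0) := squeeze_zero_norm hs h0
  have ht0 : Tendsto t atTop (𝓝 0) := squeeze_zero (fun k => (ht k).le) (fun k => (htk k).le) h0
  have hsn : Tendsto (fun k => τ + s k • n) atTop (𝓝 τ) := by
    simpa using (hs0.smul_const n).const_add τ
  refine mem_tangentConeAt_of_seq atTop (fun k => (t k)⁻¹) (fun k => t k • (τ + s k • n)) ?_
    (Eventually.of_forall hzero) ?_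
  · simpa using ht0.smul hsn
  · refine hsn.congr fun k => ?_
    rw [smul_smul, inv_mul_cancel₀ (ht k).ne', one_smul]

namespace TwoPhaseSurfaceFlow

/-! ### The derivative in coordinates -/

theorem toLp_eq_sum (v : Vec3) :
    (WithLp.toLp 2 v : E3) = ∑ i, v i • EuclideanSpace.single i (1 : ℝ) := by
  ext j
  simp [Finset.sum_apply, Pi.single_apply]

theorem fderiv_toLp (g : E3 → ℝ) (x : E3) (v : Vec3) :
    fderiv ℝ g x (WithLp.toLp 2 v) = grad g x ⬝ᵥ v := by
  rw [toLp_eq_sum, map_sum, dotProduct]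
  refine Finset.sum_congr rfl fun i _ => ?_
  rw [map_smul, smul_eq_mul, mul_comm]
  rfl

theorem norm_fderiv_sq (g : E3 → ℝ) (x : E3) : ‖fderiv ℝ g x‖ ^ 2 = grad g x ⬝ᵥ grad g x := by
  set w := (InnerProductSpace.toDual ℝ E3).symm (fderiv ℝ g x) with hw
  have h1 : ‖fderiv ℝ g x‖ = ‖w‖ := by simp [hw]
  have h2 : ∀ i, w i = grad g x i := fun i => by
    have : inner ℝ w (EuclideanSpace.single i (1 : ℝ)) = fderiv ℝ g x (EuclideanSpace.single i 1) := by
      rw [hw, InnerProductSpace.toDual_symm_apply]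
    rw [EuclideanSpace.inner_single_right] at this
    simpa [grad, pd] using this
  rw [h1, EuclideanSpace.real_norm_sq_eq, dotProduct]
  exact Finset.sum_congr rfl fun i _ => by rw [h2, sq]

theorem norm_fderiv_eq (g : E3 → ℝ) (x : E3) :
    ‖fderiv ℝ g x‖ = √(grad g x ⬝ᵥ grad g x) := by
  rw [← norm_fderiv_sq, Real.sqrt_sq (norm_nonneg _)]

/-! ### Regular sublevel sets -/

/-- `U` is the bounded regular sublevel set `{φ < 0}`. -/
structure IsDefining (U : Set E3) (φ : E3 → ℝ) : Prop where
  smooth : ContDiff ℝ ∞ φ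
  eq : U = {x | φ x < 0}
  reg : ∀ x, φ x = 0 → fderiv ℝ φ x ≠ 0
  compact : IsCompact (closure U)

/-- The unit normal of the level sets of `φ`, extended smoothly across critical points. -/
noncomputable def normalExt (φ : E3 → ℝ) (x : E3) : Vec3 :=
  (√(grad φ x ⬝ᵥ grad φ x + φ x ^ 2))⁻¹ • grad φ x

theorem IsOuterUnitNormal.eventually_mem {U : Set E3} {x : E3} {ν : Vec3}
    (h : IsOuterUnitNormal U x ν) {v : Vec3} (hv : ν ⬝ᵥ v < 0) :
    ∀ᶠ t : ℝ in 𝓝[>] 0, x + t • (WithLp.toLp 2 v : E3) ∈ U := by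
  obtain ⟨-, g, hg, hgx, hU, c, hc, hgrad⟩ := h
  have h1 := ((hg.differentiableAt one_ne_zero).hasDerivAt_along
    (WithLp.toLp 2 v)).eventually_neg_right (by simpa using hgx)
    (by rw [fderiv_toLp, hgrad, smul_dotProduct, smul_eq_mul]; nlinarith)
  have h2 : Tendsto (fun t : ℝ => x + t • (WithLp.toLp 2 v : E3)) (𝓝[>] 0) (𝓝 x) := by
    have : Continuous fun t : ℝ => x + t • (WithLp.toLp 2 v : E3) := by fun_prop
    simpa using (this.tendsto 0).mono_left nhdsWithin_le_nhds
  filter_upwards [h1, h2.eventually hU] with t ht1 ht2 using ht2.2 ht1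

theorem IsOuterUnitNormal.eventually_notMem {U : Set E3} {x : E3} {ν : Vec3}
    (h : IsOuterUnitNormal U x ν) {v : Vec3} (hv : 0 < ν ⬝ᵥ v) :
    ∀ᶠ t : ℝ in 𝓝[>] 0, x + t • (WithLp.toLp 2 v : E3) ∉ U := by
  obtain ⟨-, g, hg, hgx, hU, c, hc, hgrad⟩ := h
  have h1 := ((hg.differentiableAt one_ne_zero).hasDerivAt_along
    (WithLp.toLp 2 v)).eventually_pos_right (by simpa using hgx)
    (by rw [fderiv_toLp, hgrad, smul_dotProduct, smul_eq_mul]; positivity)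
  have h2 : Tendsto (fun t : ℝ => x + t • (WithLp.toLp 2 v : E3)) (𝓝[>] 0) (𝓝 x) := by
    have : Continuous fun t : ℝ => x + t • (WithLp.toLp 2 v : E3) := by fun_prop
    simpa using (this.tendsto 0).mono_left nhdsWithin_le_nhds
  filter_upwards [h1, h2.eventually hU] with t ht1 ht2 hmem
  exact lt_asymm ht1 (ht2.1 hmem)

/-- For distinct unit normals, the direction `ν' - ν` points strictly into `U` according to `ν` and
strictly out of it according to `ν'`. -/
theorem IsOuterUnitNormal.unique {U : Set E3} {x : E3} {ν ν' : Vec3}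
    (h : IsOuterUnitNormal U x ν) (h' : IsOuterUnitNormal U x ν') : ν = ν' := by
  by_contra hne
  have h1 := h.1
  have h2 := h'.1
  have hpos : 0 < (ν' - ν) ⬝ᵥ (ν' - ν) := by
    have h0 : (ν' - ν) ⬝ᵥ (ν' - ν) ≠ 0 := fun h0 =>
      hne (sub_eq_zero.1 (dotProduct_self_eq_zero.1 h0)).symm
    exact lt_of_le_of_ne (Finset.sum_nonneg fun i _ => mul_self_nonneg _) h0.symm
  have hexp : (ν' - ν) ⬝ᵥ (ν' - ν) = 2 - 2 * (ν ⬝ᵥ ν') := by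
    rw [sub_dotProduct, dotProduct_sub, dotProduct_sub, h1, h2, dotProduct_comm ν' ν]; ring
  have ha := h.eventually_mem (v := ν' - ν) (by rw [dotProduct_sub, h1]; linarith)
  have hb := h'.eventually_notMem (v := ν' - ν) (by
    rw [dotProduct_sub, h2, dotProduct_comm ν' ν]; linarith)
  obtain ⟨t, ht1, ht2⟩ := (ha.and hb).exists
  exact ht2 ht1

theorem outerNormal_eq {U : Set E3} {x : E3} {ν : Vec3} (h : IsOuterUnitNormal U x ν) :
    outerNormal U x = ν := by
  have hex : ∃ ν, IsOuterUnitNormal U x ν := ⟨ν, h⟩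
  rw [outerNormal, dif_pos hex]
  exact hex.choose_spec.unique h

theorem tpd_congr {U : Set E3} {g g' : E3 → ℝ} (hg : EqOn g g' (frontier U)) {x : E3} (hx : x ∈ frontier U)
    (i : Fin 3) : tpd U i g x = tpd U i g' x := by
  rw [tpd, tpd, fderivWithin_congr hg (hg hx)]

theorem continuous_pd {g : E3 → ℝ} (hg : ContDiff ℝ 1 g) (i : Fin 3) : Continuous (pd i g) :=
  (hg.continuous_fderiv one_ne_zero).clm_apply continuous_const

theorem continuous_div {V : E3 → Vec3} (hV : ∀ i, ContDiff ℝ 1 fun y => V y i) :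
    Continuous (div V) := by
  unfold div
  exact continuous_finsetSum _ fun i _ => continuous_pd (hV i) i

instance : Fact (Module.finrank ℝ E3 = 2 + 1) := ⟨by simp⟩

namespace IsDefining

variable {U : Set E3} {φ : E3 → ℝ} (h : IsDefining U φ)

include h

theorem contDiff_one : ContDiff ℝ 1 φ := h.smooth.of_le (by simp)

theorem isOpen : IsOpen U := by
  rw [h.eq]; exact isOpen_lt h.smooth.continuous continuous_const

theorem closure_eq : closure U = {x | φ x ≤ 0} := by
  refine Subset.antisymm ?_ fun x hx => ?_
  · rw [h.eq]
    exact closure_lt_subset_le h.smooth.continuous continuous_const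
  · rcases lt_or_eq_of_le (show φ x ≤ 0 from hx) with hlt | heq
    · exact subset_closure (by rw [h.eq]; exact hlt)
    · obtain ⟨e, -, he⟩ := exists_unit_fderiv_pos (h.reg x heq)
      have h1 := ((h.contDiff_one.differentiable one_ne_zero x).hasDerivAt_along
        (-e)).eventually_neg_right (by simpa using heq) (by rw [map_neg]; linarith)
      have h2 : Tendsto (fun t : ℝ => x + t • (-e)) (𝓝[>] 0) (𝓝 x) := by
        have : Continuous fun t : ℝ => x + t • (-e) := by fun_prop
        simpa using (this.tendsto 0).mono_left nhdsWithin_le_nhds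
      refine mem_closure_of_tendsto h2 ?_
      filter_upwards [h1] with t ht
      rw [h.eq]; exact ht

theorem frontier_eq : frontier U = {x | φ x = 0} := by
  rw [h.isOpen.frontier_eq, h.closure_eq, h.eq]
  ext x
  simp only [Set.mem_sdiff, mem_ofPred_eq, not_lt]
  exact ⟨fun hx => le_antisymm hx.1 hx.2, fun hx => ⟨hx.le, hx.ge⟩⟩

theorem isCompact_frontier : IsCompact (frontier U) :=
  h.compact.of_isClosed_subset isClosed_frontier frontier_subset_closure

theorem hausdorff_frontier_lt_top : (μHE[2] : Measure E3) (frontier U) < ⊤ := by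
  have hc := h.isCompact_frontier
  rw [h.frontier_eq] at hc ⊢
  exact euclideanHausdorffMeasure_levelSet_lt_top h.contDiff_one h.reg hc

/-- A set of finite two-dimensional measure is null in dimension three. -/
theorem volume_frontier : volume (frontier U) = 0 := by
  have h1 := InnerProductSpace.euclideanHausdorffMeasure_eq_volume (V := E3)
  rw [show Module.finrank ℝ E3 = 3 by simp] at h1
  rw [← h1]
  exact (Measure.euclideanHausdorffMeasure_zero_or_top (by norm_num : 2 < 3) _).resolve_right
    h.hausdorff_frontier_lt_top.ne

theorem integrableOn_frontier {F : Type*} [NormedAddCommGroup F] {u : E3 → F}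
    (hu : ContinuousOn u (frontier U)) : IntegrableOn u (frontier U) μHE[2] := by
  have hc := h.isCompact_frontier
  rw [h.frontier_eq] at hc hu ⊢
  exact integrableOn_levelSet h.contDiff_one h.reg hc hu

theorem integrableOn_of_continuous {F : Type*} [NormedAddCommGroup F] {u : E3 → F}
    (hu : Continuous u) : IntegrableOn u U :=
  (hu.continuousOn.integrableOn_compact h.compact).mono_set subset_closure

theorem isOuterUnitNormal {x : E3} (hx : x ∈ frontier U) :
    IsOuterUnitNormal U x (normalExt φ x) := by
  rw [h.frontier_eq] at hx
  have hx0 : φ x = 0 := hx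
  have hn : 0 < ‖fderiv ℝ φ x‖ := norm_pos_iff.2 (h.reg x hx0)
  have hN : normalExt φ x = ‖fderiv ℝ φ x‖⁻¹ • grad φ x := by
    rw [normalExt, hx0, norm_fderiv_eq]; simp
  refine ⟨?_, φ, h.contDiff_one.contDiffAt, hx0,
    Eventually.of_forall fun y => by rw [h.eq]; rfl, ‖fderiv ℝ φ x‖, hn, ?_⟩
  · rw [hN, smul_dotProduct, dotProduct_smul, ← norm_fderiv_sq, smul_eq_mul, smul_eq_mul]
    field_simp
  · rw [hN, smul_smul, mul_inv_cancel₀ hn.ne', one_smul]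

theorem outerNormal_eq {x : E3} (hx : x ∈ frontier U) : outerNormal U x = normalExt φ x :=
  TwoPhaseSurfaceFlow.outerNormal_eq (h.isOuterUnitNormal hx)

theorem outerNormal_dotProduct_self {x : E3} (hx : x ∈ frontier U) :
    outerNormal U x ⬝ᵥ outerNormal U x = 1 := by
  rw [h.outerNormal_eq hx]; exact (h.isOuterUnitNormal hx).1

/-- On the zero set the gradient does not vanish; off it the summand `φ x ^ 2` is positive. This is
what makes `normalExt` smooth everywhere while leaving its values on the surface unchanged. -/
theorem radicand_pos (x : E3) : 0 < grad φ x ⬝ᵥ grad φ x + φ x ^ 2 := by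
  rw [← norm_fderiv_sq]
  by_cases hx : φ x = 0
  · have := norm_pos_iff.2 (h.reg x hx)
    positivity
  · positivity

theorem outerNormal_apply {x : E3} (hx : x ∈ frontier U) (i : Fin 3) :
    outerNormal U x i = fderiv ℝ φ x (EuclideanSpace.single i 1) / ‖fderiv ℝ φ x‖ := by
  rw [h.outerNormal_eq hx]
  rw [h.frontier_eq] at hx
  have hx0 : φ x = 0 := hx
  rw [normalExt, hx0, norm_fderiv_eq]
  simp [grad, pd, div_eq_inv_mul]

theorem continuousOn_outerNormal : ContinuousOn (outerNormal U) (frontier U) := by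
  refine continuousOn_pi.2 fun i => ?_
  refine ContinuousOn.congr ?_ fun x hx => h.outerNormal_apply hx i
  rw [h.frontier_eq]
  exact continuousOn_conormal h.contDiff_one h.reg _

/-- **Divergence theorem** on a bounded regular sublevel set. -/
theorem setIntegral_div {V : E3 → Vec3} (hV : ∀ i, ContDiff ℝ 1 fun y => V y i) :
    ∫ x in U, div V x = ∫ x in frontier U, V x ⬝ᵥ outerNormal U x ∂μHE[2] := by
  unfold div dotProduct
  rw [integral_finsetSum _ fun i _ => h.integrableOn_of_continuous (continuous_pd (hV i) i),
    integral_finsetSum (f := fun i x => V x i * outerNormal U x i) _ fun i _ =>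
      h.integrableOn_frontier ((hV i).continuous.continuousOn.mul (continuousOn_pi.1 h.continuousOn_outerNormal i))]
  refine Finset.sum_congr rfl fun i _ => ?_
  have hc := h.compact
  rw [h.closure_eq] at hc
  have h1 := setIntegral_fderiv_eq_levelSet 2 h.contDiff_one h.reg hc (EuclideanSpace.single i 1)
    (hV i)
  rw [← h.eq, ← h.frontier_eq] at h1
  refine h1.trans (setIntegral_congr_fun isClosed_frontier.measurableSet fun x hx => ?_)
  simp only [h.outerNormal_apply hx i]

/-! ### Tangential derivatives -/

/-- A derivative within the surface is determined only on its tangent cone. The vector `P eᵢ` lies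
in that cone by `mem_tangentConeAt_levelSet`, so there the full derivative of `g` gives the same
value. -/
theorem tpd_eq {g : E3 → ℝ} {x : E3} (hg : DifferentiableAt ℝ g x) (hx : x ∈ frontier U)
    (i : Fin 3) :
    tpd U i g x = pd i g x - outerNormal U x i * (outerNormal U x ⬝ᵥ grad g x) := by
  set n := outerNormal U x with hn
  have hvec : tproj U x *ᵥ Pi.single i 1 = Pi.single i 1 - n i • n := by
    rw [tproj, ← hn, sub_mulVec, one_mulVec, vecMulVec_mulVec]
    simp
  have hx0 : φ x = 0 := by
    have := hx
    rw [h.frontier_eq] at this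
    exact this
  have hker : fderiv ℝ φ x (WithLp.toLp 2 (tproj U x *ᵥ Pi.single i 1)) = 0 := by
    have hgrad : grad φ x = ‖fderiv ℝ φ x‖ • n := by
      funext j
      rw [Pi.smul_apply, smul_eq_mul, hn, h.outerNormal_apply hx,
        mul_div_cancel₀ _ (norm_ne_zero_iff.2 (h.reg x hx0))]
      rfl
    rw [fderiv_toLp, hvec, hgrad, smul_dotProduct, dotProduct_sub, dotProduct_smul,
      h.outerNormal_dotProduct_self hx]
    simp
  have hmem := mem_tangentConeAt_levelSet h.contDiff_one hx0 (h.reg x hx0) hker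
  rw [← h.frontier_eq] at hmem
  have h1 := (hg.hasFDerivAt.hasFDerivWithinAt (s := frontier U)).differentiableWithinAt.hasFDerivWithinAt.unique_on
    (hg.hasFDerivAt.hasFDerivWithinAt (s := frontier U)) hmem
  rw [tpd, h1, fderiv_toLp, hvec, dotProduct_sub, dotProduct_smul, dotProduct_comm _ n]
  simp [grad]

end IsDefining

/-! ### Rules for partial derivatives -/

theorem pd_add {f g : E3 → ℝ} {x : E3} (hf : DifferentiableAt ℝ f x) (hg : DifferentiableAt ℝ g x)
    (i : Fin 3) : pd i (fun y => f y + g y) x = pd i f x + pd i g x := by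
  simp [pd, fderiv_fun_add hf hg]

theorem pd_sub {f g : E3 → ℝ} {x : E3} (hf : DifferentiableAt ℝ f x) (hg : DifferentiableAt ℝ g x)
    (i : Fin 3) : pd i (fun y => f y - g y) x = pd i f x - pd i g x := by
  simp [pd, fderiv_fun_sub hf hg]

theorem pd_mul {f g : E3 → ℝ} {x : E3} (hf : DifferentiableAt ℝ f x) (hg : DifferentiableAt ℝ g x)
    (i : Fin 3) : pd i (fun y => f y * g y) x = f x * pd i g x + pd i f x * g x := by
  simp [pd, fderiv_fun_mul hf hg, mul_comm]

theorem pd_sum {ι : Type*} {s : Finset ι} {f : ι → E3 → ℝ} {x : E3}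
    (hf : ∀ k ∈ s, DifferentiableAt ℝ (f k) x) (i : Fin 3) :
    pd i (fun y => ∑ k ∈ s, f k y) x = ∑ k ∈ s, pd i (f k) x := by
  simp [pd, fderiv_fun_sum hf]

theorem pd_const (c : ℝ) (x : E3) (i : Fin 3) : pd i (fun _ => c) x = 0 := by
  simp [pd]

theorem tpd_const {U : Set E3} (c : ℝ) {x : E3} (i : Fin 3) :
    tpd U i (fun _ => c) x = 0 := by
  simp [tpd]

theorem contDiff_pd {g : E3 → ℝ} (hg : ContDiff ℝ ∞ g) (i : Fin 3) : ContDiff ℝ ∞ (pd i g) :=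
  (hg.fderiv_right (by simp)).clm_apply contDiff_const

theorem pd_comm {g : E3 → ℝ} (hg : ContDiff ℝ ∞ g) (i j : Fin 3) (x : E3) :
    pd i (pd j g) x = pd j (pd i g) x := by
  have hd : DifferentiableAt ℝ (fderiv ℝ g) x :=
    (hg.fderiv_right (m := ∞) (by simp)).differentiable (by simp) x
  have key : ∀ i j : Fin 3, pd i (pd j g) x =
      fderiv ℝ (fderiv ℝ g) x (EuclideanSpace.single i 1) (EuclideanSpace.single j 1) := by
    intro i j
    unfold pd
    rw [fderiv_clm_apply hd (differentiableAt_const _)]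
    simp
  rw [key, key]
  exact (hg.contDiffAt.isSymmSndFDerivAt (by simpa using WithTop.coe_le_coe.2 (le_top : (2 : ℕ∞) ≤ ⊤))) _ _

/-- The curl of a vector field. -/
noncomputable def curl (G : E3 → Vec3) (x : E3) : Vec3 :=
  ![pd 1 (fun y => G y 2) x - pd 2 (fun y => G y 1) x,
    pd 2 (fun y => G y 0) x - pd 0 (fun y => G y 2) x,
    pd 0 (fun y => G y 1) x - pd 1 (fun y => G y 0) x]

theorem contDiff_curl {G : E3 → Vec3} (hG : ∀ i, ContDiff ℝ ∞ fun y => G y i) (i : Fin 3) :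
    ContDiff ℝ ∞ fun y => curl G y i := by
  have h := fun j k => contDiff_pd (hG k) j
  fin_cases i
  · exact (h 1 2).sub (h 2 1)
  · exact (h 2 0).sub (h 0 2)
  · exact (h 0 1).sub (h 1 0)

theorem div_curl {G : E3 → Vec3} (hG : ∀ i, ContDiff ℝ ∞ fun y => G y i) (x : E3) :
    div (curl G) x = 0 := by
  have hd := fun j k => (contDiff_pd (hG k) j).differentiable (by simp) x
  have h0 : pd 0 (fun y => curl G y 0) x = pd 0 (pd 1 fun y => G y 2) x - pd 0 (pd 2 fun y => G y 1) x :=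
    pd_sub (hd 1 2) (hd 2 1) 0
  have h1 : pd 1 (fun y => curl G y 1) x = pd 1 (pd 2 fun y => G y 0) x - pd 1 (pd 0 fun y => G y 2) x :=
    pd_sub (hd 2 0) (hd 0 2) 1
  have h2 : pd 2 (fun y => curl G y 2) x = pd 2 (pd 0 fun y => G y 1) x - pd 2 (pd 1 fun y => G y 0) x :=
    pd_sub (hd 0 1) (hd 1 0) 2
  rw [div, Fin.sum_univ_three, h0, h1, h2, pd_comm (hG 2) 1 0, pd_comm (hG 1) 2 0,
    pd_comm (hG 0) 2 1]
  ring

/-! ### Tangential calculus and the surface divergence theorem -/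

namespace IsDefining

variable {U : Set E3} {φ : E3 → ℝ} (h : IsDefining U φ)

include h

theorem contDiff_normalExt (i : Fin 3) : ContDiff ℝ ∞ fun x => normalExt φ x i := by
  have h1 : ContDiff ℝ ∞ fun x => grad φ x ⬝ᵥ grad φ x + φ x ^ 2 := by
    refine ContDiff.add ?_ (h.smooth.pow 2)
    unfold dotProduct
    exact ContDiff.sum fun i _ => (contDiff_pd h.smooth i).mul (contDiff_pd h.smooth i)
  exact ((h1.sqrt fun x => (h.radicand_pos x).ne').inv fun x =>
    (Real.sqrt_pos.2 (h.radicand_pos x)).ne').mul (contDiff_pd h.smooth i)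

theorem tpd_add {f g : E3 → ℝ} {x : E3} (hf : DifferentiableAt ℝ f x) (hg : DifferentiableAt ℝ g x)
    (hx : x ∈ frontier U) (i : Fin 3) :
    tpd U i (fun y => f y + g y) x = tpd U i f x + tpd U i g x := by
  rw [h.tpd_eq (hf.fun_add hg) hx, h.tpd_eq hf hx, h.tpd_eq hg hx]
  simp only [grad, dotProduct, pd_add hf hg, Fin.sum_univ_three]
  ring

theorem tpd_sub {f g : E3 → ℝ} {x : E3} (hf : DifferentiableAt ℝ f x) (hg : DifferentiableAt ℝ g x)
    (hx : x ∈ frontier U) (i : Fin 3) :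
    tpd U i (fun y => f y - g y) x = tpd U i f x - tpd U i g x := by
  rw [h.tpd_eq (hf.fun_sub hg) hx, h.tpd_eq hf hx, h.tpd_eq hg hx]
  simp only [grad, dotProduct, pd_sub hf hg, Fin.sum_univ_three]
  ring

theorem tpd_mul {f g : E3 → ℝ} {x : E3} (hf : DifferentiableAt ℝ f x) (hg : DifferentiableAt ℝ g x)
    (hx : x ∈ frontier U) (i : Fin 3) :
    tpd U i (fun y => f y * g y) x = f x * tpd U i g x + tpd U i f x * g x := by
  rw [h.tpd_eq (hf.fun_mul hg) hx, h.tpd_eq hf hx, h.tpd_eq hg hx]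
  simp only [grad, dotProduct, pd_mul hf hg, Fin.sum_univ_three]
  ring

theorem integral_curl {G : E3 → Vec3} (hG : ∀ i, ContDiff ℝ ∞ fun y => G y i) :
    ∫ x in frontier U, curl G x ⬝ᵥ outerNormal U x ∂μHE[2] = 0 := by
  rw [← h.setIntegral_div fun i => (contDiff_curl hG i).of_le (by simp)]
  simp [div_curl hG]

/-- **Surface divergence theorem**: the surface divergence of a tangential field on a closed
surface has integral zero. -/
theorem integral_tdiv {W : E3 → Vec3} (hW : ∀ i, ContDiff ℝ ∞ fun y => W y i)
    (htan : ∀ x ∈ frontier U, W x ⬝ᵥ outerNormal U x = 0) :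
    ∫ x in frontier U, tdiv U W x ∂μHE[2] = 0 := by
  set N := normalExt φ with hN
  have hNs : ∀ i, ContDiff ℝ ∞ fun y => N y i := h.contDiff_normalExt
  -- `G = N × W`. On the surface the normal component of `curl G` is `div_Γ W - (W · n) div N + n ·
  -- (W · ∇) N`; the middle term vanishes because `W` is tangential, the last because `|N| = 1`
  -- along the surface.
  set G : E3 → Vec3 := fun y => ![N y 1 * W y 2 - N y 2 * W y 1, N y 2 * W y 0 - N y 0 * W y 2,
    N y 0 * W y 1 - N y 1 * W y 0] with hGdef
  have hG : ∀ i, ContDiff ℝ ∞ fun y => G y i := by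
    intro i
    fin_cases i
    · exact ((hNs 1).mul (hW 2)).sub ((hNs 2).mul (hW 1))
    · exact ((hNs 2).mul (hW 0)).sub ((hNs 0).mul (hW 2))
    · exact ((hNs 0).mul (hW 1)).sub ((hNs 1).mul (hW 0))
  rw [← h.integral_curl hG]
  refine setIntegral_congr_fun isClosed_frontier.measurableSet fun x hx => ?_
  have hNd : ∀ i, DifferentiableAt ℝ (fun y => N y i) x := fun i =>
    (hNs i).differentiable (by simp) x
  have hWd : ∀ i, DifferentiableAt ℝ (fun y => W y i) x := fun i =>
    (hW i).differentiable (by simp) x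
  have hn : outerNormal U x = N x := h.outerNormal_eq hx
  have hpdG : ∀ k i j, pd k (fun y => N y i * W y j - N y j * W y i) x =
      (N x i * pd k (fun y => W y j) x + pd k (fun y => N y i) x * W x j) -
      (N x j * pd k (fun y => W y i) x + pd k (fun y => N y j) x * W x i) := fun k i j => by
    rw [pd_sub ((hNd i).fun_mul (hWd j)) ((hNd j).fun_mul (hWd i)), pd_mul (hNd i) (hWd j),
      pd_mul (hNd j) (hWd i)]
  have hG0 : ∀ k, pd k (fun y => G y 0) x = _ := fun k => hpdG k 1 2
  have hG1 : ∀ k, pd k (fun y => G y 1) x = _ := fun k => hpdG k 2 0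
  have hG2 : ∀ k, pd k (fun y => G y 2) x = _ := fun k => hpdG k 0 1
  have hnn := h.outerNormal_dotProduct_self hx
  have hnw := htan x hx
  -- The extension `N` has unit length only on the surface, so only the tangential derivatives of
  -- `|N|²` are known to vanish.
  have htang : ∀ k, tpd U k (fun y => (N y 0 * N y 0 + N y 1 * N y 1) + N y 2 * N y 2) x = 0 := by
    intro k
    rw [tpd_congr (g' := fun _ => 1) (fun y hy => ?_) hx, tpd_const]
    have := h.outerNormal_dotProduct_self hy
    rw [h.outerNormal_eq hy, dotProduct, Fin.sum_univ_three] at this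
    exact this
  have htk : ∀ k, 2 * (N x 0 * tpd U k (fun y => N y 0) x + N x 1 * tpd U k (fun y => N y 1) x +
      N x 2 * tpd U k (fun y => N y 2) x) = 0 := fun k => by
    have := htang k
    rw [h.tpd_add (((hNd 0).fun_mul (hNd 0)).fun_add ((hNd 1).fun_mul (hNd 1)))
      ((hNd 2).fun_mul (hNd 2)) hx, h.tpd_add ((hNd 0).fun_mul (hNd 0)) ((hNd 1).fun_mul (hNd 1)) hx,
      h.tpd_mul (hNd 0) (hNd 0) hx, h.tpd_mul (hNd 1) (hNd 1) hx, h.tpd_mul (hNd 2) (hNd 2) hx] at this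
    linarith
  have ht0 := htk 0
  have ht1 := htk 1
  have ht2 := htk 2
  rw [h.tpd_eq (hNd 0) hx, h.tpd_eq (hNd 1) hx, h.tpd_eq (hNd 2) hx] at ht0 ht1 ht2
  have hL : tdiv U W x = _ := Fin.sum_univ_three _
  rw [hL, h.tpd_eq (hWd 0) hx, h.tpd_eq (hWd 1) hx, h.tpd_eq (hWd 2) hx]
  simp only [curl, dotProduct, Fin.sum_univ_three, hG0, hG1, hG2, hn, grad, cons_val_zero,
    cons_val_one, cons_val] at hnn hnw ht0 ht1 ht2 ⊢
  set n0 := N x 0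
  set n1 := N x 1
  set n2 := N x 2
  set w0 := W x 0
  set w1 := W x 1
  set w2 := W x 2
  generalize pd 0 (fun y => N y 0) x = a00 at *
  generalize pd 1 (fun y => N y 0) x = a01 at *
  generalize pd 2 (fun y => N y 0) x = a02 at *
  generalize pd 0 (fun y => N y 1) x = a10 at *
  generalize pd 1 (fun y => N y 1) x = a11 at *
  generalize pd 2 (fun y => N y 1) x = a12 at *
  generalize pd 0 (fun y => N y 2) x = a20 at *
  generalize pd 1 (fun y => N y 2) x = a21 at *
  generalize pd 2 (fun y => N y 2) x = a22 at *
  generalize pd 0 (fun y => W y 0) x = b00 at *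
  generalize pd 1 (fun y => W y 0) x = b01 at *
  generalize pd 2 (fun y => W y 0) x = b02 at *
  generalize pd 0 (fun y => W y 1) x = b10 at *
  generalize pd 1 (fun y => W y 1) x = b11 at *
  generalize pd 2 (fun y => W y 1) x = b12 at *
  generalize pd 0 (fun y => W y 2) x = b20 at *
  generalize pd 1 (fun y => W y 2) x = b21 at *
  generalize pd 2 (fun y => W y 2) x = b22 at *
  clear_value n0 n1 n2 w0 w1 w2
  -- The last multiple of `hnw` removes the normal parts that the tangential derivatives in `ht0`,
  -- `ht1`, `ht2` bring in.
  linear_combination (-(b00 + b11 + b22)) * hnn + (a00 + a11 + a22) * hnw -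
    (w0 / 2) * ht0 - (w1 / 2) * ht1 - (w2 / 2) * ht2 -
    (n0 * (n0 * a00 + n1 * a01 + n2 * a02) + n1 * (n0 * a10 + n1 * a11 + n2 * a12) +
      n2 * (n0 * a20 + n1 * a21 + n2 * a22)) * hnw

end IsDefining

/-! ### Fields smooth in space and time -/

/-- `f` is smooth in space and time near every point whose time lies in `I`. -/
def SmoothOver (I : Set ℝ) (f : ℝ → E3 → ℝ) : Prop :=
  ∀ t ∈ I, ∀ x, ContDiffAt ℝ ∞ (fun p : ℝ × E3 => f p.1 p.2) (t, x)

namespace SmoothOver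

variable {I : Set ℝ} {f g : ℝ → E3 → ℝ}

theorem of_contDiff (h : ContDiff ℝ ∞ (fun p : ℝ × E3 => f p.1 p.2)) : SmoothOver I f :=
  fun _ _ _ => h.contDiffAt

theorem contDiff (h : SmoothOver univ f) : ContDiff ℝ ∞ (fun p : ℝ × E3 => f p.1 p.2) :=
  contDiff_iff_contDiffAt.2 fun p => h p.1 (mem_univ _) p.2

theorem mono {J : Set ℝ} (h : SmoothOver I f) (hJ : J ⊆ I) : SmoothOver J f :=
  fun t ht x => h t (hJ ht) x

theorem add (hf : SmoothOver I f) (hg : SmoothOver I g) :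
    SmoothOver I fun t x => f t x + g t x :=
  fun t ht x => (hf t ht x).add (hg t ht x)

theorem sub (hf : SmoothOver I f) (hg : SmoothOver I g) :
    SmoothOver I fun t x => f t x - g t x :=
  fun t ht x => (hf t ht x).sub (hg t ht x)

theorem mul (hf : SmoothOver I f) (hg : SmoothOver I g) :
    SmoothOver I fun t x => f t x * g t x :=
  fun t ht x => (hf t ht x).mul (hg t ht x)

theorem const (c : ℝ) : SmoothOver I fun _ _ => c := fun _ _ _ => contDiffAt_const

theorem sum {ι : Type*} {s : Finset ι} {f : ι → ℝ → E3 → ℝ} (h : ∀ i ∈ s, SmoothOver I (f i)) :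
    SmoothOver I fun t x => ∑ i ∈ s, f i t x :=
  fun t ht x => ContDiffAt.sum fun i hi => h i hi t ht x

theorem at_time (h : SmoothOver I f) {t : ℝ} (ht : t ∈ I) : ContDiff ℝ ∞ (f t) :=
  contDiff_iff_contDiffAt.2 fun x =>
    (h t ht x).comp x (contDiff_prodMk_right t).contDiffAt

theorem differentiableAt (h : SmoothOver I f) {t : ℝ} (ht : t ∈ I) (x : E3) :
    DifferentiableAt ℝ (f t) x := (h.at_time ht).differentiable (by simp) x

theorem differentiableAt_time (h : SmoothOver I f) {t : ℝ} (ht : t ∈ I) (x : E3) :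
    DifferentiableAt ℝ (fun s => f s x) t := by
  have h1 : ContDiffAt ℝ ∞ (fun s => f s x) t :=
    (h t ht x).comp t (contDiff_prodMk_left x).contDiffAt
  exact h1.differentiableAt (by simp)

/-- The spatial partial derivative is the joint derivative in the direction `(0, eᵢ)`, at all points
near `(t, x)`, where the field is still differentiable. -/
theorem pd (h : SmoothOver I f) (i : Fin 3) : SmoothOver I fun t x => pd i (f t) x := by
  intro t ht x
  have h1 : ContDiffAt ℝ ∞ (fun p : ℝ × E3 => fderiv ℝ (fun p : ℝ × E3 => f p.1 p.2) p
      ((0 : ℝ), (EuclideanSpace.single i (1 : ℝ) : E3))) (t, x) :=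
    ((h t ht x).fderiv_right (by simp)).clm_apply contDiffAt_const
  refine h1.congr_of_eventuallyEq ?_
  have h2 : ∀ᶠ p in 𝓝 (t, x), ContDiffAt ℝ 1 (fun p : ℝ × E3 => f p.1 p.2) p :=
    ((h t ht x).of_le (by simp)).eventually (by simp)
  filter_upwards [h2] with p hp
  have h3 : HasFDerivAt (fun y => f p.1 y) _ p.2 :=
    HasFDerivAt.comp (g := fun p : ℝ × E3 => f p.1 p.2) (f := fun y => (p.1, y)) p.2
      (hp.differentiableAt one_ne_zero).hasFDerivAt (hasFDerivAt_prodMk_right p.1 p.2)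
  rw [TwoPhaseSurfaceFlow.pd]
  have h4 : fderiv ℝ (f p.1) p.2 = _ := h3.fderiv
  rw [h4]
  simp

theorem continuousOn (h : SmoothOver I f) :
    ContinuousOn (fun p : ℝ × E3 => f p.1 p.2) (I ×ˢ univ) :=
  fun p hp => (h p.1 hp.1 p.2).continuousAt.continuousWithinAt

end SmoothOver

/-! ### Moving regions -/

/-- A smooth space-time level set description of the moving geometry. -/
structure IsMovingDefining (T : ℝ) (Ω : Set E3) (ΩA : ℝ → Set E3) (ψ : E3 → ℝ)
    (φ : ℝ → E3 → ℝ) : Prop where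
  outer : IsDefining Ω ψ
  smooth : SmoothOver (Ico 0 T) φ
  inner : ∀ t ∈ Ico 0 T, IsDefining (ΩA t) (φ t)
  closure_subset : ∀ t ∈ Ico 0 T, closure (ΩA t) ⊆ Ω

theorem IsMovingGeometry.exists_defining {T : ℝ} {Ω : Set E3} {ΩA : ℝ → Set E3}
    (h : IsMovingGeometry T Ω ΩA) : ∃ ψ φ, IsMovingDefining T Ω ΩA ψ φ := by
  obtain ⟨ψ, hψ, hΩ, hψr⟩ := h.outer.smooth
  obtain ⟨φ, hφ, hφA⟩ := h.smooth
  -- The defining function is given on the open set of all times below `T`, negative ones included,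
  -- so it is smooth in a full neighbourhood of the initial time.
  have hs : SmoothOver (Ico 0 T) φ := fun t ht x =>
    (hφ (t, x) ⟨ht.2, mem_univ _⟩).contDiffAt ((isOpen_Iio.prod isOpen_univ).mem_nhds
      ⟨ht.2, mem_univ _⟩)
  refine ⟨ψ, φ, ⟨hψ, hΩ, hψr, h.outer.bounded.isCompact_closure⟩, hs, fun t ht => ?_,
    h.closure_subset⟩
  exact ⟨hs.at_time ht, (hφA t ht).1, (hφA t ht).2,
    (h.outer.bounded.subset (subset_closure.trans (h.closure_subset t ht))).isCompact_closure⟩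

/-- Dominated convergence: a point off the boundary at time `t₀` stays inside, or stays outside, for
nearby times, and the boundary at time `t₀` is a null set. -/
theorem continuousOn_setIntegral_sublevel {T : ℝ} {U : ℝ → Set E3} {φ : ℝ → E3 → ℝ} {K : Set E3}
    (hφ : SmoothOver (Ico 0 T) φ) (hU : ∀ t ∈ Ico 0 T, IsDefining (U t) (φ t)) (hK : IsCompact K)
    (hsub : ∀ t ∈ Ico 0 T, U t ⊆ K) {G : ℝ → E3 → ℝ}
    (hG : ContinuousOn (fun p : ℝ × E3 => G p.1 p.2) (Ico 0 T ×ˢ univ)) :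
    ContinuousOn (fun t => ∫ x in U t, G t x) (Ico 0 T) := by
  have hGt : ∀ t ∈ Ico 0 T, Continuous (G t) := fun t ht =>
    continuousOn_univ.1 (hG.comp (by fun_prop : Continuous fun x : E3 => (t, x)).continuousOn
      fun x _ => ⟨ht, mem_univ _⟩)
  intro t₀ ht₀
  have hrw : ∀ t ∈ Ico 0 T, ∫ x in U t, G t x = ∫ x in K, (U t).indicator (G t) x := fun t ht => by
    rw [setIntegral_indicator (hU t ht).isOpen.measurableSet, inter_eq_right.2 (hsub t ht)]
  refine ContinuousWithinAt.congr ?_ (fun t ht => hrw t ht) (hrw t₀ ht₀)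
  -- Stopping at some `t₁ < T` makes the space-time slab compact, so one bound on `G` serves all
  -- times near `t₀`.
  obtain ⟨t₁, ht₁, ht₁T⟩ := exists_between ht₀.2
  have hKt : IsCompact (Icc 0 t₁ ×ˢ K) := isCompact_Icc.prod hK
  obtain ⟨C, hC⟩ := hKt.exists_bound_of_continuousOn (hG.mono
    (prod_mono (Icc_subset_Ico_right ht₁T) (subset_univ _)))
  have hnear : ∀ᶠ t in 𝓝[Ico 0 T] t₀, t ∈ Ico 0 T ∧ t ≤ t₁ :=
    (eventually_mem_nhdsWithin).and (mem_nhdsWithin_of_mem_nhds (Iic_mem_nhds ht₁))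
  refine continuousWithinAt_of_dominated (bound := fun _ => max C 0) ?_ ?_ ?_ ?_
  · filter_upwards [hnear] with t ht
    exact ((hGt t ht.1).aestronglyMeasurable.indicator (hU t ht.1).isOpen.measurableSet)
  · filter_upwards [hnear] with t ht
    refine (ae_restrict_iff' hK.measurableSet).2 (Eventually.of_forall fun x hx => ?_)
    by_cases hxA : x ∈ U t
    · rw [indicator_of_mem hxA]
      exact (hC (t, x) ⟨⟨ht.1.1, ht.2⟩, hx⟩).trans (le_max_left _ _)
    · rw [indicator_of_notMem hxA, norm_zero]
      exact le_max_right _ _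
  · refine integrableOn_const ?_
    exact hK.measure_lt_top.ne
  · have hnull := (hU t₀ ht₀).volume_frontier
    rw [(hU t₀ ht₀).frontier_eq] at hnull
    refine ae_restrict_of_ae ?_
    filter_upwards [measure_eq_zero_iff_ae_notMem.1 hnull] with x hx
    have hφc : ContinuousAt (fun t => φ t x) t₀ :=
      (hφ.differentiableAt_time ht₀ x).continuousAt
    have hGc : ContinuousWithinAt (fun t => G t x) (Ico 0 T) t₀ :=
      (hG (t₀, x) ⟨ht₀, mem_univ _⟩).comp (f := fun t => (t, x))
        (by fun_prop : Continuous fun t : ℝ => (t, x)).continuousWithinAt fun t ht => ⟨ht, mem_univ _⟩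
    rcases lt_or_gt_of_ne (show φ t₀ x ≠ 0 from hx) with hlt | hgt
    · have hev : ∀ᶠ t in 𝓝[Ico 0 T] t₀, (U t).indicator (G t) x = G t x := by
        filter_upwards [hnear, mem_nhdsWithin_of_mem_nhds (hφc.eventually (gt_mem_nhds hlt))]
          with t ht ht2
        rw [indicator_of_mem]
        rw [(hU t ht.1).eq]; exact ht2
      exact hGc.congr_of_eventuallyEq hev (hev.self_of_nhdsWithin ht₀)
    · have hev : ∀ᶠ t in 𝓝[Ico 0 T] t₀, (U t).indicator (G t) x = 0 := by
        filter_upwards [hnear, mem_nhdsWithin_of_mem_nhds (hφc.eventually (lt_mem_nhds hgt))]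
          with t ht ht2
        rw [indicator_of_notMem]
        rw [(hU t ht.1).eq]; exact not_lt.2 (le_of_lt ht2)
      exact continuousWithinAt_const.congr_of_eventuallyEq hev (hev.self_of_nhdsWithin ht₀)

namespace IsMovingDefining

variable {T : ℝ} {Ω : Set E3} {ΩA : ℝ → Set E3} {ψ : E3 → ℝ} {φ : ℝ → E3 → ℝ}
  (h : IsMovingDefining T Ω ΩA ψ φ)

include h

/-- Removing the closure of the inner region instead of the region itself changes nothing, since its
boundary has volume zero. -/
theorem integral_phaseB {t : ℝ} (ht : t ∈ Ico 0 T) {F : Type*} [NormedAddCommGroup F]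
    [NormedSpace ℝ F] {u : E3 → F} (hu : Continuous u) :
    ∫ x in phaseB Ω ΩA t, u x = (∫ x in Ω, u x) - ∫ x in ΩA t, u x := by
  have h1 := h.inner t ht
  rw [phaseB, setIntegral_sdiff isClosed_closure.measurableSet (h.outer.integrableOn_of_continuous hu)
    (h.closure_subset t ht)]
  congr 1
  exact setIntegral_congr_set (closure_ae_eq_of_null_frontier h1.volume_frontier)

/-- The minus sign reflects that `n` points out of the inner region, hence into the exterior phase.
-/
theorem integral_phaseB_div {t : ℝ} (ht : t ∈ Ico 0 T) {V : E3 → Vec3}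
    (hV : ∀ i, ContDiff ℝ 1 fun y => V y i) :
    ∫ x in phaseB Ω ΩA t, div V x = (∫ x in frontier Ω, V x ⬝ᵥ outerNormal Ω x ∂μHE[2]) -
      ∫ x in frontier (ΩA t), V x ⬝ᵥ outerNormal (ΩA t) x ∂μHE[2] := by
  rw [h.integral_phaseB ht (continuous_div hV), h.outer.setIntegral_div hV,
    (h.inner t ht).setIntegral_div hV]

theorem continuousOn_integral_inner {G : ℝ → E3 → ℝ}
    (hG : ContinuousOn (fun p : ℝ × E3 => G p.1 p.2) (Ico 0 T ×ˢ univ)) :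
    ContinuousOn (fun t => ∫ x in ΩA t, G t x) (Ico 0 T) :=
  continuousOn_setIntegral_sublevel h.smooth h.inner h.outer.compact
    (fun t ht => subset_closure.trans ((h.closure_subset t ht).trans subset_closure)) hG

theorem continuousOn_integral_phaseB {G : ℝ → E3 → ℝ}
    (hG : ContinuousOn (fun p : ℝ × E3 => G p.1 p.2) (Ico 0 T ×ˢ univ)) :
    ContinuousOn (fun t => ∫ x in phaseB Ω ΩA t, G t x) (Ico 0 T) := by
  have hGt : ∀ t ∈ Ico 0 T, Continuous (G t) := fun t ht =>
    continuousOn_univ.1 (hG.comp (by fun_prop : Continuous fun x : E3 => (t, x)).continuousOn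
      fun x _ => ⟨ht, mem_univ _⟩)
  have hΩ : ContinuousOn (fun t => ∫ x in Ω, G t x) (Ico 0 T) :=
    continuousOn_setIntegral_sublevel (φ := fun _ => ψ)
      (fun t _ x => (h.outer.smooth.comp contDiff_snd).contDiffAt) (fun _ _ => h.outer)
      h.outer.compact (fun _ _ => subset_closure) hG
  exact (hΩ.sub (h.continuousOn_integral_inner hG)).congr fun t ht => h.integral_phaseB ht (hGt t ht)

theorem smoothOver_normalExt (i : Fin 3) : SmoothOver (Ico 0 T) fun t x => normalExt (φ t) x i := by
  have h1 : SmoothOver (Ico 0 T) fun t x => grad (φ t) x ⬝ᵥ grad (φ t) x + φ t x ^ 2 := by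
    simp only [dotProduct, sq]
    exact (SmoothOver.sum fun i _ => (h.smooth.pd i).mul (h.smooth.pd i)).add
      (h.smooth.mul h.smooth)
  refine SmoothOver.mul (f := fun t x => (√(grad (φ t) x ⬝ᵥ grad (φ t) x + φ t x ^ 2))⁻¹) ?_
    (h.smooth.pd i)
  intro t ht x
  have hpos := (h.inner t ht).radicand_pos x
  exact ((h1 t ht x).sqrt hpos.ne').inv (Real.sqrt_pos.2 hpos).ne'

/-- With the extended unit normal `N`, the surface integral of `G` is the volume integral of `div (G
N)`, so continuity in time reduces to the case of moving regions. -/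
theorem continuousOn_integral_surface {G : ℝ → E3 → ℝ} (hG : SmoothOver (Ico 0 T) G) :
    ContinuousOn (fun t => ∫ x in frontier (ΩA t), G t x ∂μHE[2]) (Ico 0 T) := by
  set V : ℝ → E3 → Vec3 := fun t x i => G t x * normalExt (φ t) x i with hV
  have hVs : ∀ i, SmoothOver (Ico 0 T) fun t x => V t x i := fun i =>
    hG.mul (h.smoothOver_normalExt i)
  have hdiv : SmoothOver (Ico 0 T) fun t x => div (V t) x := SmoothOver.sum fun i _ => (hVs i).pd i
  refine (h.continuousOn_integral_inner (G := fun t x => div (V t) x) hdiv.continuousOn).congr fun t ht => ?_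
  beta_reduce
  rw [(h.inner t ht).setIntegral_div fun i => ((hVs i).at_time ht).of_le (by simp)]
  refine setIntegral_congr_fun isClosed_frontier.measurableSet fun x hx => ?_
  have h1 : V t x = G t x • normalExt (φ t) x := rfl
  rw [h1, smul_dotProduct, ← (h.inner t ht).outerNormal_eq hx,
    (h.inner t ht).outerNormal_dotProduct_self hx]
  simp

/-- **Transport balance.** Densities with bulk fluxes, a tangential surface flux, volume sources,
and interface fluxes that cancel: the total changes at the rate of the sources. -/
theorem hasDerivAt_total {vA vB vS : ℝ → E3 → Vec3} (hflow : IsFlowedBy T Ω ΩA vA vB vS)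
    {gA gB gS sA sB sS jump : ℝ → E3 → ℝ} {WA WB WS : ℝ → E3 → Vec3}
    (hgA : ContDiff ℝ ∞ (fun p : ℝ × E3 => gA p.1 p.2))
    (hgB : ContDiff ℝ ∞ (fun p : ℝ × E3 => gB p.1 p.2))
    (hgS : ContDiff ℝ ∞ (fun p : ℝ × E3 => gS p.1 p.2)) {t : ℝ} (ht : t ∈ Ioo 0 T)
    (hWA : ∀ i, ContDiff ℝ ∞ fun x => WA t x i) (hWB : ∀ i, ContDiff ℝ ∞ fun x => WB t x i)
    (hWS : ∀ i, ContDiff ℝ ∞ fun x => WS t x i)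
    (hsA : Continuous (sA t)) (hsB : Continuous (sB t))
    (hsS : ContinuousOn (sS t) (frontier (ΩA t)))
    (hA : ∀ x ∈ ΩA t, matD vA gA t x + div (vA t) x * gA t x = div (WA t) x + sA t x)
    (hB : ∀ x ∈ phaseB Ω ΩA t, matD vB gB t x + div (vB t) x * gB t x = div (WB t) x + sB t x)
    (hS : ∀ x ∈ frontier (ΩA t), matD vS gS t x + tdiv (ΩA t) (vS t) x * gS t x =
      tdiv (ΩA t) (WS t) x + jump t x + sS t x)
    (hjump : ∀ x ∈ frontier (ΩA t), jump t x =
      WB t x ⬝ᵥ outerNormal (ΩA t) x - WA t x ⬝ᵥ outerNormal (ΩA t) x)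
    (htan : ∀ x ∈ frontier (ΩA t), WS t x ⬝ᵥ outerNormal (ΩA t) x = 0)
    (hout : ∫ x in frontier Ω, WB t x ⬝ᵥ outerNormal Ω x ∂μHE[2] = 0) :
    HasDerivAt (fun s => (∫ x in ΩA s, gA s x) + (∫ x in phaseB Ω ΩA s, gB s x) +
        ∫ x in frontier (ΩA s), gS s x ∂μHE[2])
      ((∫ x in ΩA t, sA t x) + (∫ x in phaseB Ω ΩA t, sB t x) +
        ∫ x in frontier (ΩA t), sS t x ∂μHE[2]) t := by
  have htI : t ∈ Ico 0 T := ⟨ht.1.le, ht.2⟩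
  have hin := h.inner t htI
  have hm1 : ∀ {V : ℝ → E3 → Vec3}, (∀ i, ContDiff ℝ ∞ fun x => V t x i) →
      ∀ i, ContDiff ℝ 1 fun x => V t x i := fun hV i => (hV i).of_le (by simp)
  have hphm : MeasurableSet (phaseB Ω ΩA t) :=
    h.outer.isOpen.measurableSet.diff isClosed_closure.measurableSet
  have hphi : ∀ {u : E3 → ℝ}, Continuous u → IntegrableOn u (phaseB Ω ΩA t) := fun hu =>
    (h.outer.integrableOn_of_continuous hu).mono_set sdiff_subset
  have h1 := hflow.inA gA (hgA.of_le (by simp)) t ht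
  have h2 := hflow.inB gB (hgB.of_le (by simp)) t ht
  have h3 := hflow.onS gS (hgS.of_le (by simp)) t ht
  rw [setIntegral_congr_fun hin.isOpen.measurableSet fun x hx => hA x hx,
    integral_add (hin.integrableOn_of_continuous (continuous_div (hm1 hWA)))
      (hin.integrableOn_of_continuous hsA), hin.setIntegral_div (hm1 hWA)] at h1
  rw [setIntegral_congr_fun hphm fun x hx => hB x hx,
    integral_add (hphi (continuous_div (hm1 hWB))) (hphi hsB),
    h.integral_phaseB_div htI (hm1 hWB), hout] at h2
  have hfl : ∀ {V : ℝ → E3 → Vec3}, (∀ i, ContDiff ℝ ∞ fun x => V t x i) →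
      IntegrableOn (fun x => V t x ⬝ᵥ outerNormal (ΩA t) x) (frontier (ΩA t)) μHE[2] := by
    intro V hV
    refine hin.integrableOn_frontier ?_
    unfold dotProduct
    exact continuousOn_finsetSum _ fun i _ => (hV i).continuous.continuousOn.mul
      (continuousOn_pi.1 hin.continuousOn_outerNormal i)
  -- Continuity is not visible from the derivative within the surface; it comes from the formula in
  -- ordinary partial derivatives and the normal.
  have htd : ContinuousOn (tdiv (ΩA t) (WS t)) (frontier (ΩA t)) := by
    have hform : ∀ x ∈ frontier (ΩA t), tdiv (ΩA t) (WS t) x =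
        ∑ i, (pd i (fun y => WS t y i) x - outerNormal (ΩA t) x i *
          ∑ j, outerNormal (ΩA t) x j * pd j (fun y => WS t y i) x) := fun x hx =>
      Finset.sum_congr rfl fun i _ => hin.tpd_eq ((hWS i).differentiable (by simp) x) hx i
    refine ContinuousOn.congr ?_ hform
    have hn := continuousOn_pi.1 hin.continuousOn_outerNormal
    have hp : ∀ i j, ContinuousOn (pd j fun y => WS t y i) (frontier (ΩA t)) := fun i j =>
      (continuous_pd (hm1 hWS i) j).continuousOn
    exact continuousOn_finsetSum _ fun i _ => (hp i i).sub ((hn i).mul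
      (continuousOn_finsetSum _ fun j _ => (hn j).mul (hp i j)))
  have hS' : ∀ x ∈ frontier (ΩA t), matD vS gS t x + tdiv (ΩA t) (vS t) x * gS t x =
      ((tdiv (ΩA t) (WS t) x + WB t x ⬝ᵥ outerNormal (ΩA t) x) -
        WA t x ⬝ᵥ outerNormal (ΩA t) x) + sS t x := fun x hx => by
    rw [hS x hx, hjump x hx]; ring
  rw [setIntegral_congr_fun isClosed_frontier.measurableSet hS',
    integral_add (f := fun x => (tdiv (ΩA t) (WS t) x + WB t x ⬝ᵥ outerNormal (ΩA t) x) -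
        WA t x ⬝ᵥ outerNormal (ΩA t) x)
      (((hin.integrableOn_frontier htd).add (hfl hWB)).sub (hfl hWA))
      (hin.integrableOn_frontier hsS),
    integral_sub (f := fun x => tdiv (ΩA t) (WS t) x + WB t x ⬝ᵥ outerNormal (ΩA t) x)
      ((hin.integrableOn_frontier htd).add (hfl hWB)) (hfl hWA),
    integral_add (hin.integrableOn_frontier htd) (hfl hWB), hin.integral_tdiv hWS htan] at h3
  -- The flux of `WA` leaves the inner phase and that of `WB` enters the exterior one; the jump in
  -- the surface equation is their difference with the opposite sign.
  exact ((h1.add h2).add h3).congr_deriv (by ring)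

theorem continuousOn_total {gA gB gS : ℝ → E3 → ℝ}
    (hgA : ContinuousOn (fun p : ℝ × E3 => gA p.1 p.2) (Ico 0 T ×ˢ univ))
    (hgB : ContinuousOn (fun p : ℝ × E3 => gB p.1 p.2) (Ico 0 T ×ˢ univ))
    (hgS : SmoothOver (Ico 0 T) gS) :
    ContinuousOn (fun s => (∫ x in ΩA s, gA s x) + (∫ x in phaseB Ω ΩA s, gB s x) +
        ∫ x in frontier (ΩA s), gS s x ∂μHE[2]) (Ico 0 T) :=
  ((h.continuousOn_integral_inner hgA).add (h.continuousOn_integral_phaseB hgB)).add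
    (h.continuousOn_integral_surface hgS)

end IsMovingDefining

theorem intervalIntegrable_of_continuousOn_Ico {T t₁ t₂ : ℝ} {u : ℝ → ℝ} (hu : ContinuousOn u (Ico 0 T))
    (h1 : 0 ≤ t₁) (h12 : t₁ ≤ t₂) (h2 : t₂ < T) : IntervalIntegrable u volume t₁ t₂ := by
  refine ContinuousOn.intervalIntegrable (hu.mono ?_)
  rw [uIcc_of_le h12]
  exact fun t ht => ⟨h1.trans ht.1, ht.2.trans_lt h2⟩

/-- The flow identities hold only for positive times; continuity at the left end is what admits `t₁
= 0`. -/
theorem integral_eq_sub_of_continuousOn_Ico {T t₁ t₂ : ℝ} {u u' : ℝ → ℝ}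
    (hu : ContinuousOn u (Ico 0 T)) (hu' : ContinuousOn u' (Ico 0 T))
    (hd : ∀ t ∈ Ioo 0 T, HasDerivAt u (u' t) t)
    (h1 : 0 ≤ t₁) (h12 : t₁ ≤ t₂) (h2 : t₂ < T) : ∫ t in t₁..t₂, u' t = u t₂ - u t₁ :=
  intervalIntegral.integral_eq_sub_of_hasDerivAt_of_le h12
    (hu.mono fun _ ht => ⟨h1.trans ht.1, ht.2.trans_lt h2⟩)
    (fun t ht => hd t ⟨h1.trans_lt ht.1, ht.2.trans h2⟩)
    (intervalIntegrable_of_continuousOn_Ico hu' h1 h12 h2)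

/-! ### Product rules for divergences -/

theorem div_add {V W : E3 → Vec3} {x : E3} (hV : ∀ i, DifferentiableAt ℝ (fun y => V y i) x)
    (hW : ∀ i, DifferentiableAt ℝ (fun y => W y i) x) :
    div (fun y => V y + W y) x = div V x + div W x := by
  simp only [div, Pi.add_apply, pd_add (hV _) (hW _), Finset.sum_add_distrib]

theorem div_sub {V W : E3 → Vec3} {x : E3} (hV : ∀ i, DifferentiableAt ℝ (fun y => V y i) x)
    (hW : ∀ i, DifferentiableAt ℝ (fun y => W y i) x) :
    div (fun y => V y - W y) x = div V x - div W x := by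
  simp only [div, Pi.sub_apply, pd_sub (hV _) (hW _), Finset.sum_sub_distrib]

theorem div_smul {g : E3 → ℝ} {V : E3 → Vec3} {x : E3} (hg : DifferentiableAt ℝ g x)
    (hV : ∀ i, DifferentiableAt ℝ (fun y => V y i) x) :
    div (fun y => g y • V y) x = g x * div V x + V x ⬝ᵥ grad g x := by
  simp only [div, Pi.smul_apply, smul_eq_mul, pd_mul hg (hV _), Finset.sum_add_distrib,
    Finset.mul_sum, dotProduct, grad, mul_comm]

/-- The product rule produces the divergence of the columns of `M`; symmetry identifies it with the
row divergence `divMat`. -/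
theorem div_mulVec {M : E3 → Mat3} {V : E3 → Vec3} {x : E3} (hsymm : ∀ y, (M y).IsSymm)
    (hM : ∀ i j, DifferentiableAt ℝ (fun y => M y i j) x)
    (hV : ∀ i, DifferentiableAt ℝ (fun y => V y i) x) :
    div (fun y => M y *ᵥ V y) x = divMat M x ⬝ᵥ V x + frob (M x) (jac V x) := by
  have hs : ∀ y i j, M y i j = M y j i := fun y i j => (hsymm y).apply j i
  have h1 : ∀ i k, pd k (fun y => (M y *ᵥ V y) i) x =
      ∑ j, (M x i j * pd k (fun y => V y j) x + pd k (fun y => M y j i) x * V x j) := fun i k => by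
    have h2 : (fun y => (M y *ᵥ V y) i) = fun y => ∑ j, M y i j * V y j := rfl
    rw [h2, pd_sum fun j _ => (hM i j).fun_mul (hV j)]
    refine Finset.sum_congr rfl fun j _ => ?_
    rw [pd_mul (hM i j) (hV j)]
    simp only [hs _ i j]
  simp only [div, h1, divMat, dotProduct, frob, jac, of_apply, Finset.sum_add_distrib,
    Finset.sum_mul]
  rw [add_comm, Finset.sum_comm (f := fun i j => pd i (fun y => M y j i) x * V x j),
    Finset.sum_comm (f := fun i j => M x i j * pd i (fun y => V y j) x)]
  simp only [hs]

namespace IsDefining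

variable {U : Set E3} {φ : E3 → ℝ} (h : IsDefining U φ)

include h

theorem tdiv_add {V W : E3 → Vec3} {x : E3} (hV : ∀ i, DifferentiableAt ℝ (fun y => V y i) x)
    (hW : ∀ i, DifferentiableAt ℝ (fun y => W y i) x) (hx : x ∈ frontier U) :
    tdiv U (fun y => V y + W y) x = tdiv U V x + tdiv U W x := by
  simp only [tdiv, Pi.add_apply, h.tpd_add (hV _) (hW _) hx, Finset.sum_add_distrib]

theorem tdiv_sub {V W : E3 → Vec3} {x : E3} (hV : ∀ i, DifferentiableAt ℝ (fun y => V y i) x)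
    (hW : ∀ i, DifferentiableAt ℝ (fun y => W y i) x) (hx : x ∈ frontier U) :
    tdiv U (fun y => V y - W y) x = tdiv U V x - tdiv U W x := by
  simp only [tdiv, Pi.sub_apply, h.tpd_sub (hV _) (hW _) hx, Finset.sum_sub_distrib]

theorem tdiv_smul {g : E3 → ℝ} {V : E3 → Vec3} {x : E3} (hg : DifferentiableAt ℝ g x)
    (hV : ∀ i, DifferentiableAt ℝ (fun y => V y i) x) (hx : x ∈ frontier U) :
    tdiv U (fun y => g y • V y) x = g x * tdiv U V x + V x ⬝ᵥ tgrad U g x := by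
  simp only [tdiv, Pi.smul_apply, smul_eq_mul, h.tpd_mul hg (hV _) hx, Finset.sum_add_distrib,
    Finset.mul_sum, dotProduct, tgrad, mul_comm]

theorem tpd_sum {f : Fin 3 → E3 → ℝ} {x : E3} (hf : ∀ k, DifferentiableAt ℝ (f k) x)
    (hx : x ∈ frontier U) (i : Fin 3) :
    tpd U i (fun y => ∑ k, f k y) x = ∑ k, tpd U i (f k) x := by
  simp only [Fin.sum_univ_three]
  rw [h.tpd_add ((hf 0).fun_add (hf 1)) (hf 2) hx, h.tpd_add (hf 0) (hf 1) hx]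

theorem tdiv_mulVec {M : E3 → Mat3} {V : E3 → Vec3} {x : E3} (hsymm : ∀ y, (M y).IsSymm)
    (hM : ∀ i j, DifferentiableAt ℝ (fun y => M y i j) x)
    (hV : ∀ i, DifferentiableAt ℝ (fun y => V y i) x) (hx : x ∈ frontier U) :
    tdiv U (fun y => M y *ᵥ V y) x = tdivMat U M x ⬝ᵥ V x + frob (M x) (tjac U V x) := by
  have hs : ∀ y i j, M y i j = M y j i := fun y i j => (hsymm y).apply j i
  have h1 : ∀ i k, tpd U k (fun y => (M y *ᵥ V y) i) x =
      ∑ j, (M x i j * tpd U k (fun y => V y j) x + tpd U k (fun y => M y j i) x * V x j) :=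
    fun i k => by
      have h2 : (fun y => (M y *ᵥ V y) i) = fun y => ∑ j, M y i j * V y j := rfl
      rw [h2, h.tpd_sum (fun j => (hM i j).fun_mul (hV j)) hx]
      refine Finset.sum_congr rfl fun j _ => ?_
      rw [h.tpd_mul (hM i j) (hV j) hx]
      simp only [hs _ i j]
  simp only [tdiv, h1, tdivMat, dotProduct, frob, tjac, of_apply, Finset.sum_add_distrib,
    Finset.sum_mul]
  rw [add_comm, Finset.sum_comm (f := fun i j => tpd U i (fun y => M y j i) x * V x j),
    Finset.sum_comm (f := fun i j => M x i j * tpd U i (fun y => V y j) x)]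
  simp only [hs]

/-- The velocity splits into its normal and tangential parts. -/
theorem dotProduct_grad {g : E3 → ℝ} {x : E3} (hg : DifferentiableAt ℝ g x)
    (hx : x ∈ frontier U) (v : Vec3) :
    v ⬝ᵥ grad g x = (v ⬝ᵥ outerNormal U x) * (outerNormal U x ⬝ᵥ grad g x) +
      v ⬝ᵥ tgrad U g x := by
  have : tgrad U g x = grad g x - (outerNormal U x ⬝ᵥ grad g x) • outerNormal U x := by
    funext i
    rw [tgrad, h.tpd_eq hg hx, Pi.sub_apply, Pi.smul_apply, smul_eq_mul, mul_comm]
    rfl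
  rw [this, dotProduct_sub, dotProduct_smul, smul_eq_mul]
  ring

end IsDefining

/-- `outerNormal` is zero away from the surface, so fields built from it cannot be differentiated in
space. Tangential derivatives see only values on the surface, which permits replacing such fields by
smooth extensions. -/
theorem tdiv_congr {U : Set E3} {V W : E3 → Vec3} (hVW : EqOn V W (frontier U)) {x : E3}
    (hx : x ∈ frontier U) : tdiv U V x = tdiv U W x :=
  Finset.sum_congr rfl fun i _ => tpd_congr (fun _ hy => congrFun (hVW hy) i) hx i

theorem tdivMat_congr {U : Set E3} {M M' : E3 → Mat3} (hM : EqOn M M' (frontier U)) {x : E3}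
    (hx : x ∈ frontier U) : tdivMat U M x = tdivMat U M' x :=
  funext fun i => Finset.sum_congr rfl fun j _ =>
    tpd_congr (fun _ hy => congrFun (congrFun (hM hy) i) j) hx j

/-! ### Time derivatives -/

section Time

variable {I : Set ℝ} {v : ℝ → E3 → Vec3} {f g : ℝ → E3 → ℝ} {t : ℝ}

theorem matD_add (hf : SmoothOver I f) (hg : SmoothOver I g) (ht : t ∈ I) (x : E3) :
    matD v (fun s y => f s y + g s y) t x = matD v f t x + matD v g t x := by
  have h1 := hf.differentiableAt ht x
  have h2 := hg.differentiableAt ht x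
  simp only [matD, dt, dotProduct, grad, pd_add h1 h2,
    deriv_fun_add (hf.differentiableAt_time ht x) (hg.differentiableAt_time ht x), mul_add,
    Finset.sum_add_distrib]
  ring

theorem matD_mul (hf : SmoothOver I f) (hg : SmoothOver I g) (ht : t ∈ I) (x : E3) :
    matD v (fun s y => f s y * g s y) t x = f t x * matD v g t x + g t x * matD v f t x := by
  have h1 := hf.differentiableAt ht x
  have h2 := hg.differentiableAt ht x
  simp only [matD, dt, dotProduct, grad, pd_mul h1 h2,
    deriv_fun_mul (hf.differentiableAt_time ht x) (hg.differentiableAt_time ht x),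
    Fin.sum_univ_three]
  ring

/-- Reynolds transport in differential form for a density `ρ f`. -/
theorem matD_density (hf : SmoothOver I f) (hg : SmoothOver I g) (ht : t ∈ I) (x : E3) {D : ℝ}
    (hmass : matD v f t x + D * f t x = 0) :
    matD v (fun s y => f s y * g s y) t x + D * (f t x * g t x) = f t x * matD v g t x := by
  rw [matD_mul hf hg ht]
  linear_combination g t x * hmass

theorem matD_half_sq (hv : ∀ i, SmoothOver I fun s y => v s y i) (ht : t ∈ I) (x : E3) :
    matD v (fun s y => 1 / 2 * (v s y ⬝ᵥ v s y)) t x =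
      ∑ i, v t x i * matD v (fun s y => v s y i) t x := by
  simp only [dotProduct, Fin.sum_univ_three]
  rw [matD_mul (SmoothOver.const (1 / 2)) ((((hv 0).mul (hv 0)).add ((hv 1).mul (hv 1))).add
      ((hv 2).mul (hv 2))) ht,
    matD_add (((hv 0).mul (hv 0)).add ((hv 1).mul (hv 1))) ((hv 2).mul (hv 2)) ht,
    matD_add ((hv 0).mul (hv 0)) ((hv 1).mul (hv 1)) ht, matD_mul (hv 0) (hv 0) ht,
    matD_mul (hv 1) (hv 1) ht, matD_mul (hv 2) (hv 2) ht]
  have hc : matD v (fun _ _ => (1 / 2 : ℝ)) t x = 0 := by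
    simp [matD, dt, grad, pd, dotProduct]
  rw [hc]
  ring

theorem dt_add_div (hg : SmoothOver I g) (hv : ∀ i, SmoothOver I fun s y => v s y i) (ht : t ∈ I)
    (x : E3) : dt g t x + div (fun y => g t y • v t y) x =
      matD v g t x + div (v t) x * g t x := by
  rw [div_smul (hg.differentiableAt ht x) (fun i => (hv i).differentiableAt ht x), matD]
  ring

/-- `D_t^N` contains only the normal part of the convection; the product rule for `div_Γ (g v)`
supplies the tangential part. -/
theorem normD_add_tdiv {U : ℝ → Set E3} {φ : E3 → ℝ} (h : IsDefining (U t) φ)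
    (hg : SmoothOver I g) (hv : ∀ i, SmoothOver I fun s y => v s y i) (ht : t ∈ I)
    {x : E3} (hx : x ∈ frontier (U t)) :
    normD U v g t x + tdiv (U t) (fun y => g t y • v t y) x =
      matD v g t x + tdiv (U t) (v t) x * g t x := by
  rw [h.tdiv_smul (hg.differentiableAt ht x) (fun i => (hv i).differentiableAt ht x) hx, matD,
    normD, h.dotProduct_grad (hg.differentiableAt ht x) hx (v t x)]
  ring

end Time

/-! ### Tangential tensors -/

/-- The orthogonal projection along `n`. -/
def projAlong (n : Vec3) : Mat3 := 1 - vecMulVec n n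

/-- The symmetrized tangential part of `J`. -/
noncomputable def tangentialStrain (n : Vec3) (J : Mat3) : Mat3 :=
  (1 / 2 : ℝ) • (projAlong n * (J * projAlong n) + (projAlong n * (J * projAlong n))ᵀ)

theorem projAlong_isSymm (n : Vec3) : (projAlong n).IsSymm := by
  simp [projAlong, IsSymm, transpose_vecMulVec]

theorem tangentialStrain_isSymm (n : Vec3) (J : Mat3) : (tangentialStrain n J).IsSymm := by
  rw [IsSymm, tangentialStrain, transpose_smul, transpose_add, transpose_transpose, add_comm]

theorem projAlong_mulVec {n : Vec3} (hn : n ⬝ᵥ n = 1) : projAlong n *ᵥ n = 0 := by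
  rw [projAlong, sub_mulVec, one_mulVec, vecMulVec_mulVec, hn]
  simp

theorem projAlong_mul_self {n : Vec3} (hn : n ⬝ᵥ n = 1) :
    projAlong n * projAlong n = projAlong n := by
  have h : vecMulVec n n * vecMulVec n n = vecMulVec n n := by
    rw [vecMulVec_mul_vecMulVec, hn, one_smul]
  simp [projAlong, mul_sub, sub_mul, h]

theorem tangentialStrain_mulVec {n : Vec3} (hn : n ⬝ᵥ n = 1) (J : Mat3) :
    tangentialStrain n J *ᵥ n = 0 := by
  rw [tangentialStrain, transpose_mul, transpose_mul, (projAlong_isSymm n).eq, smul_mulVec,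
    add_mulVec]
  simp only [← mulVec_mulVec, projAlong_mulVec hn, mulVec_zero, add_zero, smul_zero]

theorem frob_eq_trace (M N : Mat3) : frob M N = (Mᵀ * N).trace := by
  simp only [frob, trace, diag_apply, mul_apply, transpose_apply]
  exact Finset.sum_comm

theorem frob_add_left (M M' N : Mat3) : frob (M + M') N = frob M N + frob M' N := by
  simp [frob_eq_trace, add_mul]

theorem frob_sub_left (M M' N : Mat3) : frob (M - M') N = frob M N - frob M' N := by
  simp [frob_eq_trace, sub_mul]

theorem frob_smul_left (c : ℝ) (M N : Mat3) : frob (c • M) N = c * frob M N := by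
  simp [frob_eq_trace]

theorem frob_symm_part {M : Mat3} (hM : M.IsSymm) (N : Mat3) :
    frob M ((1 / 2 : ℝ) • (N + Nᵀ)) = frob M N := by
  have h1 : (M * Nᵀ).trace = (M * N).trace := by
    rw [← trace_transpose, transpose_mul, transpose_transpose, hM.eq, trace_mul_comm]
  rw [frob_eq_trace, frob_eq_trace, hM.eq, Matrix.mul_smul, Matrix.mul_add, trace_smul, trace_add, h1,
    smul_eq_mul]
  ring

/-- The tensor `D = tangentialStrain n J` satisfies `D P = D`, so a factor `P` may be inserted in
front of `J`; a symmetric matrix then pairs with `P J P` as with its symmetric part, which is `D`.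
-/
theorem frob_tangentialStrain {n : Vec3} (hn : n ⬝ᵥ n = 1) (J : Mat3) :
    frob (tangentialStrain n J) (J * projAlong n) =
      frob (tangentialStrain n J) (tangentialStrain n J) := by
  have hD : tangentialStrain n J * projAlong n = tangentialStrain n J := by
    rw [tangentialStrain, transpose_mul, transpose_mul, (projAlong_isSymm n).eq]
    simp only [smul_mul, add_mul, Matrix.mul_assoc, projAlong_mul_self hn]
  have h1 := frob_symm_part (tangentialStrain_isSymm n J) (projAlong n * (J * projAlong n))
  rw [← tangentialStrain] at h1
  rw [h1, frob_eq_trace, frob_eq_trace, (tangentialStrain_isSymm n J).eq,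
    ← Matrix.mul_assoc (tangentialStrain n J) (projAlong n), hD]

theorem frob_projAlong {n : Vec3} (hn : n ⬝ᵥ n = 1) (J : Mat3) :
    frob (projAlong n) (J * projAlong n) = (J * projAlong n).trace := by
  rw [frob_eq_trace, (projAlong_isSymm n).eq, trace_mul_comm, Matrix.mul_assoc,
    projAlong_mul_self hn]

theorem frob_one (J : Mat3) : frob 1 J = J.trace := by
  simp [frob_eq_trace]

theorem tproj_eq (U : Set E3) (x : E3) : tproj U x = projAlong (outerNormal U x) := rfl

namespace IsDefining

variable {U : Set E3} {φ : E3 → ℝ} (h : IsDefining U φ) {V : E3 → Vec3} {x : E3}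

include h

theorem tgrad_eq {g : E3 → ℝ} (hg : DifferentiableAt ℝ g x) (hx : x ∈ frontier U) :
    tgrad U g x = projAlong (outerNormal U x) *ᵥ grad g x := by
  funext i
  rw [tgrad, h.tpd_eq hg hx, projAlong, sub_mulVec, one_mulVec, vecMulVec_mulVec]
  simp [grad, mul_comm]

theorem tjac_eq (hV : ∀ i, DifferentiableAt ℝ (fun y => V y i) x) (hx : x ∈ frontier U) :
    tjac U V x = jac V x * projAlong (outerNormal U x) := by
  ext i j
  rw [tjac, of_apply, h.tpd_eq (hV i) hx, projAlong, mul_sub, mul_one, mul_vecMulVec, Matrix.sub_apply,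
    vecMulVec_apply, mul_comm, dotProduct_comm]
  rfl

theorem tdiv_eq (hV : ∀ i, DifferentiableAt ℝ (fun y => V y i) x) (hx : x ∈ frontier U) :
    tdiv U V x = (jac V x * projAlong (outerNormal U x)).trace := by
  rw [← h.tjac_eq hV hx]
  rfl

theorem tstrain_eq (hV : ∀ i, DifferentiableAt ℝ (fun y => V y i) x) (hx : x ∈ frontier U) :
    tstrain U V x = tangentialStrain (outerNormal U x) (jac V x) := by
  rw [tstrain, h.tjac_eq hV hx, tproj_eq, tangentialStrain]

end IsDefining

/-! ### Smoothness of vector and matrix expressions -/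

namespace SmoothOver

variable {I : Set ℝ}

theorem dotProduct {V W : ℝ → E3 → Vec3} (hV : ∀ i, SmoothOver I fun t x => V t x i)
    (hW : ∀ i, SmoothOver I fun t x => W t x i) : SmoothOver I fun t x => V t x ⬝ᵥ W t x :=
  SmoothOver.sum fun i _ => (hV i).mul (hW i)

theorem mulVec {M : ℝ → E3 → Mat3} {V : ℝ → E3 → Vec3}
    (hM : ∀ i j, SmoothOver I fun t x => M t x i j) (hV : ∀ i, SmoothOver I fun t x => V t x i)
    (i : Fin 3) : SmoothOver I fun t x => (M t x *ᵥ V t x) i :=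
  SmoothOver.dotProduct (V := fun t x => M t x i) (hM i) hV

theorem matMul {M N : ℝ → E3 → Mat3} (hM : ∀ i j, SmoothOver I fun t x => M t x i j)
    (hN : ∀ i j, SmoothOver I fun t x => N t x i j) (i j : Fin 3) :
    SmoothOver I fun t x => (M t x * N t x) i j := by
  simp only [mul_apply]
  exact SmoothOver.sum fun k _ => (hM i k).mul (hN k j)

theorem frob {M N : ℝ → E3 → Mat3} (hM : ∀ i j, SmoothOver I fun t x => M t x i j)
    (hN : ∀ i j, SmoothOver I fun t x => N t x i j) :
    SmoothOver I fun t x => frob (M t x) (N t x) :=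
  SmoothOver.sum fun i _ => SmoothOver.sum fun j _ => (hM i j).mul (hN i j)

theorem projAlong {N : ℝ → E3 → Vec3} (hN : ∀ i, SmoothOver I fun t x => N t x i) (i j : Fin 3) :
    SmoothOver I fun t x => projAlong (N t x) i j :=
  (SmoothOver.const ((1 : Mat3) i j)).sub ((hN i).mul (hN j))

theorem tangentialStrain {N : ℝ → E3 → Vec3} {J : ℝ → E3 → Mat3}
    (hN : ∀ i, SmoothOver I fun t x => N t x i)
    (hJ : ∀ i j, SmoothOver I fun t x => J t x i j) (i j : Fin 3) :
    SmoothOver I fun t x => tangentialStrain (N t x) (J t x) i j := by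
  have h := SmoothOver.matMul (SmoothOver.projAlong hN)
    (SmoothOver.matMul hJ (SmoothOver.projAlong hN))
  exact (SmoothOver.const (1 / 2)).mul ((h i j).add (h j i))

theorem trace {M : ℝ → E3 → Mat3} (hM : ∀ i j, SmoothOver I fun t x => M t x i j) :
    SmoothOver I fun t x => (M t x).trace :=
  SmoothOver.sum fun i _ => hM i i

end SmoothOver

/-! ### Surface quantities with the normal as a free vector -/

namespace Fluid

variable (F : Fluid)

/-- The tangential divergence of the velocity, for a surface with normal `n` at `x`. -/
noncomputable def divAlong (n : Vec3) (t : ℝ) (x : E3) : ℝ :=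
  (jac (F.v t) x * projAlong n).trace

/-- The surface heat flux, for a surface with normal `n` at `x`. -/
noncomputable def heatAlong (n : Vec3) (t : ℝ) (x : E3) : Vec3 :=
  F.κ t x • (projAlong n *ᵥ grad (F.θ t) x)

/-- The surface stress, for a surface with normal `n` at `x`. -/
noncomputable def stressAlong (n : Vec3) (t : ℝ) (x : E3) : Mat3 :=
  F.μ t x • tangentialStrain n (jac (F.v t) x) +
    (F.lam t x * F.divAlong n t x) • projAlong n - F.π t x • projAlong n

/-- The surface dissipation, for a surface with normal `n` at `x`. -/
noncomputable def dissipAlong (n : Vec3) (t : ℝ) (x : E3) : ℝ :=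
  F.μ t x * Matrix.trace ((tangentialStrain n (jac (F.v t) x))ᵀ *
    tangentialStrain n (jac (F.v t) x)) + F.lam t x * F.divAlong n t x ^ 2

variable {F}

theorem strain_isSymm (t : ℝ) (x : E3) : (strain (F.v t) x).IsSymm := by
  rw [IsSymm, strain, transpose_smul, transpose_add, transpose_transpose, add_comm]

theorem stress_isSymm (t : ℝ) (x : E3) : (F.stress t x).IsSymm := by
  rw [IsSymm, stress, transpose_sub, transpose_add, transpose_smul, transpose_smul, transpose_smul,
    transpose_one, (F.strain_isSymm t x).eq]

theorem stressAlong_isSymm (n : Vec3) (t : ℝ) (x : E3) : (F.stressAlong n t x).IsSymm := by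
  rw [IsSymm, stressAlong, transpose_sub, transpose_add, transpose_smul, transpose_smul,
    transpose_smul, (projAlong_isSymm n).eq, (tangentialStrain_isSymm n _).eq]

theorem stressAlong_mulVec {n : Vec3} (hn : n ⬝ᵥ n = 1) (t : ℝ) (x : E3) :
    F.stressAlong n t x *ᵥ n = 0 := by
  rw [stressAlong, sub_mulVec, add_mulVec, smul_mulVec, smul_mulVec, smul_mulVec,
    projAlong_mulVec hn, tangentialStrain_mulVec hn]
  simp

theorem heatAlong_dotProduct {n : Vec3} (hn : n ⬝ᵥ n = 1) (t : ℝ) (x : E3) :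
    F.heatAlong n t x ⬝ᵥ n = 0 := by
  rw [heatAlong, smul_dotProduct, dotProduct_comm, dotProduct_mulVec, ← mulVec_transpose,
    (projAlong_isSymm n).eq, projAlong_mulVec hn, zero_dotProduct, smul_zero]

/-- The power of the bulk stress. -/
theorem frob_stress (t : ℝ) (x : E3) :
    frob (F.stress t x) (jac (F.v t) x) = F.dissip t x - div (F.v t) x * F.π t x := by
  have h1 : frob (strain (F.v t) x) (jac (F.v t) x) =
      frob (strain (F.v t) x) (strain (F.v t) x) :=
    (frob_symm_part (F.strain_isSymm t x) _).symm
  have h2 : (jac (F.v t) x).trace = div (F.v t) x := rfl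
  rw [stress, frob_sub_left, frob_add_left, frob_smul_left, frob_smul_left, frob_smul_left,
    frob_one, h1, h2, dissip]
  ring

/-- The power of the surface stress. -/
theorem frob_stressAlong {n : Vec3} (hn : n ⬝ᵥ n = 1) (t : ℝ) (x : E3) :
    frob (F.stressAlong n t x) (jac (F.v t) x * projAlong n) =
      F.dissipAlong n t x - F.divAlong n t x * F.π t x := by
  rw [stressAlong, frob_sub_left, frob_add_left, frob_smul_left, frob_smul_left, frob_smul_left,
    frob_projAlong hn, frob_tangentialStrain hn, dissipAlong, frob_eq_trace, divAlong]
  ring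

namespace Smooth

variable (hF : F.Smooth) (I : Set ℝ)

include hF

theorem smoothOver_v (i : Fin 3) : SmoothOver I fun t x => F.v t x i :=
  .of_contDiff (contDiff_pi.1 hF.v i)

theorem smoothOver_jac (i j : Fin 3) : SmoothOver I fun t x => jac (F.v t) x i j :=
  (hF.smoothOver_v I i).pd j

theorem smoothOver_div : SmoothOver I fun t x => div (F.v t) x :=
  SmoothOver.sum fun i _ => (hF.smoothOver_v I i).pd i

theorem smoothOver_strain (i j : Fin 3) : SmoothOver I fun t x => strain (F.v t) x i j :=
  (SmoothOver.const (1 / 2)).mul ((hF.smoothOver_jac I i j).add (hF.smoothOver_jac I j i))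

theorem smoothOver_stress (i j : Fin 3) : SmoothOver I fun t x => F.stress t x i j :=
  (((SmoothOver.of_contDiff hF.μ).mul (hF.smoothOver_strain I i j)).add
    (((SmoothOver.of_contDiff hF.lam).mul (hF.smoothOver_div I)).mul
      (SmoothOver.const ((1 : Mat3) i j)))).sub
    ((SmoothOver.of_contDiff hF.π).mul (SmoothOver.const ((1 : Mat3) i j)))

theorem smoothOver_stress_mulVec (i : Fin 3) :
    SmoothOver I fun t x => (F.stress t x *ᵥ F.v t x) i :=
  SmoothOver.mulVec (hF.smoothOver_stress I) (hF.smoothOver_v I) i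

theorem smoothOver_heat (i : Fin 3) : SmoothOver I fun t x => F.heat t x i :=
  (SmoothOver.of_contDiff hF.κ).mul ((SmoothOver.of_contDiff hF.θ).pd i)

theorem smoothOver_dissip : SmoothOver I F.dissip := by
  unfold dissip
  simp only [sq]
  exact ((SmoothOver.of_contDiff hF.μ).mul
    (SmoothOver.frob (hF.smoothOver_strain I) (hF.smoothOver_strain I))).add
    ((SmoothOver.of_contDiff hF.lam).mul ((hF.smoothOver_div I).mul (hF.smoothOver_div I)))

theorem smoothOver_kinetic : SmoothOver I F.kinetic := by
  unfold kinetic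
  simp only [div_eq_mul_inv]
  exact ((SmoothOver.of_contDiff hF.ρ).mul
    (SmoothOver.dotProduct (hF.smoothOver_v I) (hF.smoothOver_v I))).mul (SmoothOver.const _)

theorem smoothOver_energy : SmoothOver I F.energy :=
  (hF.smoothOver_kinetic I).add ((SmoothOver.of_contDiff hF.ρ).mul (SmoothOver.of_contDiff hF.e))

theorem smoothOver_momentum (i : Fin 3) : SmoothOver I fun t x => F.momentum t x i :=
  (SmoothOver.of_contDiff hF.ρ).mul (hF.smoothOver_v I i)

variable {I} {N : ℝ → E3 → Vec3} (hN : ∀ i, SmoothOver I fun t x => N t x i)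

include hN

theorem smoothOver_divAlong : SmoothOver I fun t x => F.divAlong (N t x) t x :=
  SmoothOver.trace (SmoothOver.matMul (hF.smoothOver_jac I) (SmoothOver.projAlong hN))

theorem smoothOver_stressAlong (i j : Fin 3) :
    SmoothOver I fun t x => F.stressAlong (N t x) t x i j :=
  (((SmoothOver.of_contDiff hF.μ).mul
    (SmoothOver.tangentialStrain hN (hF.smoothOver_jac I) i j)).add
    (((SmoothOver.of_contDiff hF.lam).mul (hF.smoothOver_divAlong hN)).mul
      (SmoothOver.projAlong hN i j))).sub
    ((SmoothOver.of_contDiff hF.π).mul (SmoothOver.projAlong hN i j))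

theorem smoothOver_stressAlong_mulVec (i : Fin 3) :
    SmoothOver I fun t x => (F.stressAlong (N t x) t x *ᵥ F.v t x) i :=
  SmoothOver.mulVec (hF.smoothOver_stressAlong hN) (hF.smoothOver_v I) i

theorem smoothOver_heatAlong (i : Fin 3) : SmoothOver I fun t x => F.heatAlong (N t x) t x i :=
  (SmoothOver.of_contDiff hF.κ).mul (SmoothOver.mulVec (V := fun t x => grad (F.θ t) x)
    (SmoothOver.projAlong hN) (fun j => (SmoothOver.of_contDiff hF.θ).pd j) i)

theorem smoothOver_dissipAlong : SmoothOver I fun t x => F.dissipAlong (N t x) t x := by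
  have hD := SmoothOver.tangentialStrain hN (hF.smoothOver_jac I)
  unfold dissipAlong
  simp only [sq]
  exact ((SmoothOver.of_contDiff hF.μ).mul
    (SmoothOver.trace (SmoothOver.matMul (fun i j => hD j i) hD))).add
    ((SmoothOver.of_contDiff hF.lam).mul
      ((hF.smoothOver_divAlong hN).mul (hF.smoothOver_divAlong hN)))

end Smooth

/-! ### Balance of mechanical and total energy -/

section Balance

variable (hF : F.Smooth) {t : ℝ} {x : E3} {D : ℝ} {b : Vec3}
  (hmass : matD F.v F.ρ t x + D * F.ρ t x = 0)
  (hmom : ∀ i, F.ρ t x * matD F.v (fun s y => F.v s y i) t x = b i)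

include hF hmass

/-- The scalar `D` is `div v` in the bulk and `div_Γ v` on the surface; leaving it free lets one
computation serve both, here and in the energy balances. -/
theorem matD_momentum {i : Fin 3} {c : ℝ}
    (hmom : F.ρ t x * matD F.v (fun s y => F.v s y i) t x = c) :
    matD F.v (fun s y => F.momentum s y i) t x + D * F.momentum t x i = c := by
  rw [← hmom]
  exact matD_density (SmoothOver.of_contDiff hF.ρ) (hF.smoothOver_v univ i) (mem_univ t) x hmass

include hmom

theorem matD_kinetic : matD F.v F.kinetic t x + D * F.kinetic t x = b ⬝ᵥ F.v t x := by
  have hk : F.kinetic = fun s y => F.ρ s y * (1 / 2 * (F.v s y ⬝ᵥ F.v s y)) := by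
    funext s y
    rw [kinetic]
    ring
  rw [hk, matD_density (I := univ) (SmoothOver.of_contDiff hF.ρ) ((SmoothOver.const _).mul
    (SmoothOver.dotProduct (hF.smoothOver_v univ) (hF.smoothOver_v univ))) (mem_univ t) x hmass,
    matD_half_sq (hF.smoothOver_v univ) (mem_univ t), Finset.mul_sum, dotProduct]
  refine Finset.sum_congr rfl fun i _ => ?_
  rw [← hmom i]
  ring

/-- Kinetic and internal energy are both of the form density times a field, so their balances simply
add. -/
theorem matD_energy {c : ℝ} (he : F.ρ t x * matD F.v F.e t x = c) :
    matD F.v F.energy t x + D * F.energy t x = b ⬝ᵥ F.v t x + c := by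
  have h1 := matD_add (v := F.v) (hF.smoothOver_kinetic univ)
    ((SmoothOver.of_contDiff hF.ρ).mul (SmoothOver.of_contDiff hF.e)) (mem_univ t) x
  have h2 := matD_density (SmoothOver.of_contDiff hF.ρ) (SmoothOver.of_contDiff hF.e)
    (mem_univ t) x hmass
  have h3 := matD_kinetic hF hmass hmom
  have h4 : F.energy = fun s y => F.kinetic s y + F.ρ s y * F.e s y := rfl
  rw [h4, h1]
  beta_reduce
  linear_combination h2 + h3 + he

end Balance

/-! ### Surface fields as restrictions of smooth fields -/

section Surface

variable (hF : F.Smooth) {U : ℝ → Set E3} {φ : E3 → ℝ} {t : ℝ} (h : IsDefining (U t) φ)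
  {x : E3}

include hF h

theorem tdiv_v_eq (hx : x ∈ frontier (U t)) : tdiv (U t) (F.v t) x = F.divAlong (normalExt φ x) t x := by
  rw [h.tdiv_eq (fun i => (hF.smoothOver_v univ i).differentiableAt (mem_univ t) x) hx,
    h.outerNormal_eq hx, divAlong]

theorem surfHeat_eq (hx : x ∈ frontier (U t)) : F.surfHeat U t x = F.heatAlong (normalExt φ x) t x := by
  rw [surfHeat, h.tgrad_eq ((SmoothOver.of_contDiff hF.θ).differentiableAt (mem_univ t) x) hx,
    h.outerNormal_eq hx, heatAlong]

theorem surfStress_eq (hx : x ∈ frontier (U t)) : F.surfStress U t x = F.stressAlong (normalExt φ x) t x := by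
  rw [surfStress, tdiv_v_eq hF h hx,
    h.tstrain_eq (fun i => (hF.smoothOver_v univ i).differentiableAt (mem_univ t) x) hx, tproj_eq,
    h.outerNormal_eq hx, stressAlong]

theorem surfDissip_eq (hx : x ∈ frontier (U t)) : F.surfDissip U t x = F.dissipAlong (normalExt φ x) t x := by
  rw [surfDissip, tdiv_v_eq hF h hx,
    h.tstrain_eq (fun i => (hF.smoothOver_v univ i).differentiableAt (mem_univ t) x) hx,
    h.outerNormal_eq hx, dissipAlong, frob_eq_trace]

/-- The power of the surface stress splits into force times velocity and the term `𝒯_S : ∇_Γ v`, the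
latter being dissipation minus pressure work. -/
theorem tdiv_surfStress_mulVec (hx : x ∈ frontier (U t)) :
    tdiv (U t) (fun y => F.surfStress U t y *ᵥ F.v t y) x =
      tdivMat (U t) (F.surfStress U t) x ⬝ᵥ F.v t x +
        (F.surfDissip U t x - tdiv (U t) (F.v t) x * F.π t x) := by
  -- Only one time is involved, so the extended normal may be regarded as constant in time.
  have hN : ∀ i, SmoothOver univ fun (_ : ℝ) y => normalExt φ y i := fun i =>
    .of_contDiff ((h.contDiff_normalExt i).comp contDiff_snd)
  have hn : normalExt φ x ⬝ᵥ normalExt φ x = 1 := by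
    rw [← h.outerNormal_eq hx, h.outerNormal_dotProduct_self hx]
  have hv := fun i => (hF.smoothOver_v univ i).differentiableAt (mem_univ t) x
  rw [tdiv_congr (W := fun y => F.stressAlong (normalExt φ y) t y *ᵥ F.v t y)
      (fun y hy => by simp only [surfStress_eq hF h hy]) hx,
    tdivMat_congr (M' := fun y => F.stressAlong (normalExt φ y) t y)
      (fun y hy => surfStress_eq hF h hy) hx,
    h.tdiv_mulVec (fun y => stressAlong_isSymm _ t y)
      (fun i j => (hF.smoothOver_stressAlong hN i j).differentiableAt (mem_univ t) x) hv hx,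
    h.tjac_eq hv hx, h.outerNormal_eq hx, frob_stressAlong hn, surfDissip_eq hF h hx,
    tdiv_v_eq hF h hx]

end Surface

end Fluid

open Fluid

/-! ### Bulk balances -/

namespace SolvesBulk

variable {T : ℝ} {U : ℝ → Set E3} {F : Fluid} (h : SolvesBulk T U F) (hF : F.Smooth) {t : ℝ}
  (ht : t ∈ Ioo 0 T) {x : E3} (hx : x ∈ U t)

include h hF ht hx

theorem momentum_balance (i : Fin 3) :
    matD F.v (fun s y => F.momentum s y i) t x + div (F.v t) x * F.momentum t x i =
      div (fun y => F.stress t y i) x :=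
  matD_momentum hF (h.mass t ht x hx) (h.momentum t ht x hx i)

theorem kinetic_balance :
    matD F.v F.kinetic t x + div (F.v t) x * F.kinetic t x =
      div (fun y => F.stress t y *ᵥ F.v t y) x + (div (F.v t) x * F.π t x - F.dissip t x) := by
  rw [matD_kinetic hF (h.mass t ht x hx) (h.momentum t ht x hx),
    div_mulVec (F.stress_isSymm t)
      (fun i j => (hF.smoothOver_stress univ i j).differentiableAt (mem_univ t) x)
      (fun i => (hF.smoothOver_v univ i).differentiableAt (mem_univ t) x), frob_stress]
  ring

/-- Dissipation and pressure work pass from kinetic to internal energy and cancel in the sum,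
leaving only a divergence. -/
theorem energy_balance :
    matD F.v F.energy t x + div (F.v t) x * F.energy t x =
      div (fun y => F.heat t y + F.stress t y *ᵥ F.v t y) x := by
  have h1 := matD_energy hF (h.mass t ht x hx) (h.momentum t ht x hx)
    (eq_sub_of_add_eq (h.energy t ht x hx))
  rw [div_add (fun i => (hF.smoothOver_heat univ i).differentiableAt (mem_univ t) x)
      fun i => (hF.smoothOver_stress_mulVec univ i).differentiableAt (mem_univ t) x, h1,
    div_mulVec (F.stress_isSymm t)
      (fun i j => (hF.smoothOver_stress univ i j).differentiableAt (mem_univ t) x)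
      (fun i => (hF.smoothOver_v univ i).differentiableAt (mem_univ t) x), frob_stress]
  ring

end SolvesBulk

theorem SolvesBulk.conservative {T : ℝ} {U : ℝ → Set E3} {F : Fluid} (h : SolvesBulk T U F)
    (hF : F.Smooth) : ConservativeBulk T U F where
  mass t ht x hx := by
    rw [← h.mass t ht x hx]
    exact dt_add_div (SmoothOver.of_contDiff hF.ρ) (hF.smoothOver_v univ) (mem_univ t) x
  energy t ht x hx := by
    have hE := (hF.smoothOver_energy univ).differentiableAt (mem_univ t) x
    have hv := fun i => (hF.smoothOver_v univ i).differentiableAt (mem_univ t) x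
    have hq := fun i => (hF.smoothOver_heat univ i).differentiableAt (mem_univ t) x
    have hTv := fun i => (hF.smoothOver_stress_mulVec univ i).differentiableAt (mem_univ t) x
    have h1 := dt_add_div (hF.smoothOver_energy univ) (hF.smoothOver_v univ) (mem_univ t) x
    have h2 := h.energy_balance hF ht hx
    rw [div_add hq hTv] at h2
    rw [div_sub (V := fun y => F.energy t y • F.v t y - F.heat t y)
        (fun i => (hE.fun_mul (hv i)).fun_sub (hq i)) hTv,
      div_sub (V := fun y => F.energy t y • F.v t y) (fun i => hE.fun_mul (hv i)) hq]
    linear_combination h1 + h2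
  momentum t ht x hx i := by
    have hm := (hF.smoothOver_momentum univ i).differentiableAt (mem_univ t) x
    have hv := fun i => (hF.smoothOver_v univ i).differentiableAt (mem_univ t) x
    have hs := fun j => (hF.smoothOver_stress univ i j).differentiableAt (mem_univ t) x
    have h1 := dt_add_div (hF.smoothOver_momentum univ i) (hF.smoothOver_v univ) (mem_univ t) x
    have h2 := h.momentum_balance hF ht hx i
    -- Row `i` of `ρ v ⊗ v` is the transport flux `(ρ vᵢ) v` of the density `ρ vᵢ`, which reduces
    -- the vector law to scalar ones.
    have h3 : divMat (fun y => F.momentumFlux t y - F.stress t y) x i =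
        div (fun y => F.momentum t y i • F.v t y - F.stress t y i) x := by
      refine Finset.sum_congr rfl fun j _ => congrArg (fun g => pd j g x) (funext fun y => ?_)
      simp only [momentumFlux, Fluid.momentum, Matrix.sub_apply, Matrix.smul_apply, Pi.sub_apply,
        Pi.smul_apply, vecMulVec_apply, smul_eq_mul]
      ring
    rw [h3, div_sub (V := fun y => F.momentum t y i • F.v t y) (fun j => hm.fun_mul (hv j)) hs]
    linear_combination h1 + h2

/-! ### Surface balances -/

namespace SolvesSurface

variable {T : ℝ} {r : ℕ} {ΩA : ℝ → Set E3} {A B S : Fluid} (h : SolvesSurface T r ΩA A B S)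
  (hS : S.Smooth) {t : ℝ} (ht : t ∈ Ioo 0 T) {φ : E3 → ℝ} (hφ : IsDefining (ΩA t) φ) {x : E3}
  (hx : x ∈ frontier (ΩA t))

include h hS ht hx

theorem momentum_balance (i : Fin 3) :
    matD S.v (fun s y => S.momentum s y i) t x + tdiv (ΩA t) (S.v t) x * S.momentum t x i =
      tdiv (ΩA t) (fun y => S.surfStress ΩA t y i) x + tractionJump r ΩA A B t x i :=
  matD_momentum hS (h.mass t ht x hx) (h.momentum t ht x hx i)

include hφ

theorem kinetic_balance :
    matD S.v S.kinetic t x + tdiv (ΩA t) (S.v t) x * S.kinetic t x =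
      tdiv (ΩA t) (fun y => S.surfStress ΩA t y *ᵥ S.v t y) x +
        tractionJump r ΩA A B t x ⬝ᵥ S.v t x +
        (tdiv (ΩA t) (S.v t) x * S.π t x - S.surfDissip ΩA t x) := by
  rw [matD_kinetic (b := tdivMat (ΩA t) (S.surfStress ΩA t) x + tractionJump r ΩA A B t x) hS
      (h.mass t ht x hx) (h.momentum t ht x hx), tdiv_surfStress_mulVec hS hφ hx, add_dotProduct]
  ring

theorem energy_balance :
    matD S.v S.energy t x + tdiv (ΩA t) (S.v t) x * S.energy t x =
      tdiv (ΩA t) (S.surfHeat ΩA t) x + tdiv (ΩA t) (fun y => S.surfStress ΩA t y *ᵥ S.v t y) x +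
        (tractionJump r ΩA A B t x ⬝ᵥ S.v t x + heatJump ΩA A B t x) := by
  rw [matD_energy (b := tdivMat (ΩA t) (S.surfStress ΩA t) x + tractionJump r ΩA A B t x) hS
      (h.mass t ht x hx) (h.momentum t ht x hx) (eq_sub_of_add_eq (h.energy t ht x hx)),
    tdiv_surfStress_mulVec hS hφ hx, add_dotProduct]
  ring

end SolvesSurface

theorem SolvesSurface.conservative {T : ℝ} {r : ℕ} {Ω : Set E3} {ΩA : ℝ → Set E3} {A B S : Fluid}
    {ψ : E3 → ℝ} {φ : ℝ → E3 → ℝ} (h : SolvesSurface T r ΩA A B S)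
    (hφ : IsMovingDefining T Ω ΩA ψ φ) (hS : S.Smooth) : ConservativeSurface T r ΩA A B S where
  mass t ht x hx := by
    rw [← h.mass t ht x hx]
    exact normD_add_tdiv (hφ.inner t ⟨ht.1.le, ht.2⟩) (SmoothOver.of_contDiff hS.ρ)
      (hS.smoothOver_v univ) (mem_univ t) hx
  energy t ht x hx := by
    have htI : t ∈ Ico 0 T := ⟨ht.1.le, ht.2⟩
    have hd := hφ.inner t htI
    have hN := hφ.smoothOver_normalExt
    have hE := (hS.smoothOver_energy univ).differentiableAt (mem_univ t) x
    have hv := fun i => (hS.smoothOver_v univ i).differentiableAt (mem_univ t) x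
    have hq := fun i => (hS.smoothOver_heatAlong hN i).differentiableAt htI x
    have hTv := fun i => (hS.smoothOver_stressAlong_mulVec hN i).differentiableAt htI x
    have h1 := normD_add_tdiv hd (hS.smoothOver_energy univ) (hS.smoothOver_v univ) (mem_univ t) hx
    have h2 := h.energy_balance hS ht hd hx
    -- The tangential divergence of a difference can be split only for differentiable fields, so the
    -- surface fluxes are first replaced by their smooth extensions.
    have e1 : EqOn (S.surfHeat ΩA t) (fun y => S.heatAlong (normalExt (φ t) y) t y)
        (frontier (ΩA t)) := fun y hy => surfHeat_eq hS hd hy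
    have e2 : EqOn (fun y => S.surfStress ΩA t y *ᵥ S.v t y)
        (fun y => S.stressAlong (normalExt (φ t) y) t y *ᵥ S.v t y) (frontier (ΩA t)) :=
      fun y hy => by simp only [surfStress_eq hS hd hy]
    rw [tdiv_congr e1 hx, tdiv_congr e2 hx] at h2
    rw [tdiv_congr (W := fun y => S.energy t y • S.v t y - S.heatAlong (normalExt (φ t) y) t y -
        S.stressAlong (normalExt (φ t) y) t y *ᵥ S.v t y)
        (fun y hy => by simp only [surfHeat_eq hS hd hy, surfStress_eq hS hd hy]) hx,
      hd.tdiv_sub (V := fun y => S.energy t y • S.v t y - S.heatAlong (normalExt (φ t) y) t y)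
        (fun i => (hE.fun_mul (hv i)).fun_sub (hq i)) hTv hx,
      hd.tdiv_sub (V := fun y => S.energy t y • S.v t y) (fun i => hE.fun_mul (hv i)) hq hx]
    linear_combination h1 + h2
  momentum t ht x hx i := by
    have htI : t ∈ Ico 0 T := ⟨ht.1.le, ht.2⟩
    have hd := hφ.inner t htI
    have hm := (hS.smoothOver_momentum univ i).differentiableAt (mem_univ t) x
    have hv := fun i => (hS.smoothOver_v univ i).differentiableAt (mem_univ t) x
    have hs := fun j =>
      (hS.smoothOver_stressAlong hφ.smoothOver_normalExt i j).differentiableAt htI x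
    have h1 := normD_add_tdiv hd (hS.smoothOver_momentum univ i) (hS.smoothOver_v univ)
      (mem_univ t) hx
    have h2 := h.momentum_balance hS ht hx i
    rw [tdiv_congr (V := fun y => S.surfStress ΩA t y i)
      (W := fun y => S.stressAlong (normalExt (φ t) y) t y i)
      (fun y hy => by simp only [surfStress_eq hS hd hy]) hx] at h2
    have h3 : tdivMat (ΩA t) (fun y => S.momentumFlux t y - S.surfStress ΩA t y) x i =
        tdiv (ΩA t) (fun y => S.momentum t y i • S.v t y -
          S.stressAlong (normalExt (φ t) y) t y i) x := by
      refine Finset.sum_congr rfl fun j _ => tpd_congr (fun y hy => ?_) hx j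
      simp only [surfStress_eq hS hd hy, momentumFlux, Fluid.momentum, Matrix.sub_apply,
        Matrix.smul_apply, Pi.sub_apply, Pi.smul_apply, vecMulVec_apply, smul_eq_mul]
      ring
    rw [h3, hd.tdiv_sub (V := fun y => S.momentum t y i • S.v t y)
      (fun j => hm.fun_mul (hv j)) hs hx]
    linear_combination h1 + h2

/-! ### The power transmitted through the interface -/

theorem projAlong_mulVec_eq (n v : Vec3) : projAlong n *ᵥ v = v - (v ⬝ᵥ n) • n := by
  rw [projAlong, sub_mulVec, one_mulVec, vecMulVec_mulVec, dotProduct_comm,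
    op_smul_eq_smul]

theorem mulVec_dotProduct_of_isSymm {M : Mat3} (hM : M.IsSymm) (v w : Vec3) :
    (M *ᵥ v) ⬝ᵥ w = (M *ᵥ w) ⬝ᵥ v := by
  rw [dotProduct_comm, dotProduct_mulVec, ← mulVec_transpose, hM.eq]

theorem strain_mulVec_dotProduct (V : E3 → Vec3) (x : E3) (n : Vec3) :
    (strain V x *ᵥ n) ⬝ᵥ n = n ⬝ᵥ (jac V x *ᵥ n) := by
  rw [strain, smul_mulVec, add_mulVec, smul_dotProduct, add_dotProduct, mulVec_transpose,
    ← dotProduct_mulVec, dotProduct_comm (jac V x *ᵥ n), smul_eq_mul]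
  ring

/-- For `r = 0` the bulk velocity is `(w · n) n`, and the interface scalar is exactly `𝒯 n · n`
because the strain contributes `n · (n · ∇) v`. For `r = 1` the bulk velocity equals `w`, and
symmetry of the stress moves it across. -/
theorem interfaceStress_power {r : ℕ} (hr : r = 0 ∨ r = 1) {U : ℝ → Set E3} {F : Fluid} {t : ℝ}
    {x : E3} {w : Vec3} (hn : outerNormal (U t) x ⬝ᵥ outerNormal (U t) x = 1)
    (hnorm : F.v t x ⬝ᵥ outerNormal (U t) x = w ⬝ᵥ outerNormal (U t) x)
    (htan : tproj (U t) x *ᵥ F.v t x = (r : ℝ) • (tproj (U t) x *ᵥ w)) :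
    (F.interfaceStress r U t x *ᵥ outerNormal (U t) x) ⬝ᵥ w =
      (F.stress t x *ᵥ F.v t x) ⬝ᵥ outerNormal (U t) x := by
  rw [tproj_eq, projAlong_mulVec_eq, projAlong_mulVec_eq, hnorm] at htan
  rcases hr with rfl | rfl
  -- With `r = 0` the tangential part of the bulk velocity vanishes; with unit normal only the
  -- normal part is left.
  · have hv : F.v t x = (w ⬝ᵥ outerNormal (U t) x) • outerNormal (U t) x := by
      simpa [sub_eq_zero] using htan
    rw [interfaceStress, if_pos rfl, hv, mulVec_smul, smul_dotProduct, smul_mulVec, one_mulVec,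
      smul_dotProduct, stress, sub_mulVec, add_mulVec, smul_mulVec, smul_mulVec, smul_mulVec,
      one_mulVec, sub_dotProduct, add_dotProduct, smul_dotProduct, smul_dotProduct,
      smul_dotProduct, hn, strain_mulVec_dotProduct, dotProduct_comm _ w]
    simp only [smul_eq_mul]
    ring
  · have hv : F.v t x = w := by simpa using htan
    rw [interfaceStress, if_neg one_ne_zero, hv]
    exact mulVec_dotProduct_of_isSymm (F.stress_isSymm t x) _ _

namespace BoundaryConditions

variable {T : ℝ} {r : ℕ} {Ω : Set E3} {ΩA : ℝ → Set E3} {A B S : Fluid}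
  (h : BoundaryConditions T r Ω ΩA A B S) (hr : r = 0 ∨ r = 1) {t : ℝ} (ht : t ∈ Ioo 0 T)

include h hr ht

theorem tractionJump_power {φ : E3 → ℝ} (hφ : IsDefining (ΩA t) φ) {x : E3}
    (hx : x ∈ frontier (ΩA t)) :
    tractionJump r ΩA A B t x ⬝ᵥ S.v t x =
      (B.stress t x *ᵥ B.v t x) ⬝ᵥ outerNormal (ΩA t) x -
        (A.stress t x *ᵥ A.v t x) ⬝ᵥ outerNormal (ΩA t) x := by
  have hn := hφ.outerNormal_dotProduct_self hx
  rw [tractionJump, sub_dotProduct,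
    interfaceStress_power hr hn (h.normal_B t ht x hx) (h.tangential_B t ht x hx),
    interfaceStress_power hr hn ((h.normal_A t ht x hx).trans (h.normal_B t ht x hx))
      ((h.tangential_A t ht x hx).trans (h.tangential_B t ht x hx))]

end BoundaryConditions

/-! ### Integrated balances -/

namespace IsMovingDefining

variable {T : ℝ} {Ω : Set E3} {ΩA : ℝ → Set E3} {ψ : E3 → ℝ} {φ : ℝ → E3 → ℝ}
  (h : IsMovingDefining T Ω ΩA ψ φ)

include h

theorem integrableOn_inner {t : ℝ} (ht : t ∈ Ico 0 T) {u : ℝ → E3 → ℝ}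
    (hu : SmoothOver (Ico 0 T) u) : IntegrableOn (u t) (ΩA t) :=
  (h.inner t ht).integrableOn_of_continuous (hu.at_time ht).continuous

theorem integrableOn_phaseB {t : ℝ} (ht : t ∈ Ico 0 T) {u : ℝ → E3 → ℝ}
    (hu : SmoothOver (Ico 0 T) u) : IntegrableOn (u t) (phaseB Ω ΩA t) :=
  (h.outer.integrableOn_of_continuous (hu.at_time ht).continuous).mono_set sdiff_subset

theorem integrableOn_surface {t : ℝ} (ht : t ∈ Ico 0 T) {u : ℝ → E3 → ℝ}
    (hu : SmoothOver (Ico 0 T) u) : IntegrableOn (u t) (frontier (ΩA t)) μHE[2] :=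
  (h.inner t ht).integrableOn_frontier (hu.at_time ht).continuous.continuousOn

/-- The time-integrated form of `hasDerivAt_total`. Bulk fluxes are smooth for all times, whereas
the surface flux involves the extended normal and is smooth only for times in `[0, T)`. -/
theorem total_sub_total {vA vB vS : ℝ → E3 → Vec3} (hflow : IsFlowedBy T Ω ΩA vA vB vS)
    {gA gB gS sA sB sS jump : ℝ → E3 → ℝ} {WA WB WS : ℝ → E3 → Vec3}
    (hgA : SmoothOver univ gA) (hgB : SmoothOver univ gB) (hgS : SmoothOver univ gS)
    (hWA : ∀ i, SmoothOver univ fun t x => WA t x i)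
    (hWB : ∀ i, SmoothOver univ fun t x => WB t x i)
    (hWS : ∀ i, SmoothOver (Ico 0 T) fun t x => WS t x i)
    (hsA : SmoothOver (Ico 0 T) sA) (hsB : SmoothOver (Ico 0 T) sB)
    (hsS : SmoothOver (Ico 0 T) sS)
    (hA : ∀ t ∈ Ioo 0 T, ∀ x ∈ ΩA t,
      matD vA gA t x + div (vA t) x * gA t x = div (WA t) x + sA t x)
    (hB : ∀ t ∈ Ioo 0 T, ∀ x ∈ phaseB Ω ΩA t,
      matD vB gB t x + div (vB t) x * gB t x = div (WB t) x + sB t x)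
    (hS : ∀ t ∈ Ioo 0 T, ∀ x ∈ frontier (ΩA t),
      matD vS gS t x + tdiv (ΩA t) (vS t) x * gS t x =
        tdiv (ΩA t) (WS t) x + jump t x + sS t x)
    (hjump : ∀ t ∈ Ioo 0 T, ∀ x ∈ frontier (ΩA t), jump t x =
      WB t x ⬝ᵥ outerNormal (ΩA t) x - WA t x ⬝ᵥ outerNormal (ΩA t) x)
    (htan : ∀ t ∈ Ioo 0 T, ∀ x ∈ frontier (ΩA t), WS t x ⬝ᵥ outerNormal (ΩA t) x = 0)
    (hout : ∀ t ∈ Ioo 0 T, ∫ x in frontier Ω, WB t x ⬝ᵥ outerNormal Ω x ∂μHE[2] = 0)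
    {t₁ t₂ : ℝ} (h1 : 0 ≤ t₁) (h12 : t₁ ≤ t₂) (h2 : t₂ < T) :
    ((∫ x in ΩA t₂, gA t₂ x) + (∫ x in phaseB Ω ΩA t₂, gB t₂ x) +
        ∫ x in frontier (ΩA t₂), gS t₂ x ∂μHE[2]) -
      ((∫ x in ΩA t₁, gA t₁ x) + (∫ x in phaseB Ω ΩA t₁, gB t₁ x) +
        ∫ x in frontier (ΩA t₁), gS t₁ x ∂μHE[2]) =
      ∫ t in t₁..t₂, ((∫ x in ΩA t, sA t x) + (∫ x in phaseB Ω ΩA t, sB t x) +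
        ∫ x in frontier (ΩA t), sS t x ∂μHE[2]) := by
  refine (integral_eq_sub_of_continuousOn_Ico
    (h.continuousOn_total (hgA.mono (subset_univ _)).continuousOn
      (hgB.mono (subset_univ _)).continuousOn (hgS.mono (subset_univ _)))
    (h.continuousOn_total hsA.continuousOn hsB.continuousOn hsS) (fun t ht => ?_) h1 h12 h2).symm
  have htI : t ∈ Ico 0 T := ⟨ht.1.le, ht.2⟩
  exact h.hasDerivAt_total hflow hgA.contDiff hgB.contDiff hgS.contDiff ht
    (fun i => (hWA i).at_time (mem_univ t)) (fun i => (hWB i).at_time (mem_univ t))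
    (fun i => (hWS i).at_time htI) (hsA.at_time htI).continuous (hsB.at_time htI).continuous
    (hsS.at_time htI).continuous.continuousOn (hA t ht) (hB t ht) (hS t ht) (hjump t ht)
    (htan t ht) (hout t ht)

theorem total_eq_total {vA vB vS : ℝ → E3 → Vec3} (hflow : IsFlowedBy T Ω ΩA vA vB vS)
    {gA gB gS jump : ℝ → E3 → ℝ} {WA WB WS : ℝ → E3 → Vec3}
    (hgA : SmoothOver univ gA) (hgB : SmoothOver univ gB) (hgS : SmoothOver univ gS)
    (hWA : ∀ i, SmoothOver univ fun t x => WA t x i)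
    (hWB : ∀ i, SmoothOver univ fun t x => WB t x i)
    (hWS : ∀ i, SmoothOver (Ico 0 T) fun t x => WS t x i)
    (hA : ∀ t ∈ Ioo 0 T, ∀ x ∈ ΩA t, matD vA gA t x + div (vA t) x * gA t x = div (WA t) x)
    (hB : ∀ t ∈ Ioo 0 T, ∀ x ∈ phaseB Ω ΩA t,
      matD vB gB t x + div (vB t) x * gB t x = div (WB t) x)
    (hS : ∀ t ∈ Ioo 0 T, ∀ x ∈ frontier (ΩA t),
      matD vS gS t x + tdiv (ΩA t) (vS t) x * gS t x = tdiv (ΩA t) (WS t) x + jump t x)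
    (hjump : ∀ t ∈ Ioo 0 T, ∀ x ∈ frontier (ΩA t), jump t x =
      WB t x ⬝ᵥ outerNormal (ΩA t) x - WA t x ⬝ᵥ outerNormal (ΩA t) x)
    (htan : ∀ t ∈ Ioo 0 T, ∀ x ∈ frontier (ΩA t), WS t x ⬝ᵥ outerNormal (ΩA t) x = 0)
    (hout : ∀ t ∈ Ioo 0 T, ∫ x in frontier Ω, WB t x ⬝ᵥ outerNormal Ω x ∂μHE[2] = 0)
    {t₁ t₂ : ℝ} (h1 : 0 ≤ t₁) (h12 : t₁ ≤ t₂) (h2 : t₂ < T) :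
    (∫ x in ΩA t₂, gA t₂ x) + (∫ x in phaseB Ω ΩA t₂, gB t₂ x) +
        ∫ x in frontier (ΩA t₂), gS t₂ x ∂μHE[2] =
      (∫ x in ΩA t₁, gA t₁ x) + (∫ x in phaseB Ω ΩA t₁, gB t₁ x) +
        ∫ x in frontier (ΩA t₁), gS t₁ x ∂μHE[2] := by
  refine sub_eq_zero.1 ((h.total_sub_total hflow hgA hgB hgS hWA hWB hWS (sA := fun _ _ => 0)
    (sB := fun _ _ => 0) (sS := fun _ _ => 0) (.const 0) (.const 0) (.const 0)
    (fun t ht x hx => ?_) (fun t ht x hx => ?_) (fun t ht x hx => ?_) hjump htan hout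
    h1 h12 h2).trans (by simp))
  · rw [hA t ht x hx, add_zero]
  · rw [hB t ht x hx, add_zero]
  · rw [hS t ht x hx, add_zero]

end IsMovingDefining

/-! ### Global conservation laws -/

section Conservation

variable {T : ℝ} {r : ℕ} {Ω : Set E3} {ΩA : ℝ → Set E3} {A B S : Fluid} {ψ : E3 → ℝ}
  {φ : ℝ → E3 → ℝ} (h : IsMovingDefining T Ω ΩA ψ φ) (hr : r = 0 ∨ r = 1)
  (hA : A.Smooth) (hB : B.Smooth) (hS : S.Smooth)
  (hflow : IsFlowedBy T Ω ΩA A.v B.v S.v) (hbc : BoundaryConditions T r Ω ΩA A B S)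
  (hsys : SolvesSystem T r Ω ΩA A B S)
  {t₁ t₂ : ℝ} (h1 : 0 ≤ t₁) (h12 : t₁ ≤ t₂) (h2 : t₂ < T)

include h hA hB hS hflow hsys h1 h12 h2

theorem mass_conservation :
    (∫ x in ΩA t₂, A.ρ t₂ x) + (∫ x in phaseB Ω ΩA t₂, B.ρ t₂ x) +
        (∫ x in frontier (ΩA t₂), S.ρ t₂ x ∂μHE[2]) =
      (∫ x in ΩA t₁, A.ρ t₁ x) + (∫ x in phaseB Ω ΩA t₁, B.ρ t₁ x) +
        (∫ x in frontier (ΩA t₁), S.ρ t₁ x ∂μHE[2]) := by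
  have hz : ∀ {I : Set ℝ} (i : Fin 3), SmoothOver I fun _ _ => (0 : Vec3) i := fun _ => .const _
  have hd : ∀ x, div (fun _ => (0 : Vec3)) x = 0 := fun x => by simp [div, pd_const]
  refine h.total_eq_total hflow (WA := fun _ _ => 0) (WB := fun _ _ => 0) (WS := fun _ _ => 0)
    (jump := fun _ _ => 0) (.of_contDiff hA.ρ) (.of_contDiff hB.ρ) (.of_contDiff hS.ρ) hz hz hz
    (fun t ht x hx => ?_) (fun t ht x hx => ?_) (fun t ht x hx => ?_) (by simp) (by simp) (by simp)
    h1 h12 h2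
  · rw [hsys.inA.mass t ht x hx, hd]
  · rw [hsys.inB.mass t ht x hx, hd]
  · rw [hsys.onS.mass t ht x hx]
    simp [tdiv, tpd_const]

/-- Each component is a scalar balance whose fluxes are the rows of the stress tensors; the surface
row is tangential because the surface stress annihilates `n`. -/
theorem momentum_conservation (hr1 : r = 1)
    (hout : ∀ t ∈ Ioo 0 T, ∫ x in frontier Ω, B.stress t x *ᵥ outerNormal Ω x ∂μHE[2] = 0) :
    (∫ x in ΩA t₂, A.momentum t₂ x) + (∫ x in phaseB Ω ΩA t₂, B.momentum t₂ x) +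
        (∫ x in frontier (ΩA t₂), S.momentum t₂ x ∂μHE[2]) =
      (∫ x in ΩA t₁, A.momentum t₁ x) + (∫ x in phaseB Ω ΩA t₁, B.momentum t₁ x) +
        (∫ x in frontier (ΩA t₁), S.momentum t₁ x ∂μHE[2]) := by
  have ht1 : t₁ ∈ Ico 0 T := ⟨h1, h12.trans_lt h2⟩
  have ht2 : t₂ ∈ Ico 0 T := ⟨h1.trans h12, h2⟩
  have hsm : ∀ {F : Fluid}, F.Smooth → ∀ i, SmoothOver (Ico 0 T) fun t x => F.momentum t x i :=
    fun hF i => hF.smoothOver_momentum _ i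
  funext i
  simp only [Pi.add_apply]
  rw [eval_integral fun i => h.integrableOn_inner ht2 (hsm hA i),
    eval_integral fun i => h.integrableOn_phaseB ht2 (hsm hB i),
    eval_integral fun i => h.integrableOn_surface ht2 (hsm hS i),
    eval_integral fun i => h.integrableOn_inner ht1 (hsm hA i),
    eval_integral fun i => h.integrableOn_phaseB ht1 (hsm hB i),
    eval_integral fun i => h.integrableOn_surface ht1 (hsm hS i)]
  refine h.total_eq_total hflow (gA := fun t x => A.momentum t x i)
    (gB := fun t x => B.momentum t x i) (gS := fun t x => S.momentum t x i)
    (WA := fun t x => A.stress t x i) (WB := fun t x => B.stress t x i)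
    (WS := fun t x => S.stressAlong (normalExt (φ t) x) t x i)
    (jump := fun t x => tractionJump r ΩA A B t x i)
    (hA.smoothOver_momentum _ i) (hB.smoothOver_momentum _ i) (hS.smoothOver_momentum _ i)
    (hA.smoothOver_stress _ i) (hB.smoothOver_stress _ i)
    (hS.smoothOver_stressAlong h.smoothOver_normalExt i)
    (fun t ht x hx => hsys.inA.momentum_balance hA ht hx i)
    (fun t ht x hx => hsys.inB.momentum_balance hB ht hx i) (fun t ht x hx => ?_)
    (fun t ht x hx => ?_) (fun t ht x hx => ?_) (fun t ht => ?_) h1 h12 h2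
  · rw [hsys.onS.momentum_balance hS ht hx i, tdiv_congr (V := fun y => S.surfStress ΩA t y i)
      (W := fun y => S.stressAlong (normalExt (φ t) y) t y i)
      (fun y hy => congrFun (surfStress_eq hS (h.inner t ⟨ht.1.le, ht.2⟩) hy) i) hx]
  -- With `r = 1` the interface stress is the full stress, so the traction jump is literally the
  -- jump of the row fluxes.
  · simp only [tractionJump, interfaceStress, hr1, if_neg one_ne_zero]
    rfl
  · have hd := h.inner t ⟨ht.1.le, ht.2⟩
    have hn := hd.outerNormal_dotProduct_self hx
    rw [← hd.outerNormal_eq hx]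
    exact congrFun (stressAlong_mulVec hn t x) i
  -- The outer condition is an identity between vector integrals; integrability of each component
  -- allows evaluating it componentwise.
  · have h3 := congrFun (hout t ht) i
    rw [eval_integral fun j => h.outer.integrableOn_frontier ?_] at h3
    · exact h3
    · change ContinuousOn (fun x => ∑ k, B.stress t x j k * outerNormal Ω x k) _
      exact continuousOn_finsetSum _ fun k _ =>
        ((hB.smoothOver_stress univ j k).at_time (mem_univ t)).continuous.continuousOn.mul
          (continuousOn_pi.1 h.outer.continuousOn_outerNormal k)

include hr hbc

/-- The flux is `q + 𝒯 v` in every phase. The heat fluxes match the heat jump by definition, and the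
stress powers match by `tractionJump_power`. -/
theorem energy_conservation :
    (∫ x in ΩA t₂, A.energy t₂ x) + (∫ x in phaseB Ω ΩA t₂, B.energy t₂ x) +
        (∫ x in frontier (ΩA t₂), S.energy t₂ x ∂μHE[2]) =
      (∫ x in ΩA t₁, A.energy t₁ x) + (∫ x in phaseB Ω ΩA t₁, B.energy t₁ x) +
        (∫ x in frontier (ΩA t₁), S.energy t₁ x ∂μHE[2]) := by
  have hN := h.smoothOver_normalExt
  refine h.total_eq_total hflow (WA := fun t x => A.heat t x + A.stress t x *ᵥ A.v t x)
    (WB := fun t x => B.heat t x + B.stress t x *ᵥ B.v t x)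
    (WS := fun t x => S.heatAlong (normalExt (φ t) x) t x +
      S.stressAlong (normalExt (φ t) x) t x *ᵥ S.v t x)
    (jump := fun t x => tractionJump r ΩA A B t x ⬝ᵥ S.v t x + heatJump ΩA A B t x)
    (hA.smoothOver_energy _) (hB.smoothOver_energy _) (hS.smoothOver_energy _)
    (fun i => (hA.smoothOver_heat _ i).add (hA.smoothOver_stress_mulVec _ i))
    (fun i => (hB.smoothOver_heat _ i).add (hB.smoothOver_stress_mulVec _ i))
    (fun i => (hS.smoothOver_heatAlong hN i).add (hS.smoothOver_stressAlong_mulVec hN i))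
    (fun t ht x hx => hsys.inA.energy_balance hA ht hx)
    (fun t ht x hx => hsys.inB.energy_balance hB ht hx) (fun t ht x hx => ?_)
    (fun t ht x hx => ?_) (fun t ht x hx => ?_) (fun t ht => ?_) h1 h12 h2
  · have htI : t ∈ Ico 0 T := ⟨ht.1.le, ht.2⟩
    have hd := h.inner t htI
    rw [hsys.onS.energy_balance hS ht hd hx,
      hd.tdiv_add (fun i => (hS.smoothOver_heatAlong hN i).differentiableAt htI x)
        (fun i => (hS.smoothOver_stressAlong_mulVec hN i).differentiableAt htI x) hx,
      tdiv_congr (fun y hy => surfHeat_eq hS hd hy) hx,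
      tdiv_congr (V := fun y => S.surfStress ΩA t y *ᵥ S.v t y)
        (W := fun y => S.stressAlong (normalExt (φ t) y) t y *ᵥ S.v t y)
        (fun y hy => by simp only [surfStress_eq hS hd hy]) hx]
  · rw [hbc.tractionJump_power hr ht (h.inner t ⟨ht.1.le, ht.2⟩) hx, heatJump, add_dotProduct,
      add_dotProduct]
    ring
  · have hd := h.inner t ⟨ht.1.le, ht.2⟩
    have hn := hd.outerNormal_dotProduct_self hx
    rw [← hd.outerNormal_eq hx, add_dotProduct, heatAlong_dotProduct hn,
      mulVec_dotProduct_of_isSymm (stressAlong_isSymm _ t x), stressAlong_mulVec hn,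
      zero_dotProduct, add_zero]
  -- On the outer boundary the stress flux vanishes by the no-slip condition and the heat flux by
  -- the Neumann condition.
  · refine setIntegral_eq_zero_of_forall_eq_zero fun x hx => ?_
    rw [hbc.outer_velocity t ht x hx, mulVec_zero, add_zero, heat, smul_dotProduct,
      dotProduct_comm, hbc.outer_temperature t ht x hx, smul_zero]

/-- The flux is `𝒯 v` and the source is pressure work minus dissipation; the latter no longer
cancels, as the internal energy is left out. -/
theorem kinetic_energy_law :
    (∫ x in ΩA t₂, A.kinetic t₂ x) + (∫ x in phaseB Ω ΩA t₂, B.kinetic t₂ x) +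
        (∫ x in frontier (ΩA t₂), S.kinetic t₂ x ∂μHE[2]) +
        (∫ t in t₁..t₂, ∫ x in ΩA t, A.dissip t x) +
        (∫ t in t₁..t₂, ∫ x in phaseB Ω ΩA t, B.dissip t x) +
        (∫ t in t₁..t₂, ∫ x in frontier (ΩA t), S.surfDissip ΩA t x ∂μHE[2]) =
      (∫ x in ΩA t₁, A.kinetic t₁ x) + (∫ x in phaseB Ω ΩA t₁, B.kinetic t₁ x) +
        (∫ x in frontier (ΩA t₁), S.kinetic t₁ x ∂μHE[2]) +
        (∫ t in t₁..t₂, ∫ x in ΩA t, div (A.v t) x * A.π t x) +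
        (∫ t in t₁..t₂, ∫ x in phaseB Ω ΩA t, div (B.v t) x * B.π t x) +
        (∫ t in t₁..t₂, ∫ x in frontier (ΩA t),
          tdiv (ΩA t) (S.v t) x * S.π t x ∂μHE[2]) := by
  have hN := h.smoothOver_normalExt
  have hpv : ∀ {F : Fluid}, F.Smooth →
      SmoothOver (Ico 0 T) fun t x => div (F.v t) x * F.π t x := fun hF =>
    (hF.smoothOver_div _).mul (.of_contDiff hF.π)
  have hdi : ∀ {F : Fluid}, F.Smooth → SmoothOver (Ico 0 T) F.dissip := fun hF =>
    hF.smoothOver_dissip _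
  have hpS : SmoothOver (Ico 0 T) fun t x => S.divAlong (normalExt (φ t) x) t x * S.π t x :=
    (hS.smoothOver_divAlong hN).mul (.of_contDiff hS.π)
  have hdS := hS.smoothOver_dissipAlong hN
  have key := h.total_sub_total hflow (WA := fun t x => A.stress t x *ᵥ A.v t x)
    (WB := fun t x => B.stress t x *ᵥ B.v t x)
    (WS := fun t x => S.stressAlong (normalExt (φ t) x) t x *ᵥ S.v t x)
    (jump := fun t x => tractionJump r ΩA A B t x ⬝ᵥ S.v t x)
    (hA.smoothOver_kinetic _) (hB.smoothOver_kinetic _) (hS.smoothOver_kinetic _)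
    (hA.smoothOver_stress_mulVec _) (hB.smoothOver_stress_mulVec _)
    (hS.smoothOver_stressAlong_mulVec hN) ((hpv hA).sub (hdi hA)) ((hpv hB).sub (hdi hB))
    (hpS.sub hdS)
    (fun t ht x hx => hsys.inA.kinetic_balance hA ht hx)
    (fun t ht x hx => hsys.inB.kinetic_balance hB ht hx) (fun t ht x hx => ?_)
    (fun t ht x hx => hbc.tractionJump_power hr ht (h.inner t ⟨ht.1.le, ht.2⟩) hx)
    (fun t ht x hx => ?_) (fun t ht => ?_) h1 h12 h2
  · have hII : ∀ {u : ℝ → ℝ}, ContinuousOn u (Ico 0 T) → IntervalIntegrable u volume t₁ t₂ :=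
      fun hu => intervalIntegrable_of_continuousOn_Ico hu h1 h12 h2
    have iA := hII (h.continuousOn_integral_inner
      (G := fun t x => div (A.v t) x * A.π t x) (hpv hA).continuousOn)
    have iA' := hII (h.continuousOn_integral_inner (hdi hA).continuousOn)
    have iB := hII (h.continuousOn_integral_phaseB
      (G := fun t x => div (B.v t) x * B.π t x) (hpv hB).continuousOn)
    have iB' := hII (h.continuousOn_integral_phaseB (hdi hB).continuousOn)
    have iS := hII (h.continuousOn_integral_surface hpS)
    have iS' := hII (h.continuousOn_integral_surface hdS)
    have hmem : ∀ t ∈ uIcc t₁ t₂, t ∈ Ico 0 T := fun t ht => by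
      rw [uIcc_of_le h12] at ht
      exact ⟨h1.trans ht.1, ht.2.trans_lt h2⟩
    have eS : ∫ t in t₁..t₂, ∫ x in frontier (ΩA t), tdiv (ΩA t) (S.v t) x * S.π t x ∂μHE[2] =
        ∫ t in t₁..t₂, ∫ x in frontier (ΩA t),
          S.divAlong (normalExt (φ t) x) t x * S.π t x ∂μHE[2] :=
      intervalIntegral.integral_congr fun t ht =>
        setIntegral_congr_fun isClosed_frontier.measurableSet fun x hx => by
          simp only [tdiv_v_eq hS (h.inner t (hmem t ht)) hx]
    have eS' : ∫ t in t₁..t₂, ∫ x in frontier (ΩA t), S.surfDissip ΩA t x ∂μHE[2] =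
        ∫ t in t₁..t₂, ∫ x in frontier (ΩA t),
          S.dissipAlong (normalExt (φ t) x) t x ∂μHE[2] :=
      intervalIntegral.integral_congr fun t ht =>
        setIntegral_congr_fun isClosed_frontier.measurableSet fun x hx =>
          surfDissip_eq hS (h.inner t (hmem t ht)) hx
    -- Separating the source into six time integrals needs each spatial integral to be interval
    -- integrable in time, which its continuity on `[0, T)` provides.
    rw [intervalIntegral.integral_congr (g := fun t =>
      (((∫ x in ΩA t, div (A.v t) x * A.π t x) - ∫ x in ΩA t, A.dissip t x) +
        ((∫ x in phaseB Ω ΩA t, div (B.v t) x * B.π t x) - ∫ x in phaseB Ω ΩA t, B.dissip t x)) +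
        ((∫ x in frontier (ΩA t), S.divAlong (normalExt (φ t) x) t x * S.π t x ∂μHE[2]) -
          ∫ x in frontier (ΩA t), S.dissipAlong (normalExt (φ t) x) t x ∂μHE[2])) (fun t ht => ?_),
      intervalIntegral.integral_add ((iA.sub iA').add (iB.sub iB')) (iS.sub iS'),
      intervalIntegral.integral_add (iA.sub iA') (iB.sub iB'), intervalIntegral.integral_sub iA iA',
      intervalIntegral.integral_sub iB iB', intervalIntegral.integral_sub iS iS'] at key
    · rw [eS, eS']
      linear_combination key
    · have htI := hmem t ht
      beta_reduce
      rw [integral_sub (h.integrableOn_inner htI (hpv hA)) (h.integrableOn_inner htI (hdi hA)),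
        integral_sub (h.integrableOn_phaseB htI (hpv hB)) (h.integrableOn_phaseB htI (hdi hB)),
        integral_sub (h.integrableOn_surface htI hpS) (h.integrableOn_surface htI hdS)]
  · have hd := h.inner t ⟨ht.1.le, ht.2⟩
    rw [hsys.onS.kinetic_balance hS ht hd hx,
      tdiv_congr (V := fun y => S.surfStress ΩA t y *ᵥ S.v t y)
        (W := fun y => S.stressAlong (normalExt (φ t) y) t y *ᵥ S.v t y)
        (fun y hy => by simp only [surfStress_eq hS hd hy]) hx, tdiv_v_eq hS hd hx,
      surfDissip_eq hS hd hx]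
  · have hd := h.inner t ⟨ht.1.le, ht.2⟩
    have hn := hd.outerNormal_dotProduct_self hx
    rw [← hd.outerNormal_eq hx, mulVec_dotProduct_of_isSymm (stressAlong_isSymm _ t x),
      stressAlong_mulVec hn, zero_dotProduct]
  · refine setIntegral_eq_zero_of_forall_eq_zero fun x hx => ?_
    rw [hbc.outer_velocity t ht x hx, mulVec_zero, zero_dotProduct]

end Conservation

end TwoPhaseSurfaceFlow

/-! ### The theorem -/

open TwoPhaseSurfaceFlow in
theorem theorem2p8 (T : ℝ) (Ω : Set E3) (ΩA : ℝ → Set E3) (hgeo : IsMovingGeometry T Ω ΩA)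
    (r : ℕ) (hr : r = 0 ∨ r = 1) (A B S : Fluid)
    (hA : A.Smooth) (hB : B.Smooth) (hS : S.Smooth) :
    -- (i) conservative forms
    (SolvesSystem T r Ω ΩA A B S →
      ConservativeBulk T ΩA A ∧ ConservativeBulk T (phaseB Ω ΩA) B ∧
        ConservativeSurface T r ΩA A B S) ∧
    -- (ii) conservation of mass and of total energy, and the kinetic energy law
    (IsFlowedBy T Ω ΩA A.v B.v S.v → BoundaryConditions T r Ω ΩA A B S →
      SolvesSystem T r Ω ΩA A B S →
      ∀ t₁ t₂ : ℝ, 0 ≤ t₁ → t₁ < t₂ → t₂ < T →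
        ((∫ x in ΩA t₂, A.ρ t₂ x) + (∫ x in phaseB Ω ΩA t₂, B.ρ t₂ x) +
            (∫ x in frontier (ΩA t₂), S.ρ t₂ x ∂μHE[2]) =
          (∫ x in ΩA t₁, A.ρ t₁ x) + (∫ x in phaseB Ω ΩA t₁, B.ρ t₁ x) +
            (∫ x in frontier (ΩA t₁), S.ρ t₁ x ∂μHE[2])) ∧
        ((∫ x in ΩA t₂, A.energy t₂ x) + (∫ x in phaseB Ω ΩA t₂, B.energy t₂ x) +
            (∫ x in frontier (ΩA t₂), S.energy t₂ x ∂μHE[2]) =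
          (∫ x in ΩA t₁, A.energy t₁ x) + (∫ x in phaseB Ω ΩA t₁, B.energy t₁ x) +
            (∫ x in frontier (ΩA t₁), S.energy t₁ x ∂μHE[2])) ∧
        ((∫ x in ΩA t₂, A.kinetic t₂ x) + (∫ x in phaseB Ω ΩA t₂, B.kinetic t₂ x) +
            (∫ x in frontier (ΩA t₂), S.kinetic t₂ x ∂μHE[2]) +
            (∫ t in t₁..t₂, ∫ x in ΩA t, A.dissip t x) +
            (∫ t in t₁..t₂, ∫ x in phaseB Ω ΩA t, B.dissip t x) +
            (∫ t in t₁..t₂, ∫ x in frontier (ΩA t), S.surfDissip ΩA t x ∂μHE[2]) =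
          (∫ x in ΩA t₁, A.kinetic t₁ x) + (∫ x in phaseB Ω ΩA t₁, B.kinetic t₁ x) +
            (∫ x in frontier (ΩA t₁), S.kinetic t₁ x ∂μHE[2]) +
            (∫ t in t₁..t₂, ∫ x in ΩA t, div (A.v t) x * A.π t x) +
            (∫ t in t₁..t₂, ∫ x in phaseB Ω ΩA t, div (B.v t) x * B.π t x) +
            (∫ t in t₁..t₂, ∫ x in frontier (ΩA t),
              tdiv (ΩA t) (S.v t) x * S.π t x ∂μHE[2]))) ∧
    -- (iii) conservation of momentum
    (r = 1 →
      (∀ t ∈ Ioo 0 T, ∫ x in frontier Ω, B.stress t x *ᵥ outerNormal Ω x ∂μHE[2] = 0) →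
      IsFlowedBy T Ω ΩA A.v B.v S.v → BoundaryConditions T r Ω ΩA A B S →
      SolvesSystem T r Ω ΩA A B S →
      ∀ t₁ t₂ : ℝ, 0 ≤ t₁ → t₁ < t₂ → t₂ < T →
        (∫ x in ΩA t₂, A.momentum t₂ x) + (∫ x in phaseB Ω ΩA t₂, B.momentum t₂ x) +
            (∫ x in frontier (ΩA t₂), S.momentum t₂ x ∂μHE[2]) =
          (∫ x in ΩA t₁, A.momentum t₁ x) + (∫ x in phaseB Ω ΩA t₁, B.momentum t₁ x) +
            (∫ x in frontier (ΩA t₁), S.momentum t₁ x ∂μHE[2])) := by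
  obtain ⟨ψ, φ, h⟩ := hgeo.exists_defining
  refine ⟨fun hsys => ⟨hsys.inA.conservative hA, hsys.inB.conservative hB,
    hsys.onS.conservative h hS⟩, fun hflow hbc hsys t₁ t₂ h1 h12 h2 => ⟨?_, ?_, ?_⟩,
    fun hr1 hout hflow _ hsys t₁ t₂ h1 h12 h2 => ?_⟩
  · exact mass_conservation h hA hB hS hflow hsys h1 h12.le h2
  · exact energy_conservation h hr hA hB hS hflow hbc hsys h1 h12.le h2
  · exact kinetic_energy_law h hr hA hB hS hflow hbc hsys h1 h12.le h2
  · exact momentum_conservation h hA hB hS hflow hsys h1 h12.le h2 hr1 hout
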